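/- For strings $T,P$ with $|P|\ge 1$ let $\mathrm{Occ}(T,P)=\{k\ge 1 : T[k:k+|P|-1]=P\}$, and let the non-overlapping frequency $\mathrm{nOcc}(T,P)$ be the maximal size of a set $A\subseteq \mathrm{Occ}(T,P)$ such that $k_1+|P|\le k_2$ for all $k_1<k_2$ in $A$. A straight line program (SLP) of size $n\ge 1$ is a sequence of assignments $X_1=\mathit{expr}_1,\dots,X_n=\mathit{expr}_n$, where each $\mathit{expr}_i$ is either a letter or $X_\ell X_r$ with $\ell,r<i$; it derives the string $T$ obtained by expanding $X_n$. The problem of computing, for an SLP of size $n$ that derives $T$ and an integer $q\ge 1$, the values $\mathrm{nOcc}(T,P)$ for all strings $P$ of length $q$ that occur in $T$ can be solved on a word RAM in $O(q^2n)$ time and $O(qn)$ space (measured in words). Precisely: there is a single word RAM program (unit-cost addition, subtraction, multiplication, division, remainder and comparison of words, branching, and loads and stores with computed addresses) such that for every $c\in\mathbb N$ there is a constant $C$ with the following property. Let an SLP of size $n$ deriving $T$ and an integer $q\ge 1$ be given, where the letters are non-negative integers smaller than $(n+q)^c$ (a polynomial integer alphabet), and let $w$ be a word size such that $|T|<2^w$,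 every letter in the SLP is smaller than $2^w$, and $C\,q\,n\le 2^w$ (so that lengths and positions of $T$, letters, and memory addresses fit in a word). Started with the assignments of the SLP in memory (three words each) and $n,q$ in registers, on a machine with a memory of $C\,q\,n$ words of $w$ bits, holding the input, all working space and the output, the program halts after at most $C\,q^2n$ steps without accessing any address outside that memory. Its output is a table in memory that contains, for every string $P$ of length $q$ that occurs in $T$, exactly one entry, consisting of the address of a copy of $P$ in memory (in $q$ consecutive words) and the number $\mathrm{nOcc}(T,P)$, and that contains no other entries. -/

import Mathlib

/-! ### Occurrences and non-overlapping frequency -/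

/-- The occurrences of `P` in `T`: the (1-based) positions `k` with `T[k : k + |P| - 1] = P`. -/
def Occ {α : Type*} [DecidableEq α] (T P : List α) : Finset ℕ :=
  (Finset.Icc 1 T.length).filter fun k => (T.drop (k - 1)).take P.length = P

/-- Any two distinct positions in `A` are starting positions of non-overlapping
occurrences of a string of length `m`. -/
def NonOverlapping (m : ℕ) (A : Finset ℕ) : Prop :=
  ∀ k₁ ∈ A, ∀ k₂ ∈ A, k₁ < k₂ → k₁ + m ≤ k₂

open Classical in
/-- The non-overlapping frequency of `P` in `T`: the size of a largest subset of `Occ T P`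
in which any two occurrences are non-overlapping. -/
noncomputable def nOcc {α : Type*} [DecidableEq α] (T P : List α) : ℕ :=
  ((Occ T P).powerset.filter (NonOverlapping P.length)).sup Finset.card

/-! ### Straight line programs -/

/-- The right-hand side of the assignment to the variable with (0-based) index `i`: a single
letter, or the concatenation of two variables of smaller index. -/
inductive SLPExpr (α : Type*) (i : ℕ) where
  | letter (a : α) : SLPExpr α i
  | pair (l r : Fin i) : SLPExpr α i

/-- A straight line program: a nonempty sequence of assignments. -/
structure SLP (α : Type*) where
  /-- the number of assignments -/
  size : ℕ
  size_pos : 0 < size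
  rhs : (i : Fin size) → SLPExpr α i

/-- The string derived from the `i`-th variable. -/
def SLP.val {α : Type*} (G : SLP α) (i : Fin G.size) : List α :=
  match G.rhs i with
  | .letter a => [a]
  | .pair l r =>
      G.val ⟨l, l.isLt.trans i.isLt⟩ ++ G.val ⟨r, r.isLt.trans i.isLt⟩
termination_by i.val
decreasing_by
  · exact l.isLt
  · exact r.isLt

/-- The text derived by the program, that is, by its last variable. -/
def SLP.text {α : Type*} (G : SLP α) : List α :=
  G.val ⟨G.size - 1, Nat.sub_one_lt_of_lt G.size_pos⟩

/-! ### The word RAM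

Programs over finitely many registers (those named in the program) and an array of memory
cells, all of which hold `w`-bit words, that is, numbers below `2 ^ w`. -/

namespace WordRAM

/-- The constant-time operations on words. -/
inductive Op where
  | add | sub | mul | div | mod | lt | eq

/-- The value of an operation on `w`-bit words: arithmetic is modulo `2 ^ w`, comparisons
return `1` or `0`. -/
def Op.eval (w : ℕ) : Op → ℕ → ℕ → ℕ
  | .add, a, b => (a + b) % 2 ^ w
  | .sub, a, b => (a + 2 ^ w - b) % 2 ^ w
  | .mul, a, b => (a * b) % 2 ^ w
  | .div, a, b => a / b
  | .mod, a, b => a % b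
  | .lt, a, b => if a < b then 1 % 2 ^ w else 0
  | .eq, a, b => if a = b then 1 % 2 ^ w else 0

/-- Expressions built from constants and registers. -/
inductive Expr where
  | const (k : ℕ)
  | reg (r : ℕ)
  | bin (o : Op) (e₁ e₂ : Expr)

/-- The number of steps needed to evaluate an expression: one for each node. -/
def Expr.cost : Expr → ℕ
  | .const _ => 1
  | .reg _ => 1
  | .bin _ e₁ e₂ => e₁.cost + e₂.cost + 1

/-- The value of an expression when the registers hold `ρ`. -/
def Expr.eval (w : ℕ) (ρ : ℕ → ℕ) : Expr → ℕ
  | .const k => k % 2 ^ w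
  | .reg r => ρ r
  | .bin o e₁ e₂ => o.eval w (e₁.eval w ρ) (e₂.eval w ρ)

/-- Programs. -/
inductive Prog where
  | skip
  /-- `assign d e`: put the value of `e` into register `d` -/
  | assign (d : ℕ) (e : Expr)
  /-- `load d e`: put the content of the memory cell with address `e` into register `d` -/
  | load (d : ℕ) (e : Expr)
  /-- `store e v`: put the value of `v` into the memory cell with address `e` -/
  | store (e v : Expr)
  | seq (p₁ p₂ : Prog)
  /-- `branch e p₁ p₂`: run `p₁` if `e` is nonzero, and `p₂` otherwise -/
  | branch (e : Expr) (p₁ p₂ : Prog)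
  /-- `loop e p`: run `p` as long as `e` is nonzero -/
  | loop (e : Expr) (p : Prog)

/-- A state of the machine: the contents of the registers and of the memory cells. -/
structure State where
  reg : ℕ → ℕ
  mem : ℕ → ℕ

/-- `Exec w S p s t s'`: on a machine with `w`-bit words whose memory consists of the `S`
cells with addresses `0, …, S - 1`, the program `p`, started in state `s`, halts after `t` steps
in state `s'`. There is no execution that accesses a cell with an address outside the memory. -/
inductive Exec (w S : ℕ) : Prog → State → ℕ → State → Prop
  | skip (s : State) : Exec w S .skip s 1 s
  | assign (d : ℕ) (e : Expr) (s : State) :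
      Exec w S (.assign d e) s (e.cost + 1)
        ⟨Function.update s.reg d (e.eval w s.reg), s.mem⟩
  | load (d : ℕ) (e : Expr) (s : State) (h : e.eval w s.reg < S) :
      Exec w S (.load d e) s (e.cost + 1)
        ⟨Function.update s.reg d (s.mem (e.eval w s.reg)), s.mem⟩
  | store (e v : Expr) (s : State) (h : e.eval w s.reg < S) :
      Exec w S (.store e v) s (e.cost + v.cost + 1)
        ⟨s.reg, Function.update s.mem (e.eval w s.reg) (v.eval w s.reg)⟩
  | seq {p₁ p₂ : Prog} {s s₁ s₂ : State} {t₁ t₂ : ℕ}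
      (h₁ : Exec w S p₁ s t₁ s₁) (h₂ : Exec w S p₂ s₁ t₂ s₂) :
      Exec w S (.seq p₁ p₂) s (t₁ + t₂) s₂
  | branch_true {e : Expr} {p₁ p₂ : Prog} {s s' : State} {t : ℕ}
      (he : e.eval w s.reg ≠ 0) (h : Exec w S p₁ s t s') :
      Exec w S (.branch e p₁ p₂) s (e.cost + 1 + t) s'
  | branch_false {e : Expr} {p₁ p₂ : Prog} {s s' : State} {t : ℕ}
      (he : e.eval w s.reg = 0) (h : Exec w S p₂ s t s') :
      Exec w S (.branch e p₁ p₂) s (e.cost + 1 + t) s'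
  | loop_false {e : Expr} {p : Prog} {s : State}
      (he : e.eval w s.reg = 0) :
      Exec w S (.loop e p) s (e.cost + 1) s
  | loop_true {e : Expr} {p : Prog} {s s₁ s₂ : State} {t₁ t₂ : ℕ}
      (he : e.eval w s.reg ≠ 0) (h₁ : Exec w S p s t₁ s₁)
      (h₂ : Exec w S (.loop e p) s₁ t₂ s₂) :
      Exec w S (.loop e p) s (e.cost + 1 + t₁ + t₂) s₂

/-- The three words that encode a right-hand side: `0, a, 0` for a letter `a`, and `1, l, r`
for a pair of variables. -/
def encodeRhs {i : ℕ} : SLPExpr ℕ i → ℕ → ℕ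
  | .letter _, 0 => 0
  | .letter a, 1 => a
  | .letter _, _ => 0
  | .pair _ _, 0 => 1
  | .pair l _, 1 => l
  | .pair _ r, _ => r

/-- The initial state on input `(G, q)`: registers `0` and `1` hold the size of `G` and `q`, cells
`3 * i`, `3 * i + 1`, `3 * i + 2` encode the `i`-th assignment, and everything else is `0`. -/
def input (G : SLP ℕ) (q : ℕ) : State where
  reg := fun r => if r = 0 then G.size else if r = 1 then q else 0
  mem := fun a => if h : a / 3 < G.size then encodeRhs (G.rhs ⟨a / 3, h⟩) (a % 3) else 0

/-- The string of length `q` stored in the memory cells from address `a` on. -/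
def State.gram (s : State) (q a : ℕ) : List ℕ :=
  (List.range q).map fun d => s.mem (a + d)

/-- The output of a halted machine: a list of `m` pairs of a string of length `q` and a number,
where register `1` holds `m` and register `0` holds the address `b` of a table with `2 * m` cells;
the `k`-th pair is given by cell `b + 2 * k`, which holds the address at which the string is stored,
and by cell `b + 2 * k + 1`, which holds the number. -/
def State.output (s : State) (q : ℕ) : List (List ℕ × ℕ) :=
  (List.range (s.reg 1)).map fun k =>
    (s.gram q (s.mem (s.reg 0 + 2 * k)), s.mem (s.reg 0 + 2 * k + 1))

/-- All cells that make up the output have addresses below `S`. -/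
def State.OutputInMemory (s : State) (q S : ℕ) : Prop :=
  ∀ k < s.reg 1, s.reg 0 + 2 * k + 1 < S ∧ s.mem (s.reg 0 + 2 * k) + q ≤ S

/-- `L` lists every string `P` of length `q` that occurs in `T` exactly once, together with the
non-overlapping frequency of `P` in `T`, and it lists nothing else. -/
def ListsFrequencies (T : List ℕ) (q : ℕ) (L : List (List ℕ × ℕ)) : Prop :=
  (L.map Prod.fst).Nodup ∧
    ∀ (P : List ℕ) (f : ℕ), (P, f) ∈ L ↔ P.length = q ∧ (Occ T P).Nonempty ∧ f = nOcc T P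

end WordRAM

/-!
A straight line program is brought into the uniform shape of `ArrayProg.RowSLP`: row `i` derives
`X i = X (lc i) ++ mid i ++ X (rc i)`, where `mid i` has at most one letter. The `q`-grams of `X i`,
read from left to right, are those of the first factor, then those of a window of length less than
`2 * q` around the boundary, then those of the second factor (`grams_append`,
`ArrayProg.grams_row`). All strings of length `q` that occur thus occur in one of `n` windows of
total length `O(q * n)`.

*Greedy selection.* The non-overlapping frequency of `P` is the number of occurrences that are
selected by the leftmost greedy algorithm (`nOcc_eq_count`). This algorithm is an automaton that
reads the `q`-grams one by one; its state is the number `d ≤ q - 1` of upcoming positions that are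
blocked by the occurrence selected last. Entering a string in state `d` instead of `0` costs at most
one selected occurrence (`Greedy.count_interleave`), and the effect of `d` is determined by the last
occurrence of `P` among the first `d` positions, if any (`Greedy.of_no_hit`). A row therefore needs
tables of size `O(q)` only: for each `j < q - 1`, the final state and the loss for the `q`-gram at
position `j` when the first `j + 1` positions are blocked, and for each `q`-gram among the last
`q - 1` ones, the final state of the selection started in state `0` (`ArrayProg.Table`). From these
the selection of an arbitrary `P` in an arbitrary initial state is evaluated in `O(q)` steps
(`ArrayProg.lookup_spec`). The run of the automaton through a row is a run through the table of the
first factor, through the window, and through the table of the second factor, in `O(q)` steps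
(`ArrayProg.walk_spec`), and a row needs `O(q)` of these for its own tables
(`ArrayProg.rowTables_spec`).

*Frequencies.* Let `δ i P` be the frequency of `P` in `X i` minus the frequencies in the two
factors. It vanishes unless `P` occurs in the window of row `i` (`ArrayProg.count_of_notMem`), and
otherwise one run of the automaton yields it, since the frequencies in the factors cancel and only
their losses remain. The frequency of `P` in the whole text is the sum of `δ i P`, weighted with the
number of occurrences of row `i` in the derivation tree. These numbers are propagated from the last
row to the first one (`ArrayProg.freqs_spec`). Intermediate values may be negative or may overflow,
so they are computed modulo the number `2 ^ w` of words; the final values are exact, because a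
frequency is at most `|T| < 2 ^ w`.

*Names.* Comparing two `q`-grams has to take constant time, so each position in the windows gets a
name, such that two positions have the same name if and only if the same `q`-gram starts there
(`ArrayProg.names_spec`). The partition of the positions is refined by one base-`(n + q)` digit of
one letter at a time, with buckets. A letter below `(n + q) ^ c` has at most `c` digits, so that
this takes `O(c * q)` passes of `O(q * n)` steps. The program does not depend on `c`, as it stops at
the leading digit of the largest letter.

The algorithm is written in a small language with arrays, whose runs are simulated on the word RAM
with a constant slowdown (`ArrayProg.Run.simulate`).
-/

set_option linter.unusedSimpArgs false

/-! ### A language with arrays on top of the word RAM -/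

namespace ArrayProg

open WordRAM

/-- Arithmetic expressions over registers. The operations `add`, `sub`, `mul` are exact, and may
only be evaluated where the result is a word (see `HE.ok`); `addW`, `subW`, `mulW` wrap around. -/
inductive HE where
  | const (k : ℕ)
  | reg (r : ℕ)
  | add (a b : HE)
  | sub (a b : HE)
  | mul (a b : HE)
  | div (a b : HE)
  | mod (a b : HE)
  | addW (a b : HE)
  | subW (a b : HE)
  | mulW (a b : HE)

/-- The value of an expression; `W` is the number of words. -/
@[simp] def HE.eval (W : ℕ) (ρ : ℕ → ℕ) : HE → ℕ
  | .const k => k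
  | .reg r => ρ r
  | .add a b => a.eval W ρ + b.eval W ρ
  | .sub a b => a.eval W ρ - b.eval W ρ
  | .mul a b => a.eval W ρ * b.eval W ρ
  | .div a b => a.eval W ρ / b.eval W ρ
  | .mod a b => a.eval W ρ % b.eval W ρ
  | .addW a b => (a.eval W ρ + b.eval W ρ) % W
  | .subW a b => (a.eval W ρ + W - b.eval W ρ) % W
  | .mulW a b => (a.eval W ρ * b.eval W ρ) % W

/-- No exact operation in the expression overflows. -/
@[simp] def HE.ok (W : ℕ) (ρ : ℕ → ℕ) : HE → Prop
  | .const k => k < W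
  | .reg _ => True
  | .add a b => a.ok W ρ ∧ b.ok W ρ ∧ a.eval W ρ + b.eval W ρ < W
  | .sub a b => a.ok W ρ ∧ b.ok W ρ ∧ b.eval W ρ ≤ a.eval W ρ ∧ a.eval W ρ - b.eval W ρ < W
  | .mul a b => a.ok W ρ ∧ b.ok W ρ ∧ a.eval W ρ * b.eval W ρ < W
  | .div a b => a.ok W ρ ∧ b.ok W ρ
  | .mod a b => a.ok W ρ ∧ b.ok W ρ
  | .addW a b => a.ok W ρ ∧ b.ok W ρ
  | .subW a b => a.ok W ρ ∧ b.ok W ρ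
  | .mulW a b => a.ok W ρ ∧ b.ok W ρ

/-- The word RAM expression that computes an `HE`. -/
def HE.compile : HE → Expr
  | .const k => .const k
  | .reg r => .reg r
  | .add a b => .bin .add a.compile b.compile
  | .sub a b => .bin .sub a.compile b.compile
  | .mul a b => .bin .mul a.compile b.compile
  | .div a b => .bin .div a.compile b.compile
  | .mod a b => .bin .mod a.compile b.compile
  | .addW a b => .bin .add a.compile b.compile
  | .subW a b => .bin .sub a.compile b.compile
  | .mulW a b => .bin .mul a.compile b.compile

theorem HE.eval_compile {w : ℕ} {ρ : ℕ → ℕ} {e : HE} (h : e.ok (2 ^ w) ρ) :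
    e.compile.eval w ρ = e.eval (2 ^ w) ρ := by
  induction e with
  | const k => exact Nat.mod_eq_of_lt h
  | reg r => rfl
  | add a b iha ihb =>
    obtain ⟨ha, hb, hab⟩ := h
    simp [compile, Expr.eval, Op.eval, iha ha, ihb hb, Nat.mod_eq_of_lt hab]
  | mul a b iha ihb =>
    obtain ⟨ha, hb, hab⟩ := h
    simp [compile, Expr.eval, Op.eval, iha ha, ihb hb, Nat.mod_eq_of_lt hab]
  | sub a b iha ihb =>
    obtain ⟨ha, hb, hab, hlt⟩ := h
    simp only [compile, Expr.eval, Op.eval, iha ha, ihb hb, eval]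
    rw [Nat.sub_add_comm hab, Nat.add_mod_right, Nat.mod_eq_of_lt hlt]
  | div a b iha ihb => simp [compile, Expr.eval, Op.eval, iha h.1, ihb h.2]
  | mod a b iha ihb => simp [compile, Expr.eval, Op.eval, iha h.1, ihb h.2]
  | addW a b iha ihb => simp [compile, Expr.eval, Op.eval, iha h.1, ihb h.2]
  | subW a b iha ihb => simp [compile, Expr.eval, Op.eval, iha h.1, ihb h.2]
  | mulW a b iha ihb => simp [compile, Expr.eval, Op.eval, iha h.1, ihb h.2]

/-- Programs over registers and numbered arrays. -/
inductive Cmd where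
  | skip
  | set (d : ℕ) (e : HE)
  /-- put entry `e` of array `a` into register `d` -/
  | ld (d a : ℕ) (e : HE)
  /-- put the value of `v` into entry `e` of array `a` -/
  | st (a : ℕ) (e v : HE)
  | seq (p₁ p₂ : Cmd)
  | ifLt (a b : HE) (p₁ p₂ : Cmd)
  | ifEq (a b : HE) (p₁ p₂ : Cmd)
  /-- run `p` as long as `a < b` -/
  | whileLt (a b : HE) (p : Cmd)

/-- Sequential composition. -/
infixr:60 " ;; " => Cmd.seq

/-- Run `p` with register `r` counting from `0` up to the content of register `b`. -/
def Cmd.forUp (r b : ℕ) (p : Cmd) : Cmd :=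
  .set r (.const 0) ;; .whileLt (.reg r) (.reg b) (p ;; .set r (.add (.reg r) (.const 1)))

/-- Entry `e` of array `a` is the memory cell `a * Z + e`, where register `2` holds the common
size `Z` of the arrays. -/
def addr (a : ℕ) (e : HE) : Expr :=
  .bin .add (.bin .mul (.const a) (.reg 2)) e.compile

/-- The word RAM program for a `Cmd`. -/
def Cmd.compile : Cmd → Prog
  | .skip => .skip
  | .set d e => .assign d e.compile
  | .ld d a e => .load d (addr a e)
  | .st a e v => .store (addr a e) v.compile
  | .seq p₁ p₂ => .seq p₁.compile p₂.compile
  | .ifLt a b p₁ p₂ => .branch (.bin .lt a.compile b.compile) p₁.compile p₂.compile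
  | .ifEq a b p₁ p₂ => .branch (.bin .eq a.compile b.compile) p₁.compile p₂.compile
  | .whileLt a b p => .loop (.bin .lt a.compile b.compile) p.compile

/-- A bound on the number of word RAM steps that correspond to one step of a `Cmd`. It depends only
on the text of the program. -/
def Cmd.stepCost : Cmd → ℕ
  | .skip => 1
  | .set _ e => e.compile.cost + 1
  | .ld _ a e => (addr a e).cost + 1
  | .st a e v => (addr a e).cost + v.compile.cost + 1
  | .seq p₁ p₂ => max p₁.stepCost p₂.stepCost
  | .ifLt a b p₁ p₂ => max (a.compile.cost + b.compile.cost + 2) (max p₁.stepCost p₂.stepCost)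
  | .ifEq a b p₁ p₂ => max (a.compile.cost + b.compile.cost + 2) (max p₁.stepCost p₂.stepCost)
  | .whileLt a b p => max (a.compile.cost + b.compile.cost + 2) p.stepCost

/-- The contents of the registers and of the arrays. -/
structure AState where
  reg : ℕ → ℕ
  arr : ℕ → ℕ → ℕ

/-- Change register `d` to `v`. -/
def AState.set (σ : AState) (d v : ℕ) : AState := ⟨Function.update σ.reg d v, σ.arr⟩

/-- Change entry `x` of array `a` to `v`. -/
def AState.put (σ : AState) (a x v : ℕ) : AState :=
  ⟨σ.reg, Function.update σ.arr a (Function.update (σ.arr a) x v)⟩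

@[simp] theorem AState.set_reg (σ : AState) (d v r : ℕ) :
    (σ.set d v).reg r = if r = d then v else σ.reg r := by
  simp [AState.set, Function.update_apply]

@[simp] theorem AState.set_arr (σ : AState) (d v : ℕ) : (σ.set d v).arr = σ.arr := rfl

@[simp] theorem AState.put_reg (σ : AState) (a x v : ℕ) : (σ.put a x v).reg = σ.reg := rfl

theorem AState.put_arr (σ : AState) (a x v b y : ℕ) :
    (σ.put a x v).arr b y = if b = a ∧ y = x then v else σ.arr b y := by
  by_cases h : b = a
  · subst h
    simp [AState.put, Function.update_apply]
  · simp [AState.put, h]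

theorem AState.put_arr_ne (σ : AState) {a x v b : ℕ} (h : b ≠ a) :
    (σ.put a x v).arr b = σ.arr b := by
  simp [AState.put, h]

theorem AState.put_arr_same (σ : AState) (a x v y : ℕ) :
    (σ.put a x v).arr a y = if y = x then v else σ.arr a y := by
  simp [AState.put_arr]

/-- `Run W Z K p σ t σ'`: with words below `W` and `K` arrays of size `Z`, the program `p` leads
from `σ` to `σ'` in `t` steps, without overflow and without leaving the arrays. Register `2` holds
`Z` and must not be assigned. -/
inductive Run (W Z K : ℕ) : Cmd → AState → ℕ → AState → Prop
  | skip (σ) : Run W Z K .skip σ 1 σ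
  | set {d e σ} (hd : d ≠ 2) (he : e.ok W σ.reg) :
      Run W Z K (.set d e) σ 1 (σ.set d (e.eval W σ.reg))
  | ld {d a e σ} (hd : d ≠ 2) (ha : a < K) (he : e.ok W σ.reg) (hx : e.eval W σ.reg < Z) :
      Run W Z K (.ld d a e) σ 1 (σ.set d (σ.arr a (e.eval W σ.reg)))
  | st {a e v σ} (ha : a < K) (he : e.ok W σ.reg) (hx : e.eval W σ.reg < Z)
      (hv : v.ok W σ.reg) :
      Run W Z K (.st a e v) σ 1 (σ.put a (e.eval W σ.reg) (v.eval W σ.reg))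
  | seq {p₁ p₂ σ σ₁ σ₂ t₁ t₂} (h₁ : Run W Z K p₁ σ t₁ σ₁) (h₂ : Run W Z K p₂ σ₁ t₂ σ₂) :
      Run W Z K (.seq p₁ p₂) σ (t₁ + t₂) σ₂
  | ifLt_true {a b p₁ p₂ σ σ' t} (ha : a.ok W σ.reg) (hb : b.ok W σ.reg)
      (h : a.eval W σ.reg < b.eval W σ.reg) (h₁ : Run W Z K p₁ σ t σ') :
      Run W Z K (.ifLt a b p₁ p₂) σ (1 + t) σ'
  | ifLt_false {a b p₁ p₂ σ σ' t} (ha : a.ok W σ.reg) (hb : b.ok W σ.reg)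
      (h : ¬ a.eval W σ.reg < b.eval W σ.reg) (h₂ : Run W Z K p₂ σ t σ') :
      Run W Z K (.ifLt a b p₁ p₂) σ (1 + t) σ'
  | ifEq_true {a b p₁ p₂ σ σ' t} (ha : a.ok W σ.reg) (hb : b.ok W σ.reg)
      (h : a.eval W σ.reg = b.eval W σ.reg) (h₁ : Run W Z K p₁ σ t σ') :
      Run W Z K (.ifEq a b p₁ p₂) σ (1 + t) σ'
  | ifEq_false {a b p₁ p₂ σ σ' t} (ha : a.ok W σ.reg) (hb : b.ok W σ.reg)
      (h : a.eval W σ.reg ≠ b.eval W σ.reg) (h₂ : Run W Z K p₂ σ t σ') :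
      Run W Z K (.ifEq a b p₁ p₂) σ (1 + t) σ'
  | whileLt_false {a b p σ} (ha : a.ok W σ.reg) (hb : b.ok W σ.reg)
      (h : ¬ a.eval W σ.reg < b.eval W σ.reg) :
      Run W Z K (.whileLt a b p) σ 1 σ
  | whileLt_true {a b p σ σ₁ σ₂ t₁ t₂} (ha : a.ok W σ.reg) (hb : b.ok W σ.reg)
      (h : a.eval W σ.reg < b.eval W σ.reg) (h₁ : Run W Z K p σ t₁ σ₁)
      (h₂ : Run W Z K (.whileLt a b p) σ₁ t₂ σ₂) :
      Run W Z K (.whileLt a b p) σ (1 + t₁ + t₂) σ₂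

/-- The machine state `s` represents `σ`: the `K` arrays of size `Z` lie one after the other in
memory. Entries beyond the size, and further arrays, of `σ` are irrelevant. -/
structure Rep (Z K : ℕ) (s : State) (σ : AState) : Prop where
  reg : s.reg = σ.reg
  size : s.reg 2 = Z
  mem : ∀ a < K, ∀ x < Z, s.mem (a * Z + x) = σ.arr a x

theorem region_lt {Z K S a x : ℕ} (hS : K * Z ≤ S) (ha : a < K) (hx : x < Z) :
    a * Z + x < S := by
  have : (a + 1) * Z ≤ K * Z := Nat.mul_le_mul_right Z ha
  rw [Nat.succ_mul] at this
  omega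

theorem region_inj {Z a b x y : ℕ} (hx : x < Z) (hy : y < Z) (h : a * Z + x = b * Z + y) :
    a = b ∧ x = y := by
  have hZ : 0 < Z := by omega
  have h1 : (a * Z + x) / Z = a := by
    rw [mul_comm, Nat.mul_add_div hZ, Nat.div_eq_of_lt hx, add_zero]
  have h2 : (b * Z + y) / Z = b := by
    rw [mul_comm, Nat.mul_add_div hZ, Nat.div_eq_of_lt hy, add_zero]
  have hab : a = b := by rw [← h1, h, h2]
  subst hab
  exact ⟨rfl, by omega⟩

theorem Rep.addr_eval {w Z K S : ℕ} {s : State} {σ : AState} {a : ℕ} {e : HE}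
    (hS : K * Z ≤ S) (hw : S ≤ 2 ^ w) (h : Rep Z K s σ) (ha : a < K)
    (he : e.ok (2 ^ w) σ.reg) (hx : e.eval (2 ^ w) σ.reg < Z) :
    (addr a e).eval w s.reg = a * Z + e.eval (2 ^ w) σ.reg := by
  have hlt := region_lt hS ha hx
  have haZ : a ≤ a * Z := Nat.le_mul_of_pos_right a (by omega)
  simp only [addr, Expr.eval, Op.eval, h.size]
  rw [h.reg, HE.eval_compile he, Nat.mod_eq_of_lt (a := a) (by omega),
    Nat.mod_eq_of_lt (a := a * Z) (by omega), Nat.mod_eq_of_lt (by omega)]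

theorem Rep.cond_lt {w Z K : ℕ} {s : State} {σ : AState} {a b : HE} (h : Rep Z K s σ)
    (hw : 1 < 2 ^ w) (ha : a.ok (2 ^ w) σ.reg) (hb : b.ok (2 ^ w) σ.reg) :
    (Expr.bin .lt a.compile b.compile).eval w s.reg ≠ 0 ↔
      a.eval (2 ^ w) σ.reg < b.eval (2 ^ w) σ.reg := by
  simp [Expr.eval, Op.eval, h.reg, HE.eval_compile ha, HE.eval_compile hb, Nat.mod_eq_of_lt hw]

theorem Rep.cond_eq {w Z K : ℕ} {s : State} {σ : AState} {a b : HE} (h : Rep Z K s σ)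
    (hw : 1 < 2 ^ w) (ha : a.ok (2 ^ w) σ.reg) (hb : b.ok (2 ^ w) σ.reg) :
    (Expr.bin .eq a.compile b.compile).eval w s.reg ≠ 0 ↔
      a.eval (2 ^ w) σ.reg = b.eval (2 ^ w) σ.reg := by
  simp [Expr.eval, Op.eval, h.reg, HE.eval_compile ha, HE.eval_compile hb, Nat.mod_eq_of_lt hw]

/-- A run of a `Cmd` is simulated by the word RAM, with a constant slowdown. The number of words has
to exceed `1`, as the comparisons of the word RAM would return `1 % 2 ^ w = 0` otherwise. -/
theorem Run.simulate {w Z K S M : ℕ} (hS : K * Z ≤ S) (hw : S ≤ 2 ^ w) (hw1 : 1 < 2 ^ w)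
    {p : Cmd} {σ σ' : AState} {t : ℕ} (h : Run (2 ^ w) Z K p σ t σ') (hM : p.stepCost ≤ M)
    {s : State} (hs : Rep Z K s σ) :
    ∃ t' s', Exec w S p.compile s t' s' ∧ t' ≤ M * t ∧ Rep Z K s' σ' := by
  induction h generalizing s with
  | skip σ => exact ⟨1, s, .skip s, by simpa [Cmd.stepCost] using hM, hs⟩
  | @set d e σ hd he =>
    refine ⟨_, _, .assign _ _ _, by simpa [Cmd.stepCost] using hM, ?_, ?_, ?_⟩
    · simp [hs.reg, HE.eval_compile he, AState.set]
    · simp [Ne.symm hd, hs.size]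
    · exact hs.mem
  | @ld d a e σ hd ha he hx =>
    have hadr := hs.addr_eval hS hw ha he hx
    refine ⟨_, _, .load _ _ _ ?_, by simpa [Cmd.stepCost] using hM, ?_, ?_, ?_⟩
    · rw [hadr]; exact region_lt hS ha hx
    · change Function.update s.reg d (s.mem ((addr a e).eval w s.reg)) = Function.update σ.reg d _
      rw [hadr, hs.mem a ha _ hx, hs.reg]
    · simp [Ne.symm hd, hs.size]
    · exact hs.mem
  | @st a e v σ ha he hx hv =>
    have hadr := hs.addr_eval hS hw ha he hx
    refine ⟨_, _, .store _ _ _ ?_, by simpa [Cmd.stepCost] using hM, ?_, ?_, ?_⟩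
    · rw [hadr]; exact region_lt hS ha hx
    · exact hs.reg
    · exact hs.size
    · intro b hb y hy
      simp only [hadr, AState.put_arr, Function.update_apply]
      by_cases hby : b = a ∧ y = e.eval (2 ^ w) σ.reg
      · simp [hby.1, hby.2, hs.reg, HE.eval_compile hv]
      · rw [if_neg hby, if_neg (fun h => hby (region_inj hy hx h)), hs.mem b hb y hy]
  | seq h₁ h₂ ih₁ ih₂ =>
    simp only [Cmd.stepCost, max_le_iff] at hM
    obtain ⟨t₁, s₁, he₁, ht₁, hr₁⟩ := ih₁ hM.1 hs
    obtain ⟨t₂, s₂, he₂, ht₂, hr₂⟩ := ih₂ hM.2 hr₁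
    exact ⟨_, s₂, .seq he₁ he₂, by rw [mul_add]; omega, hr₂⟩
  | ifLt_true ha hb h h₁ ih =>
    simp only [Cmd.stepCost, max_le_iff] at hM
    obtain ⟨t₁, s₁, he₁, ht₁, hr₁⟩ := ih hM.2.1 hs
    refine ⟨_, s₁, .branch_true ((hs.cond_lt hw1 ha hb).2 h) he₁, ?_, hr₁⟩
    simp only [Expr.cost, mul_add]; omega
  | ifLt_false ha hb h h₁ ih =>
    simp only [Cmd.stepCost, max_le_iff] at hM
    obtain ⟨t₁, s₁, he₁, ht₁, hr₁⟩ := ih hM.2.2 hs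
    refine ⟨_, s₁, .branch_false (not_not.1 (mt (hs.cond_lt hw1 ha hb).1 h)) he₁, ?_, hr₁⟩
    simp only [Expr.cost, mul_add]; omega
  | ifEq_true ha hb h h₁ ih =>
    simp only [Cmd.stepCost, max_le_iff] at hM
    obtain ⟨t₁, s₁, he₁, ht₁, hr₁⟩ := ih hM.2.1 hs
    refine ⟨_, s₁, .branch_true ((hs.cond_eq hw1 ha hb).2 h) he₁, ?_, hr₁⟩
    simp only [Expr.cost, mul_add]; omega
  | ifEq_false ha hb h h₁ ih =>
    simp only [Cmd.stepCost, max_le_iff] at hM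
    obtain ⟨t₁, s₁, he₁, ht₁, hr₁⟩ := ih hM.2.2 hs
    refine ⟨_, s₁, .branch_false (not_not.1 (mt (hs.cond_eq hw1 ha hb).1 h)) he₁, ?_, hr₁⟩
    simp only [Expr.cost, mul_add]; omega
  | whileLt_false ha hb h =>
    simp only [Cmd.stepCost, max_le_iff] at hM
    refine ⟨_, s, .loop_false (not_not.1 (mt (hs.cond_lt hw1 ha hb).1 h)), ?_, hs⟩
    simp only [Expr.cost]; omega
  | whileLt_true ha hb h h₁ h₂ ih₁ ih₂ =>
    have hM' := hM
    simp only [Cmd.stepCost, max_le_iff] at hM'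
    obtain ⟨t₁, s₁, he₁, ht₁, hr₁⟩ := ih₁ hM'.2 hs
    obtain ⟨t₂, s₂, he₂, ht₂, hr₂⟩ := ih₂ hM hr₁
    refine ⟨_, s₂, .loop_true ((hs.cond_lt hw1 ha hb).2 h) he₁ he₂, ?_, hr₂⟩
    simp only [Expr.cost, mul_add]; omega

/-- The weakest precondition: `p` halts when started in `σ`, and the final state and the number of
steps satisfy `Q`. -/
def WP (W Z K : ℕ) (p : Cmd) (Q : AState → ℕ → Prop) (σ : AState) : Prop :=
  ∃ t σ', Run W Z K p σ t σ' ∧ Q σ' t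

section WP

variable {W Z K : ℕ} {Q Q' : AState → ℕ → Prop} {σ : AState}

theorem WP.mono {p : Cmd} (h : WP W Z K p Q σ) (hQ : ∀ σ' t, Q σ' t → Q' σ' t) :
    WP W Z K p Q' σ := by
  obtain ⟨t, σ', hr, hq⟩ := h
  exact ⟨t, σ', hr, hQ _ _ hq⟩

@[simp] theorem wp_skip : WP W Z K .skip Q σ ↔ Q σ 1 := by
  constructor
  · rintro ⟨t, σ', ⟨⟩, h⟩; exact h
  · intro h; exact ⟨_, _, .skip σ, h⟩

@[simp] theorem wp_set {d : ℕ} {e : HE} :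
    WP W Z K (.set d e) Q σ ↔ d ≠ 2 ∧ e.ok W σ.reg ∧ Q (σ.set d (e.eval W σ.reg)) 1 := by
  constructor
  · rintro ⟨t, σ', ⟨⟩, h⟩; exact ⟨by assumption, by assumption, h⟩
  · rintro ⟨hd, he, h⟩; exact ⟨_, _, .set hd he, h⟩

@[simp] theorem wp_ld {d a : ℕ} {e : HE} :
    WP W Z K (.ld d a e) Q σ ↔ d ≠ 2 ∧ a < K ∧ e.ok W σ.reg ∧ e.eval W σ.reg < Z ∧
      Q (σ.set d (σ.arr a (e.eval W σ.reg))) 1 := by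
  constructor
  · rintro ⟨t, σ', ⟨⟩, h⟩; exact ⟨by assumption, by assumption, by assumption, by assumption, h⟩
  · rintro ⟨hd, ha, he, hx, h⟩; exact ⟨_, _, .ld hd ha he hx, h⟩

@[simp] theorem wp_st {a : ℕ} {e v : HE} :
    WP W Z K (.st a e v) Q σ ↔ a < K ∧ e.ok W σ.reg ∧ e.eval W σ.reg < Z ∧ v.ok W σ.reg ∧
      Q (σ.put a (e.eval W σ.reg) (v.eval W σ.reg)) 1 := by
  constructor
  · rintro ⟨t, σ', ⟨⟩, h⟩; exact ⟨by assumption, by assumption, by assumption, by assumption, h⟩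
  · rintro ⟨ha, he, hx, hv, h⟩; exact ⟨_, _, .st ha he hx hv, h⟩

@[simp] theorem wp_seq {p₁ p₂ : Cmd} :
    WP W Z K (.seq p₁ p₂) Q σ ↔
      WP W Z K p₁ (fun σ₁ t₁ => WP W Z K p₂ (fun σ₂ t₂ => Q σ₂ (t₁ + t₂)) σ₁) σ := by
  constructor
  · rintro ⟨t, σ', h, hq⟩
    cases h with
    | seq h₁ h₂ => exact ⟨_, _, h₁, _, _, h₂, hq⟩
  · rintro ⟨t₁, σ₁, h₁, t₂, σ₂, h₂, hq⟩
    exact ⟨_, _, .seq h₁ h₂, hq⟩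

@[simp] theorem wp_ifLt {a b : HE} {p₁ p₂ : Cmd} :
    WP W Z K (.ifLt a b p₁ p₂) Q σ ↔ a.ok W σ.reg ∧ b.ok W σ.reg ∧
      (a.eval W σ.reg < b.eval W σ.reg → WP W Z K p₁ (fun σ' t => Q σ' (1 + t)) σ) ∧
      (¬ a.eval W σ.reg < b.eval W σ.reg → WP W Z K p₂ (fun σ' t => Q σ' (1 + t)) σ) := by
  constructor
  · rintro ⟨t, σ', h, hq⟩
    cases h with
    | ifLt_true ha hb h h₁ => exact ⟨ha, hb, fun _ => ⟨_, _, h₁, hq⟩, fun h' => absurd h h'⟩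
    | ifLt_false ha hb h h₁ => exact ⟨ha, hb, fun h' => absurd h' h, fun _ => ⟨_, _, h₁, hq⟩⟩
  · rintro ⟨ha, hb, h₁, h₂⟩
    by_cases h : a.eval W σ.reg < b.eval W σ.reg
    · obtain ⟨t, σ', hr, hq⟩ := h₁ h
      exact ⟨_, _, .ifLt_true ha hb h hr, hq⟩
    · obtain ⟨t, σ', hr, hq⟩ := h₂ h
      exact ⟨_, _, .ifLt_false ha hb h hr, hq⟩

@[simp] theorem wp_ifEq {a b : HE} {p₁ p₂ : Cmd} :
    WP W Z K (.ifEq a b p₁ p₂) Q σ ↔ a.ok W σ.reg ∧ b.ok W σ.reg ∧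
      (a.eval W σ.reg = b.eval W σ.reg → WP W Z K p₁ (fun σ' t => Q σ' (1 + t)) σ) ∧
      (a.eval W σ.reg ≠ b.eval W σ.reg → WP W Z K p₂ (fun σ' t => Q σ' (1 + t)) σ) := by
  constructor
  · rintro ⟨t, σ', h, hq⟩
    cases h with
    | ifEq_true ha hb h h₁ => exact ⟨ha, hb, fun _ => ⟨_, _, h₁, hq⟩, fun h' => absurd h h'⟩
    | ifEq_false ha hb h h₁ => exact ⟨ha, hb, fun h' => absurd h' h, fun _ => ⟨_, _, h₁, hq⟩⟩
  · rintro ⟨ha, hb, h₁, h₂⟩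
    by_cases h : a.eval W σ.reg = b.eval W σ.reg
    · obtain ⟨t, σ', hr, hq⟩ := h₁ h
      exact ⟨_, _, .ifEq_true ha hb h hr, hq⟩
    · obtain ⟨t, σ', hr, hq⟩ := h₂ h
      exact ⟨_, _, .ifEq_false ha hb h hr, hq⟩

/-- One unfolding of a loop. -/
theorem wp_whileLt {a b : HE} {p : Cmd} (ha : a.ok W σ.reg) (hb : b.ok W σ.reg)
    (h₁ : a.eval W σ.reg < b.eval W σ.reg →
      WP W Z K p (fun σ₁ t₁ => WP W Z K (.whileLt a b p) (fun σ₂ t₂ => Q σ₂ (1 + t₁ + t₂)) σ₁) σ)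
    (h₂ : ¬ a.eval W σ.reg < b.eval W σ.reg → Q σ 1) : WP W Z K (.whileLt a b p) Q σ := by
  by_cases h : a.eval W σ.reg < b.eval W σ.reg
  · obtain ⟨t₁, σ₁, hr₁, t₂, σ₂, hr₂, hq⟩ := h₁ h
    exact ⟨_, _, .whileLt_true ha hb h hr₁ hr₂, hq⟩
  · exact ⟨_, _, .whileLt_false ha hb h, h₂ h⟩

/-- A loop with invariant `I`, where `I i` holds after `i` rounds, with at most `m` rounds, and
with at most `B i` steps in round `i`. -/
theorem WP.while_sum {a b : HE} {p : Cmd} (I : ℕ → AState → Prop) (m : ℕ) (B : ℕ → ℕ) (h0 : I 0 σ)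
    (hok : ∀ i σ, I i σ → a.ok W σ.reg ∧ b.ok W σ.reg)
    (hlt : ∀ i σ, I i σ → a.eval W σ.reg < b.eval W σ.reg → i < m)
    (hstep : ∀ i σ, I i σ → a.eval W σ.reg < b.eval W σ.reg →
      WP W Z K p (fun σ' t => t ≤ B i ∧ I (i + 1) σ') σ) :
    WP W Z K (.whileLt a b p)
      (fun σ' t => t ≤ (∑ i ∈ Finset.range m, (B i + 1)) + 1 ∧ ∃ i ≤ m, I i σ' ∧
        ¬ a.eval W σ'.reg < b.eval W σ'.reg) σ := by
  suffices H : ∀ d i σ, i + d = m → I i σ → WP W Z K (.whileLt a b p)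
      (fun σ' t => (∑ i ∈ Finset.range i, (B i + 1)) + t ≤
          (∑ i ∈ Finset.range m, (B i + 1)) + 1 ∧ ∃ i ≤ m, I i σ' ∧
        ¬ a.eval W σ'.reg < b.eval W σ'.reg) σ by simpa using H m 0 σ (by omega) h0
  intro d
  induction d with
  | zero =>
    intro i σ hi hI
    refine wp_whileLt (hok i σ hI).1 (hok i σ hI).2 (fun h => ?_) (fun h => ?_)
    · have := hlt i σ hI h; omega
    · obtain rfl : i = m := by omega
      exact ⟨le_rfl, i, le_rfl, hI, h⟩
  | succ d ih =>
    intro i σ hi hI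
    refine wp_whileLt (hok i σ hI).1 (hok i σ hI).2 (fun h => ?_) (fun h => ?_)
    · refine (hstep i σ hI h).mono fun σ₁ t₁ ⟨ht₁, hI₁⟩ => ?_
      refine (ih (i + 1) σ₁ (by omega) hI₁).mono fun σ₂ t₂ ⟨ht₂, h₂⟩ => ⟨?_, h₂⟩
      rw [Finset.sum_range_succ] at ht₂
      omega
    · refine ⟨?_, i, by omega, hI, h⟩
      have : Finset.range i ⊆ Finset.range m := Finset.range_subset_range.2 (by omega)
      have := Finset.sum_le_sum_of_subset (f := fun i => B i + 1) this
      omega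

/-- A loop with invariant `I`, where `I i` holds after `i` rounds, and with at most `m` rounds. -/
theorem WP.while {a b : HE} {p : Cmd} (I : ℕ → AState → Prop) (m B : ℕ) (h0 : I 0 σ)
    (hok : ∀ i σ, I i σ → a.ok W σ.reg ∧ b.ok W σ.reg)
    (hlt : ∀ i σ, I i σ → a.eval W σ.reg < b.eval W σ.reg → i < m)
    (hstep : ∀ i σ, I i σ → a.eval W σ.reg < b.eval W σ.reg →
      WP W Z K p (fun σ' t => t ≤ B ∧ I (i + 1) σ') σ) :
    WP W Z K (.whileLt a b p)
      (fun σ' t => t ≤ m * (B + 1) + 1 ∧ ∃ i ≤ m, I i σ' ∧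
        ¬ a.eval W σ'.reg < b.eval W σ'.reg) σ := by
  simpa using WP.while_sum (Z := Z) (K := K) I m (fun _ => B) h0 hok hlt hstep

/-- A counting loop with invariant `I`, where `I k` holds when the counter is `k`, and with at most
`B k` steps in round `k`. -/
theorem WP.forUp_sum {r b : ℕ} {p : Cmd} (I : ℕ → AState → Prop) (m : ℕ) (B : ℕ → ℕ) (hm : m < W)
    (hr : r ≠ 2) (h0 : I 0 (σ.set r 0))
    (hb : ∀ k σ, k ≤ m → I k σ → σ.reg b = m)
    (hstep : ∀ k σ, k < m → σ.reg r = k → I k σ →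
      WP W Z K p (fun σ' t => t ≤ B k ∧ σ'.reg r = k ∧ I (k + 1) (σ'.set r (k + 1))) σ) :
    WP W Z K (Cmd.forUp r b p)
      (fun σ' t => t ≤ (∑ k ∈ Finset.range m, (B k + 2)) + 2 ∧ σ'.reg r = m ∧ I m σ') σ := by
  rw [Cmd.forUp, wp_seq, wp_set]
  refine ⟨hr, by simp only [HE.ok]; omega, ?_⟩
  have := WP.while_sum (W := W) (Z := Z) (K := K) (σ := σ.set r 0) (a := .reg r) (b := .reg b)
    (p := p ;; .set r (.add (.reg r) (.const 1)))
    (fun k σ => k ≤ m ∧ σ.reg r = k ∧ I k σ) m (fun k => B k + 1) ⟨by omega, by simp, h0⟩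
    (fun i σ h => by simp) (fun i σ h => ?_) (fun i σ h hlt => ?_)
  · refine this.mono ?_
    rintro σ' t ⟨ht, i, him, ⟨_, hri, hI⟩, hnlt⟩
    have hbm := hb i σ' him hI
    simp only [HE.eval, hri, hbm] at hnlt
    obtain rfl : i = m := by omega
    refine ⟨?_, hri, hI⟩
    simp only [add_assoc, Nat.reduceAdd] at ht ⊢
    omega
  · have := hb i σ h.1 h.2.2
    simp only [HE.eval, h.2.1, this]; exact id
  · obtain ⟨him, hri, hI⟩ := h
    have hbm := hb i σ him hI
    simp only [HE.eval, hri, hbm] at hlt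
    rw [wp_seq]
    refine (hstep i σ hlt hri hI).mono ?_
    rintro σ' t ⟨ht, hr', hI'⟩
    rw [wp_set]
    refine ⟨hr, ?_, ?_, ?_, ?_, ?_⟩
    · simp only [HE.ok, HE.eval, hr']; exact ⟨trivial, by omega, by omega⟩
    · omega
    · omega
    · simp [hr']
    · simpa [hr'] using hI'

/-- A counting loop with invariant `I`, where `I k` holds when the counter is `k`. -/
theorem WP.forUp {r b : ℕ} {p : Cmd} (I : ℕ → AState → Prop) (m B : ℕ) (hm : m < W)
    (hr : r ≠ 2) (h0 : I 0 (σ.set r 0))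
    (hb : ∀ k σ, k ≤ m → I k σ → σ.reg b = m)
    (hstep : ∀ k σ, k < m → σ.reg r = k → I k σ →
      WP W Z K p (fun σ' t => t ≤ B ∧ σ'.reg r = k ∧ I (k + 1) (σ'.set r (k + 1))) σ) :
    WP W Z K (Cmd.forUp r b p)
      (fun σ' t => t ≤ m * (B + 2) + 2 ∧ σ'.reg r = m ∧ I m σ') σ := by
  simpa using WP.forUp_sum (Z := Z) (K := K) I m (fun _ => B) hm hr h0 hb hstep

end WP

end ArrayProg

/-! ### Greedy selection of non-overlapping hits -/

namespace Greedy

/-- The state of the leftmost greedy selection after reading one position, where `b` tells whether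
the position is a hit. The state is the number of upcoming positions that are blocked because they
are closer than `q` to the hit selected last. -/
def step (q : ℕ) (b : Bool) (d : ℕ) : ℕ :=
  if d = 0 then (if b then q - 1 else 0) else d - 1

/-- The final state of the greedy selection started in state `d`. -/
def state (q : ℕ) : List Bool → ℕ → ℕ
  | [], d => d
  | b :: bs, d => state q bs (step q b d)

/-- The number of hits selected by the greedy selection started in state `d`. -/
def count (q : ℕ) : List Bool → ℕ → ℕ
  | [], _ => 0
  | b :: bs, d => (if d = 0 ∧ b = true then 1 else 0) + count q bs (step q b d)

variable {q : ℕ}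

theorem step_le {b : Bool} {d : ℕ} (h : d ≤ q - 1) : step q b d ≤ q - 1 := by
  unfold step; split_ifs <;> omega

theorem state_append (as bs : List Bool) (d : ℕ) :
    state q (as ++ bs) d = state q bs (state q as d) := by
  induction as generalizing d with
  | nil => rfl
  | cons a as ih => exact ih _

theorem count_append (as bs : List Bool) (d : ℕ) :
    count q (as ++ bs) d = count q as d + count q bs (state q as d) := by
  induction as generalizing d with
  | nil => simp [count, state]
  | cons a as ih => simp only [List.cons_append, count, state, ih, add_assoc]

theorem state_le {bs : List Bool} {d : ℕ} (h : d ≤ q - 1) : state q bs d ≤ q - 1 := by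
  induction bs generalizing d with
  | nil => exact h
  | cons b bs ih => exact ih (step_le h)

/-- Blocking more positions at the start loses at most one selected hit. -/
theorem count_interleave (bs : List Bool) {d d' : ℕ} (h : d ≤ d') (h' : d' ≤ q - 1) :
    count q bs d' ≤ count q bs d ∧ count q bs d ≤ count q bs d' + 1 := by
  induction bs generalizing d d' with
  | nil => simp [count]
  | cons b bs ih =>
    rcases Nat.eq_zero_or_pos d with rfl | hd
    · rcases Nat.eq_zero_or_pos d' with rfl | hd'
      · simp
      · cases b
        · have := ih (d := 0) (d' := d' - 1) (by omega) (by omega)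
          simpa [count, step, hd'.ne'] using this
        · have := ih (d := d' - 1) (d' := q - 1) (by omega) le_rfl
          simp only [count, step, hd'.ne', if_true, if_false, and_self, false_and]
          omega
    · have := ih (d := d - 1) (d' := d' - 1) (by omega) (by omega)
      simpa [count, step, hd.ne', (hd.trans_le h).ne'] using this

/-- When all positions are blocked, nothing is selected. -/
theorem of_length_le {bs : List Bool} {d : ℕ} (h : bs.length ≤ d) :
    state q bs d = d - bs.length ∧ count q bs d = 0 := by
  induction bs generalizing d with
  | nil => simp [state, count]
  | cons b bs ih =>
    simp only [List.length_cons] at h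
    have hd : d ≠ 0 := by omega
    have := ih (d := d - 1) (by omega)
    simp only [state, count, step, hd, if_false, false_and, List.length_cons]
    omega

/-- Blocking positions without hits changes nothing. The final states agree only if the sequence is
long enough for the blocked positions. -/
theorem of_no_hit {bs : List Bool} {d d' : ℕ} (h : d ≤ d')
    (hno : ∀ j, d ≤ j → j < d' → bs.getD j false = false) :
    count q bs d = count q bs d' ∧ (d' ≤ bs.length → state q bs d = state q bs d') := by
  induction bs generalizing d d' with
  | nil => simp only [count, state, List.length_nil, true_and]; omega
  | cons b bs ih =>
    have key := ih (d := d - 1) (d' := d' - 1) (by omega) (fun j hj hj' => by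
      have := hno (j + 1) (by omega) (by omega)
      simpa using this)
    rcases Nat.eq_zero_or_pos d' with rfl | hd'
    · obtain rfl : d = 0 := by omega
      simp
    · have hs : step q b d = d - 1 := by
        rcases Nat.eq_zero_or_pos d with rfl | hd
        · have := hno 0 le_rfl hd'
          simp only [List.getD_cons_zero] at this
          simp [step, this]
        · simp [step, hd.ne']
      have hc : (if d = 0 ∧ b = true then 1 else 0) = 0 := by
        rw [if_neg]
        rintro ⟨rfl, rfl⟩
        simpa using hno 0 le_rfl hd'
      have hs' : step q b d' = d' - 1 := by simp [step, hd'.ne']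
      simp only [count, state, hs, hc, hs', hd'.ne', false_and, if_false, List.length_cons,
        zero_add]
      exact ⟨key.1, fun hl => key.2 (by omega)⟩

theorem of_all_false {bs : List Bool} {d : ℕ} (h : ∀ b ∈ bs, b = false) :
    state q bs d = d - bs.length ∧ count q bs d = 0 := by
  induction bs generalizing d with
  | nil => simp [state, count]
  | cons b bs ih =>
    have hb := h b (by simp)
    have := ih (d := step q b d) (fun b hb => h b (by simp [hb]))
    subst hb
    simp only [state, count, List.length_cons]
    have hs : step q false d = d - 1 := by unfold step; split_ifs <;> simp_all
    rw [this.1, this.2, hs]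
    simp; omega

/-- The selection forgets everything after `q - 1` positions without hits. -/
theorem state_zero_of_suffix {bs : List Bool} (h : ∀ b ∈ bs.reverse.take (q - 1), b = false) :
    state q bs 0 = 0 := by
  have hbs : bs = (bs.reverse.drop (q - 1)).reverse ++ (bs.reverse.take (q - 1)).reverse := by
    rw [← List.reverse_append, List.take_append_drop, List.reverse_reverse]
  rw [hbs, state_append, (of_all_false (bs := (bs.reverse.take (q - 1)).reverse)
    (fun b hb => h b (List.mem_reverse.1 hb))).1]
  by_cases hl : q - 1 ≤ bs.length
  · have := state_le (q := q) (bs := (bs.reverse.drop (q - 1)).reverse) (d := 0) (Nat.zero_le _)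
    simp only [List.length_reverse, List.length_take]
    omega
  · rw [List.drop_of_length_le (by simp; omega)]
    simp [state]

/-- The greedy selection is at least as large as every other one. If the first position is a hit
that the other selection skips, then selecting it costs at most one hit later on. -/
theorem card_le_count (bs : List Bool) {d : ℕ} (hq : 1 ≤ q) (hd : d ≤ q - 1) (A : Finset ℕ)
    (hA : ∀ i ∈ A, bs.getD i false = true ∧ d ≤ i) (hno : NonOverlapping q A) :
    A.card ≤ count q bs d := by
  induction bs generalizing d A with
  | nil =>
    have : A = ∅ := Finset.eq_empty_of_forall_notMem fun i hi => by simpa using (hA i hi).1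
    simp [this]
  | cons b bs ih =>
    have hinj : Set.InjOn Nat.pred (A.erase 0 : Finset ℕ) := by
      intro i hi j hj hij
      simp only [Finset.coe_erase, Set.mem_sdiff, Finset.mem_coe, Set.mem_singleton_iff] at hi hj
      simp only [Nat.pred_eq_sub_one] at hij
      omega
    have hcard := Finset.card_image_of_injOn hinj
    have hno' : NonOverlapping q ((A.erase 0).image Nat.pred) := by
      intro i hi j hj hij
      simp only [Finset.mem_image, Finset.mem_erase, Nat.pred_eq_sub_one] at hi hj
      obtain ⟨i', ⟨hi0, hi'⟩, rfl⟩ := hi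
      obtain ⟨j', ⟨hj0, hj'⟩, rfl⟩ := hj
      have := hno i' hi' j' hj' (by omega)
      omega
    have hmem : ∀ i ∈ (A.erase 0).image Nat.pred, bs.getD i false = true ∧ i + 1 ∈ A := by
      intro i hi
      simp only [Finset.mem_image, Finset.mem_erase, Nat.pred_eq_sub_one] at hi
      obtain ⟨i', ⟨hi0, hi'⟩, rfl⟩ := hi
      have hii : i' - 1 + 1 = i' := by omega
      have := (hA i' hi').1
      rw [← hii, List.getD_cons_succ] at this
      exact ⟨this, by rwa [hii]⟩
    by_cases h0 : 0 ∈ A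
    · obtain ⟨hb, hd0⟩ := hA 0 h0
      obtain rfl : d = 0 := by omega
      simp only [List.getD_cons_zero] at hb
      subst hb
      have := ih (d := q - 1) le_rfl _ (fun i hi => ⟨(hmem i hi).1, by
        have := hno 0 h0 (i + 1) (hmem i hi).2 (by omega)
        omega⟩) hno'
      rw [hcard] at this
      have hc := Finset.card_erase_add_one h0
      simp only [count, step, if_true, and_self]
      omega
    · have := ih (d := d - 1) (by omega) _ (fun i hi => ⟨(hmem i hi).1, by
        have := (hA _ (hmem i hi).2).2
        omega⟩) hno'
      rw [hcard, Finset.erase_eq_of_notMem h0] at this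
      refine this.trans ?_
      rcases Nat.eq_zero_or_pos d with rfl | hd'
      · cases b
        · simp [count, step]
        · have := (count_interleave bs (q := q) (d := 0) (d' := q - 1) (by omega) le_rfl).2
          simp only [count, step, if_true, and_self]
          simp only [zero_tsub]
          omega
      · simp [count, step, hd'.ne']

/-- The hits selected by the greedy selection do not overlap. -/
theorem exists_card_eq_count (bs : List Bool) {d : ℕ} (hq : 1 ≤ q) :
    ∃ A : Finset ℕ, (∀ i ∈ A, bs.getD i false = true ∧ d ≤ i) ∧ NonOverlapping q A ∧
      A.card = count q bs d := by
  induction bs generalizing d with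
  | nil => exact ⟨∅, by simp, by simp [NonOverlapping], by simp [count]⟩
  | cons b bs ih =>
    obtain ⟨A, hA, hno, hc⟩ := ih (d := step q b d)
    have hno' : NonOverlapping q (A.map (addRightEmbedding 1)) := by
      intro i hi j hj hij
      simp only [Finset.mem_map, addRightEmbedding_apply] at hi hj
      obtain ⟨i, hi, rfl⟩ := hi
      obtain ⟨j, hj, rfl⟩ := hj
      have := hno i hi j hj (by omega)
      omega
    have hA' : ∀ i ∈ A.map (addRightEmbedding 1), (b :: bs).getD i false = true ∧
        step q b d + 1 ≤ i := by
      intro i hi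
      simp only [Finset.mem_map, addRightEmbedding_apply] at hi
      obtain ⟨i, hi, rfl⟩ := hi
      exact ⟨by simpa using (hA i hi).1, by have := (hA i hi).2; omega⟩
    by_cases h : d = 0 ∧ b = true
    · obtain ⟨rfl, rfl⟩ := h
      simp only [step, if_true] at hA'
      have h0 : 0 ∉ A.map (addRightEmbedding 1) := by simp
      refine ⟨insert 0 (A.map (addRightEmbedding 1)), ?_, ?_, ?_⟩
      · intro i hi
        rcases Finset.mem_insert.1 hi with rfl | hi
        · simp
        · exact ⟨(hA' i hi).1, Nat.zero_le _⟩
      · intro i hi j hj hij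
        rcases Finset.mem_insert.1 hj with rfl | hj
        · omega
        · rcases Finset.mem_insert.1 hi with rfl | hi
          · have := (hA' j hj).2; omega
          · exact hno' i hi j hj hij
      · rw [Finset.card_insert_of_notMem h0, Finset.card_map, hc]
        simp [count, add_comm]
    · refine ⟨A.map (addRightEmbedding 1), ?_, hno', ?_⟩
      · intro i hi
        refine ⟨(hA' i hi).1, ?_⟩
        have := (hA' i hi).2
        have : d ≤ step q b d + 1 := by unfold step; split_ifs <;> omega
        omega
      · rw [Finset.card_map, hc]
        simp only [count, if_neg h, zero_add]

end Greedy

/-! ### The sequence of `q`-grams of a string -/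

/-- The substrings of length `q`, from left to right. -/
def grams {α : Type*} (q : ℕ) : List α → List (List α)
  | [] => []
  | x :: xs => if q ≤ xs.length + 1 then (x :: xs).take q :: grams q xs else []

section Grams

variable {α : Type*} {q : ℕ}

theorem length_grams (hq : 1 ≤ q) (X : List α) : (grams q X).length = X.length + 1 - q := by
  induction X with
  | nil => simp [grams]; omega
  | cons x xs ih =>
    simp only [grams]
    split_ifs with h
    · simp only [List.length_cons, ih]; omega
    · simp only [List.length_nil, List.length_cons]; omega

theorem grams_eq_nil {X : List α} (hq : 1 ≤ q) (h : X.length < q) : grams q X = [] :=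
  List.eq_nil_of_length_eq_zero (by rw [length_grams hq]; omega)

theorem grams_getElem? (hq : 1 ≤ q) (X : List α) (k : ℕ) :
    (grams q X)[k]? = if k + q ≤ X.length then some ((X.drop k).take q) else none := by
  induction X generalizing k with
  | nil => simp [grams]; omega
  | cons x xs ih =>
    simp only [grams]
    split_ifs with h h' h'
    · cases k with
      | zero => simp
      | succ k =>
        simp only [List.length_cons] at h'
        simp only [List.getElem?_cons_succ, ih, List.drop_succ_cons]
        rw [if_pos (by omega)]
    · cases k with
      | zero => simp only [List.length_cons] at h'; omega
      | succ k =>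
        simp only [List.length_cons] at h'
        simp only [List.getElem?_cons_succ, ih]
        rw [if_neg (by omega)]
    · simp only [List.length_cons] at h'; omega
    · simp

/-- A string of length at most `q - 1` has no `q`-grams of its own, so in front of `Y` it only
contributes `q`-grams that end within the first `q - 1` letters of `Y`. -/
theorem grams_append_short (hq : 1 ≤ q) (X Y : List α) (h : X.length ≤ q - 1) :
    grams q (X ++ Y) = grams q (X ++ Y.take (q - 1)) ++ grams q Y := by
  induction X with
  | nil => simp [grams_eq_nil hq (show (Y.take (q - 1)).length < q by simp; omega)]
  | cons x xs ih =>
    simp only [List.length_cons] at h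
    simp only [List.cons_append, grams, List.length_append, List.length_take]
    by_cases hY : q ≤ xs.length + Y.length + 1
    · rw [if_pos hY, if_pos (by omega), ih (by omega), List.cons_append]
      congr 1
      obtain ⟨p, rfl⟩ : ∃ p, q = p + 1 := ⟨q - 1, by omega⟩
      simp only [List.take_succ_cons, List.take_append, Nat.add_sub_cancel, List.take_take]
      congr 3
      omega
    · rw [if_neg hY, if_neg (by omega), grams_eq_nil hq (X := Y) (by omega), List.append_nil]

/-- The `q`-grams of a concatenation: those of the two parts, and in between those that cross the
boundary, which are the `q`-grams of a string of length at most `2 * (q - 1)`. -/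
theorem grams_append (hq : 1 ≤ q) (X Y : List α) :
    grams q (X ++ Y) =
      grams q X ++ grams q (X.drop (X.length - (q - 1)) ++ Y.take (q - 1)) ++ grams q Y := by
  induction X with
  | nil => simpa [grams] using grams_append_short hq [] Y (by simp)
  | cons x xs ih =>
    by_cases h : q ≤ xs.length + 1
    · have hd : (x :: xs).drop ((x :: xs).length - (q - 1)) = xs.drop (xs.length - (q - 1)) := by
        have : (x :: xs).length - (q - 1) = xs.length - (q - 1) + 1 := by
          simp only [List.length_cons]; omega
        rw [this, List.drop_succ_cons]
      rw [hd]
      simp only [List.cons_append, grams, List.length_append]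
      rw [if_pos (by omega), if_pos h, ih]
      have : (x :: (xs ++ Y)).take q = (x :: xs).take q := by
        rw [← List.cons_append, List.take_append_of_le_length (by simpa using h)]
      simp [this]
    · have hl : (x :: xs).length - (q - 1) = 0 := by simp only [List.length_cons]; omega
      rw [hl, List.drop_zero,
        grams_append_short hq (x :: xs) Y (by simp only [List.length_cons]; omega),
        grams_eq_nil hq (X := x :: xs) (by simp only [List.length_cons]; omega), List.nil_append]

variable [DecidableEq α]

/-- The positions of `P` in a sequence, as a sequence of truth values. -/
def hits {β : Type*} [DecidableEq β] (L : List β) (z : β) : List Bool :=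
  L.map fun y => decide (y = z)

theorem hits_append {β : Type*} [DecidableEq β] (L M : List β) (z : β) :
    hits (L ++ M) z = hits L z ++ hits M z := by simp [hits]

@[simp] theorem length_hits {β : Type*} [DecidableEq β] (L : List β) (z : β) :
    (hits L z).length = L.length := by simp [hits]

theorem hits_getD {β : Type*} [DecidableEq β] (L : List β) (z : β) (i : ℕ) :
    (hits L z).getD i false = true ↔ L[i]? = some z := by
  simp only [hits, List.getD_eq_getElem?_getD, List.getElem?_map]
  cases L[i]? <;> simp

theorem mem_Occ {T P : List α} (hP : 1 ≤ P.length) {k : ℕ} :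
    k ∈ Occ T P ↔ 1 ≤ k ∧ (grams P.length T)[k - 1]? = some P := by
  simp only [Occ, Finset.mem_filter, Finset.mem_Icc, grams_getElem? hP]
  constructor
  · rintro ⟨⟨h1, h2⟩, h⟩
    have hl := congrArg List.length h
    simp only [List.length_take, List.length_drop] at hl
    rw [if_pos (by omega), h]
    exact ⟨h1, rfl⟩
  · rintro ⟨h1, h⟩
    split_ifs at h with hl
    exact ⟨⟨h1, by omega⟩, Option.some.inj h⟩

/-- The non-overlapping frequency is the number of occurrences selected greedily. -/
theorem nOcc_eq_count {T P : List α} (hP : 1 ≤ P.length) :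
    nOcc T P = Greedy.count P.length (hits (grams P.length T) P) 0 := by
  classical
  apply le_antisymm
  · refine Finset.sup_le fun A hA => ?_
    simp only [Finset.mem_filter, Finset.mem_powerset] at hA
    obtain ⟨hsub, hno⟩ := hA
    have hinj : Set.InjOn Nat.pred (A : Set ℕ) := by
      intro i hi j hj hij
      have h1 := ((mem_Occ hP).1 (hsub hi)).1
      have h2 := ((mem_Occ hP).1 (hsub hj)).1
      simp only [Nat.pred_eq_sub_one] at hij
      omega
    rw [← Finset.card_image_of_injOn hinj]
    refine Greedy.card_le_count _ hP (Nat.zero_le _) _ ?_ ?_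
    · intro i hi
      obtain ⟨j, hj, rfl⟩ := Finset.mem_image.1 hi
      exact ⟨(hits_getD _ _ _).2 ((mem_Occ hP).1 (hsub hj)).2, Nat.zero_le _⟩
    · intro i hi j hj hij
      obtain ⟨i', hi', rfl⟩ := Finset.mem_image.1 hi
      obtain ⟨j', hj', rfl⟩ := Finset.mem_image.1 hj
      have h1 := ((mem_Occ hP).1 (hsub hi')).1
      simp only [Nat.pred_eq_sub_one] at hij ⊢
      have := hno i' hi' j' hj' (by omega)
      omega
  · obtain ⟨A, hA, hno, hc⟩ :=
      Greedy.exists_card_eq_count (hits (grams P.length T) P) (d := 0) hP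
    rw [← hc, ← Finset.card_map (addRightEmbedding 1)]
    refine Finset.le_sup (f := Finset.card) ?_
    simp only [Finset.mem_filter, Finset.mem_powerset]
    constructor
    · intro i hi
      simp only [Finset.mem_map, addRightEmbedding_apply] at hi
      obtain ⟨j, hj, rfl⟩ := hi
      exact (mem_Occ hP).2 ⟨by omega, by simpa using (hits_getD _ _ _).1 (hA j hj).1⟩
    · intro i hi j hj hij
      simp only [Finset.mem_map, addRightEmbedding_apply] at hi hj
      obtain ⟨i, hi, rfl⟩ := hi
      obtain ⟨j, hj, rfl⟩ := hj
      have := hno i hi j hj (by omega)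
      omega

theorem Occ_nonempty_iff {T P : List α} (hP : 1 ≤ P.length) :
    (Occ T P).Nonempty ↔ P ∈ grams P.length T := by
  rw [List.mem_iff_getElem?]
  constructor
  · rintro ⟨k, hk⟩
    exact ⟨_, ((mem_Occ hP).1 hk).2⟩
  · rintro ⟨k, hk⟩
    exact ⟨k + 1, (mem_Occ hP).2 ⟨by omega, by simpa using hk⟩⟩

theorem nOcc_ne_zero_iff {T P : List α} : nOcc T P ≠ 0 ↔ (Occ T P).Nonempty := by
  classical
  constructor
  · intro h
    by_contra hne
    rw [Finset.not_nonempty_iff_eq_empty] at hne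
    apply h
    rw [nOcc, hne, ← Nat.le_zero]
    refine Finset.sup_le fun A hA => ?_
    simp only [Finset.mem_filter, Finset.mem_powerset, Finset.subset_empty] at hA
    simp [hA.1]
  · rintro ⟨k, hk⟩ h
    have : ({k} : Finset ℕ).card ≤ nOcc T P := by
      refine Finset.le_sup (f := Finset.card) ?_
      simp only [Finset.mem_filter, Finset.mem_powerset, Finset.singleton_subset_iff]
      refine ⟨hk, ?_⟩
      intro i hi j hj hij
      simp only [Finset.mem_singleton] at hi hj
      omega
    simp [h] at this

theorem nOcc_le_length {T P : List α} : nOcc T P ≤ T.length := by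
  classical
  refine Finset.sup_le fun A hA => ?_
  simp only [Finset.mem_filter, Finset.mem_powerset] at hA
  refine (Finset.card_le_card hA.1).trans ((Finset.card_filter_le _ _).trans ?_)
  simp

end Grams

/-! ### Rows of arrays and copying -/

namespace ArrayProg

open Greedy

/-- From position `b` on, `A` holds the list `L`. -/
def Row (A : ℕ → ℕ) (b : ℕ) (L : List ℕ) : Prop :=
  ∀ k < L.length, A (b + k) = L.getD k 0

theorem Row.congr {A A' : ℕ → ℕ} {b : ℕ} {L : List ℕ} (h : Row A b L)
    (hA : ∀ k < L.length, A' (b + k) = A (b + k)) : Row A' b L :=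
  fun k hk => (hA k hk).trans (h k hk)

theorem row_nil (A : ℕ → ℕ) (b : ℕ) : Row A b [] := fun k hk => by simp at hk

theorem Row.getElem? {A : ℕ → ℕ} {b : ℕ} {L : List ℕ} (h : Row A b L) {k : ℕ}
    (hk : k < L.length) : L[k]? = some (A (b + k)) := by
  rw [h k hk, List.getD_eq_getElem?_getD, List.getElem?_eq_getElem hk]; rfl

theorem Row.mem {A : ℕ → ℕ} {b : ℕ} {L : List ℕ} (h : Row A b L) {k : ℕ}
    (hk : k < L.length) : A (b + k) ∈ L :=
  List.mem_of_getElem? (h.getElem? hk)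

/-- Appending one more entry to a list that is cut off at length `cap`: the entry is added as long
as there is room, and discarded otherwise. -/
theorem take_append_take_succ {L M : List ℕ} {k cap : ℕ} (hk : k < M.length) :
    (((L ++ M.take k).take cap).length < cap →
      (L ++ M.take (k + 1)).take cap = (L ++ M.take k).take cap ++ [M.getD k 0]) ∧
    (¬ ((L ++ M.take k).take cap).length < cap →
      (L ++ M.take (k + 1)).take cap = (L ++ M.take k).take cap) := by
  have hs : M.take (k + 1) = M.take k ++ [M.getD k 0] := by
    rw [List.take_add_one, List.getD_eq_getElem?_getD, List.getElem?_eq_getElem hk]; rfl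
  simp only [List.length_take, List.length_append]
  constructor
  · intro h
    rw [hs, List.take_of_length_le (l := L ++ M.take k) (by simp; omega),
      List.take_of_length_le (by simp; omega), List.append_assoc]
  · intro h
    rw [hs, ← List.append_assoc, List.take_append_of_le_length (by simp; omega)]

theorem Row.snoc {A : ℕ → ℕ} {b : ℕ} {L : List ℕ} (h : Row A b L) {A' : ℕ → ℕ} {v : ℕ}
    (hA : ∀ y, A' y = if y = b + L.length then v else A y) : Row A' b (L ++ [v]) := by
  intro k hk
  simp only [List.length_append, List.length_singleton] at hk
  rw [hA]
  rcases Nat.lt_succ_iff_lt_or_eq.1 hk with hk' | rfl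
  · rw [if_neg (by omega), h k hk', List.getD_append _ _ _ _ hk']
  · simp

/-- Append the row with base register `42` and length register `43` of array `src`, or its
reversal, to the row with base register `40` and length register `50` of array `dst`, up to the
length in register `41`. -/
def appendRow (dst src : ℕ) (rev : Bool) : Cmd :=
  .forUp 51 43 (.ifLt (.reg 50) (.reg 41)
    (.ld 52 src (if rev then .sub (.add (.reg 42) (.reg 43)) (.add (.reg 51) (.const 1))
      else .add (.reg 42) (.reg 51)) ;;
     .st dst (.add (.reg 40) (.reg 50)) (.reg 52) ;;
     .set 50 (.add (.reg 50) (.const 1)))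
    .skip)

/-- The source may be the destination array itself, if it ends before the row that is written. -/
theorem appendRow_spec {W Z dst src : ℕ} {rev : Bool} {σ : AState} {L M : List ℕ}
    {cap db sb : ℕ} (hZ : Z < W) (hdst : dst < 27) (hsrc : src < 27)
    (h40 : σ.reg 40 = db) (h41 : σ.reg 41 = cap) (h42 : σ.reg 42 = sb)
    (h43 : σ.reg 43 = M.length) (h50 : σ.reg 50 = L.length) (hL : L.length ≤ cap)
    (hrow : Row (σ.arr dst) db L) (hM : Row (σ.arr src) sb M) (hdb : db + cap ≤ Z)
    (hsb : sb + M.length ≤ Z) (hne : src ≠ dst ∨ sb + M.length ≤ db) :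
    WP W Z 27 (appendRow dst src rev) (fun σ' t => t ≤ 6 * M.length + 2 ∧
      (∀ r < 50, σ'.reg r = σ.reg r) ∧
      σ'.reg 50 = ((L ++ if rev then M.reverse else M).take cap).length ∧
      Row (σ'.arr dst) db ((L ++ if rev then M.reverse else M).take cap) ∧
      (∀ a, a ≠ dst → σ'.arr a = σ.arr a) ∧
      ∀ x, x < db ∨ db + ((L ++ if rev then M.reverse else M).take cap).length ≤ x →
        σ'.arr dst x = σ.arr dst x) σ := by
  generalize hN : (if rev then M.reverse else M) = N
  have hNl : N.length = M.length := by subst hN; cases rev <;> simp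
  refine (WP.forUp (fun k τ => (∀ r < 50, τ.reg r = σ.reg r) ∧
      τ.reg 50 = ((L ++ N.take k).take cap).length ∧
      Row (τ.arr dst) db ((L ++ N.take k).take cap) ∧
      (∀ a, a ≠ dst → τ.arr a = σ.arr a) ∧
      ∀ x, x < db ∨ db + ((L ++ N.take k).take cap).length ≤ x → τ.arr dst x = σ.arr dst x)
    M.length 4 (by omega) (by norm_num) ?_ ?_ ?_).mono ?_
  · refine ⟨fun r hr => ?_, ?_, ?_, fun _ _ => rfl, fun _ _ => rfl⟩
    · simp [show r ≠ 51 by omega]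
    · simp [h50, hL]
    · simpa [List.take_of_length_le hL] using hrow
  · rintro k τ - ⟨hf, -⟩
    rw [hf 43 (by norm_num), h43]
  · rintro k τ hk h51 ⟨hf, h50', hr', ha', hx'⟩
    have hcap : ((L ++ N.take k).take cap).length ≤ cap := by simp
    have hkey := take_append_take_succ (L := L) (M := N) (k := k) (cap := cap) (by omega)
    generalize hcur : (L ++ N.take k).take cap = cur at *
    have hsrcv : ∀ i, i < M.length → τ.arr src (sb + i) = M.getD i 0 := by
      intro i hi
      rw [← hM i hi]
      by_cases hsd : src = dst
      · rw [hsd] at hne ⊢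
        exact hx' _ (.inl (by simp at hne; omega))
      · rw [ha' src hsd]
    rw [wp_ifLt]
    simp only [HE.ok, HE.eval, hf, h41, h50', Nat.reduceLT, true_and]
    refine ⟨fun hlt => ?_, fun hlt => ?_⟩
    · have hv : ∀ e : HE, e = (if rev then
            .sub (.add (.reg 42) (.reg 43)) (.add (.reg 51) (.const 1))
          else .add (.reg 42) (.reg 51) : HE) → e.ok W τ.reg ∧ e.eval W τ.reg < Z ∧
          τ.arr src (e.eval W τ.reg) = N.getD k 0 := by
        rintro e rfl
        cases rev
        · simp only [Bool.false_eq_true, if_false] at hN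
          subst hN
          simp only [Bool.false_eq_true, if_false, HE.ok, HE.eval, hf, h42, h51, Nat.reduceLT,
            true_and]
          exact ⟨by omega, by omega, hsrcv k hk⟩
        · simp only [if_true] at hN
          subst hN
          simp only [if_true, HE.ok, HE.eval, hf, h42, h43, h51, Nat.reduceLT, true_and]
          refine ⟨by omega, by omega, ?_⟩
          have : sb + M.length - (k + 1) = sb + (M.length - 1 - k) := by omega
          rw [this, hsrcv _ (by omega)]
          simp only [List.getD_eq_getElem?_getD]
          rw [List.getElem?_reverse hk]
      obtain ⟨hv1, hv2, hv3⟩ := hv _ rfl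
      simp only [wp_seq, wp_ld, wp_st, wp_set]
      simp only [HE.ok, HE.eval, hv3, AState.set_reg, AState.put_reg, hf, h40, h50', h51]
      simp (disch := omega) only [Nat.reduceLT, Nat.reduceEqDiff, true_and, if_false, if_true,
        ne_eq, hf, h40, not_false_eq_true]
      refine ⟨hsrc, hv1, hv2, hdst, by omega, by omega, by omega, by omega, ?_, ?_, ?_, ?_, ?_⟩
      · intro r hr
        simp [show r ≠ 51 by omega, show r ≠ 50 by omega, show r ≠ 52 by omega, hf r hr]
      · simp [hkey.1 hlt]
      · rw [hkey.1 hlt]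
        exact hr'.snoc fun y => by simp [AState.put_arr_same]
      · intro a ha
        simp [AState.put_arr_ne _ ha, ha' a ha]
      · intro x hx
        simp only [AState.set_arr, AState.put_arr_same]
        rw [hkey.1 hlt] at hx
        simp only [List.length_append, List.length_singleton] at hx
        rw [if_neg (by omega)]
        exact hx' x (by omega)
    · rw [wp_skip]
      refine ⟨by omega, h51, fun r hr => ?_, ?_, ?_, ha', ?_⟩
      · simp [show r ≠ 51 by omega, hf r hr]
      · simp [h50', hkey.2 hlt]
      · rw [hkey.2 hlt]; exact hr'
      · rw [hkey.2 hlt]; exact hx'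
  · rintro σ' t ⟨ht, -, hf, h50', hr, ha, hx⟩
    rw [List.take_of_length_le (l := N) hNl.le] at h50' hr hx
    exact ⟨by omega, hf, h50', hr, ha, hx⟩

/-! ### Tables for the greedy selection, and their use -/

/-! The numbers of the arrays; a row is named by the position at which it starts in each of them.

* `aIN`: the assignments of the straight line program;
* `aLC`, `aRC`: the rows of the two factors; `aML`, `aMV`: length and letter of the middle part;
* `aPX`, `aPXL`, `aSX`, `aSXL`: the first and the last `q - 1` letters, and their numbers;
* `aU`: the windows; `aWL`: the numbers of their `q`-grams; `aNM`: the names of the positions in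
  `aU`;
* `aHD`, `aNX`: heads and links of the bucket lists; `aSTP`, `aNW`: stamps and new names;
* `aPY`, `aPYL`, `aSY`, `aSYL`: the names of the first and the last `q - 1` `q`-grams, and their
  numbers; `aHS`, `aHL`, `aFS`: the tables of states and losses, see `Table`;
* `aACC`: the numbers of occurrences of the rows in the derivation tree;
* `aFQ`, `aNF`: the frequencies of the names, and their new values while a row is treated;
* `aOUT`: the table of the results. -/

local notation "aIN" => 0
local notation "aLC" => 1
local notation "aRC" => 2
local notation "aML" => 3
local notation "aMV" => 4
local notation "aPX" => 5
local notation "aPXL" => 6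
local notation "aSX" => 7
local notation "aSXL" => 8
local notation "aU" => 9
local notation "aWL" => 10
local notation "aNM" => 11
local notation "aHD" => 12
local notation "aNX" => 13
local notation "aSTP" => 14
local notation "aNW" => 15
local notation "aPY" => 16
local notation "aPYL" => 17
local notation "aSY" => 18
local notation "aSYL" => 19
local notation "aHS" => 20
local notation "aHL" => 21
local notation "aFS" => 22
local notation "aACC" => 23
local notation "aFQ" => 24
local notation "aNF" => 25
local notation "aOUT" => 26

/-- The tables for a sequence `Y` in the rows at `v`: its first and last `q - 1` entries, the last
ones in reverse order; for every entry `z` at position `j < q - 1`, the final state of the greedy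
selection of `z` in `Y` when the positions up to `j` are blocked, and the number of hits that are
lost by blocking them; for every entry `z` among the last `q - 1` ones, the final state of the
greedy selection of `z` in `Y` without blocked positions. -/
structure Table (q : ℕ) (A : ℕ → ℕ → ℕ) (v : ℕ) (Y : List ℕ) : Prop where
  pyl : A aPYL v = (Y.take (q - 1)).length
  py : Row (A aPY) v (Y.take (q - 1))
  syl : A aSYL v = (Y.reverse.take (q - 1)).length
  sy : Row (A aSY) v (Y.reverse.take (q - 1))
  hs : ∀ j < (Y.take (q - 1)).length,
    A aHS (v + j) = state q (hits Y (A aPY (v + j))) (j + 1)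
  hl : ∀ j < (Y.take (q - 1)).length,
    A aHL (v + j) + count q (hits Y (A aPY (v + j))) (j + 1) = count q (hits Y (A aPY (v + j))) 0
  fs : ∀ k < (Y.reverse.take (q - 1)).length,
    A aFS (v + k) = state q (hits Y (A aSY (v + k))) 0

/-- Look up the final state of the selection of the symbol in register `40` without blocked
positions, in the tables at register `42`. -/
def lookupFresh : Cmd :=
  .set 50 (.const 0) ;; .ld 53 aSYL (.reg 42) ;;
  .forUp 52 53 (.ld 54 aSY (.add (.reg 42) (.reg 52)) ;;
    .ifEq (.reg 54) (.reg 40) (.ld 50 aFS (.add (.reg 42) (.reg 52))) .skip)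

/-- If the symbol is not among the last `q - 1` entries, then the final state is `0`. -/
theorem lookupFresh_spec {W Z q v z : ℕ} {σ : AState} {Y : List ℕ} (hZ : Z < W)
    (h40 : σ.reg 40 = z) (h42 : σ.reg 42 = v) (hT : Table q σ.arr v Y) (hv : v + q ≤ Z)
    (hq : 1 ≤ q) :
    WP W Z 27 lookupFresh (fun σ' t => t ≤ 5 * q + 4 ∧ (∀ r < 50, σ'.reg r = σ.reg r) ∧
      σ'.arr = σ.arr ∧ σ'.reg 50 = state q (hits Y z) 0) σ := by
  have hl : (Y.reverse.take (q - 1)).length ≤ q - 1 := by simp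
  have hsyl := hT.syl
  have hsy := hT.sy
  have hfs := hT.fs
  generalize hL : Y.reverse.take (q - 1) = L at *
  simp only [lookupFresh, wp_seq, wp_set, wp_ld]
  simp only [HE.ok, HE.eval, AState.set_reg, AState.set_arr, h40, h42, Nat.reduceEqDiff, if_false,
    hsyl]
  refine ⟨by norm_num, by omega, by norm_num, by norm_num, trivial, by omega, ?_⟩
  refine (WP.forUp (fun k τ => (∀ r < 50, τ.reg r = σ.reg r) ∧ τ.arr = σ.arr ∧
      τ.reg 53 = L.length ∧ (τ.reg 50 = state q (hits Y z) 0 ∨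
        (τ.reg 50 = 0 ∧ ∀ i < k, σ.arr aSY (v + i) ≠ z)))
    L.length 3 (by omega) (by norm_num) ?_ ?_ ?_).mono ?_
  · refine ⟨fun r hr => ?_, rfl, by simp, .inr ⟨by simp, by omega⟩⟩
    simp [show r ≠ 52 by omega, show r ≠ 53 by omega, show r ≠ 50 by omega]
  · rintro k τ - ⟨-, -, h, -⟩
    exact h
  · rintro k τ hk h52 ⟨hf, ha, h53, h50⟩
    simp (disch := omega) only [wp_seq, wp_ld, wp_ifEq, wp_skip, HE.ok, HE.eval, AState.set_reg,
      AState.set_arr, hf, h42, h40, h52, ha, Nat.reduceEqDiff, if_false, if_true, true_and]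
    refine ⟨by omega, by omega, by omega, by omega, ?_, ?_⟩
    · intro h
      refine ⟨by omega, by omega, by omega, by omega, by omega, ?_, h53, .inl ?_⟩
      · intro r hr
        simp [show r ≠ 52 by omega, show r ≠ 54 by omega, show r ≠ 50 by omega, hf r hr]
      · rw [hfs k hk, h]
    · intro h
      refine ⟨by omega, ?_, h53, ?_⟩
      · intro r hr
        simp [show r ≠ 52 by omega, show r ≠ 54 by omega, show r ≠ 50 by omega, hf r hr]
      · rcases h50 with h50 | ⟨h50, hno⟩
        · exact .inl h50
        · refine .inr ⟨h50, fun i hi => ?_⟩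
          rcases Nat.lt_succ_iff_lt_or_eq.1 hi with hi | rfl
          · exact hno i hi
          · exact h
  · rintro σ' t ⟨ht, -, hf, ha, -, h50⟩
    have : L.length * 5 ≤ (q - 1) * 5 := Nat.mul_le_mul_right _ hl
    refine ⟨by omega, hf, ha, ?_⟩
    rcases h50 with h50 | ⟨h50, hno⟩
    · exact h50
    · rw [h50, state_zero_of_suffix]
      intro b hb
      rw [hits, ← List.map_reverse, ← List.map_take, hL] at hb
      obtain ⟨y, hy, rfl⟩ := List.mem_map.1 hb
      obtain ⟨i, hi, rfl⟩ := List.mem_iff_getElem.1 hy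
      have h1 := hsy.getElem? hi
      rw [List.getElem?_eq_getElem hi] at h1
      simpa [Option.some.inj h1] using hno i hi

/-- Look up the result of the selection of the symbol in register `40`, started in the state in
register `41`, in the tables at register `42`: the final state is put into register `50`, and the
number of hits lost by the blocked positions into register `51`. -/
def lookup : Cmd :=
  lookupFresh ;; .set 51 (.const 0) ;; .ld 53 aPYL (.reg 42) ;;
  .forUp 52 53 (.ifLt (.reg 52) (.reg 41)
    (.ld 54 aPY (.add (.reg 42) (.reg 52)) ;;
      .ifEq (.reg 54) (.reg 40)
        (.ld 50 aHS (.add (.reg 42) (.reg 52)) ;; .ld 51 aHL (.add (.reg 42) (.reg 52))) .skip)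
    .skip) ;;
  .ifLt (.reg 53) (.reg 41) (.set 50 (.sub (.reg 41) (.reg 53))) .skip

/-- The selection started in state `d` behaves like the one that is blocked just beyond the last
hit before position `d`. -/
theorem lookup_spec {W Z q v z d : ℕ} {σ : AState} {Y : List ℕ} (hZ : Z < W)
    (h40 : σ.reg 40 = z) (h41 : σ.reg 41 = d) (h42 : σ.reg 42 = v) (hT : Table q σ.arr v Y)
    (hv : v + q ≤ Z) (hq : 1 ≤ q) (hd : d ≤ q - 1) :
    WP W Z 27 lookup (fun σ' t => t ≤ 12 * q + 12 ∧ (∀ r < 50, σ'.reg r = σ.reg r) ∧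
      σ'.arr = σ.arr ∧ σ'.reg 50 = state q (hits Y z) d ∧
      σ'.reg 51 + count q (hits Y z) d = count q (hits Y z) 0) σ := by
  have hl : (Y.take (q - 1)).length ≤ q - 1 := by simp
  have hlY : (Y.take (q - 1)).length = min (q - 1) Y.length := by simp
  have hpyl := hT.pyl
  have hpy := hT.py
  have hhs := hT.hs
  have hhl := hT.hl
  have hget : ∀ j < (Y.take (q - 1)).length,
      (hits Y z).getD j false = decide (σ.arr aPY (v + j) = z) := by
    intro j hj
    have h1 := hpy.getElem? hj
    have h2 : Y[j]? = some (σ.arr aPY (v + j)) := by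
      rw [← h1, List.getElem?_take, if_pos (by omega)]
    simp [hits, List.getD_eq_getElem?_getD, List.getElem?_map, h2]
  generalize hm : (Y.take (q - 1)).length = m at *
  rw [lookup, wp_seq]
  refine (lookupFresh_spec hZ h40 h42 hT hv hq).mono ?_
  rintro σ₁ t₁ ⟨ht₁, hf₁, ha₁, h50₁⟩
  simp (disch := omega) only [wp_seq, wp_set, wp_ld, HE.ok, HE.eval, AState.set_reg,
    AState.set_arr, hf₁, h42, ha₁, hpyl, Nat.reduceEqDiff, if_false, if_true, true_and]
  refine ⟨by omega, by omega, by omega, by omega, by omega, ?_⟩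
  refine (WP.forUp (fun k τ => (∀ r < 50, τ.reg r = σ.reg r) ∧ τ.arr = σ.arr ∧
      τ.reg 53 = m ∧ ∃ d' ≤ min k d, τ.reg 50 = state q (hits Y z) d' ∧
        τ.reg 51 + count q (hits Y z) d' = count q (hits Y z) 0 ∧
        ∀ i, d' ≤ i → i < min k d → (hits Y z).getD i false = false)
    m 5 (by omega) (by norm_num) ?_ ?_ ?_).mono ?_
  · refine ⟨fun r hr => ?_, by simp [ha₁], by simp, 0, by omega, by simp [h50₁], by simp,
      by omega⟩
    simp [show r ≠ 52 by omega, show r ≠ 53 by omega, show r ≠ 51 by omega, hf₁ r hr]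
  · rintro k τ - ⟨-, -, h, -⟩
    exact h
  · rintro k τ hk h52 ⟨hf, ha, h53, d', hd', h50, h51, hno⟩
    simp (disch := omega) only [wp_seq, wp_ld, wp_ifEq, wp_ifLt, wp_skip, HE.ok, HE.eval,
      AState.set_reg, AState.set_arr, hf, h42, h40, h41, h52, ha, Nat.reduceEqDiff, if_false,
      if_true, true_and]
    refine ⟨fun hkd => ⟨by omega, by omega, by omega, by omega, fun h => ?_, fun h => ?_⟩,
      fun hkd => ?_⟩
    · refine ⟨by omega, by omega, by omega, by omega, by omega, by omega, by omega, by omega,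
        by omega, ?_, h53, k + 1, by omega, ?_, ?_, by omega⟩
      · intro r hr
        simp [show r ≠ 52 by omega, show r ≠ 54 by omega, show r ≠ 50 by omega,
          show r ≠ 51 by omega, hf r hr]
      · rw [hhs k hk, h]
      · have := hhl k hk; rwa [h] at this
    · refine ⟨by omega, ?_, h53, d', by omega, h50, h51, ?_⟩
      · intro r hr
        simp [show r ≠ 52 by omega, show r ≠ 54 by omega, hf r hr]
      · intro i hi1 hi2
        rcases (show i < min k d ∨ i = k by omega) with hi | rfl
        · exact hno i hi1 hi
        · rw [hget i hk]; simpa using h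
    · refine ⟨by omega, ?_, h53, d', by omega, h50, h51, fun i hi1 hi2 =>
        hno i hi1 (by omega)⟩
      intro r hr
      simp [show r ≠ 52 by omega, hf r hr]
  · rintro σ' t ⟨ht, -, hf, ha, h53, d', hd', h50, h51, hno⟩
    have hno' : ∀ i, d' ≤ i → i < d → (hits Y z).getD i false = false := by
      intro i hi1 hi2
      by_cases him : i < m
      · exact hno i hi1 (by omega)
      · rw [List.getD_eq_default]
        rw [length_hits]; omega
    have hkey := of_no_hit (q := q) (show d' ≤ d by omega) hno'
    have hm5 : m * (5 + 2) ≤ (q - 1) * 7 := Nat.mul_le_mul_right _ hl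
    simp (disch := omega) only [wp_ifLt, wp_set, wp_skip, HE.ok, HE.eval, h53, hf, h41,
      true_and, AState.set_reg, AState.set_arr, if_true, Nat.reduceEqDiff, if_false]
    refine ⟨fun hlt => ⟨by omega, by omega, by omega, ?_, ha, ?_, ?_⟩,
      fun hlt => ⟨by omega, fun r hr => hf r hr, ha, ?_, ?_⟩⟩
    · intro r hr
      simp [show r ≠ 50 by omega, hf r hr]
    · rw [(of_length_le (by rw [length_hits]; omega)).1, length_hits]
      omega
    · rw [← hkey.1]; exact h51
    · rw [h50, hkey.2 (by rw [length_hits]; omega)]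
    · rw [← hkey.1]; exact h51

theorem Table.congr {q v : ℕ} {A A' : ℕ → ℕ → ℕ} {Y : List ℕ} (h : Table q A v Y) (hq : 1 ≤ q)
    (hA : ∀ a, 16 ≤ a → a ≤ 22 → ∀ x, v ≤ x → x < v + q → A' a x = A a x) :
    Table q A' v Y := by
  have h1 : (Y.take (q - 1)).length ≤ q - 1 := by simp
  have h2 : (Y.reverse.take (q - 1)).length ≤ q - 1 := by simp
  refine ⟨?_, ?_, ?_, ?_, fun j hj => ?_, fun j hj => ?_, fun j hj => ?_⟩
  · rw [hA _ (by norm_num) (by norm_num) _ le_rfl (by omega)]; exact h.pyl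
  · exact h.py.congr fun k hk => hA _ (by norm_num) (by norm_num) _ (by omega) (by omega)
  · rw [hA _ (by norm_num) (by norm_num) _ le_rfl (by omega)]; exact h.syl
  · exact h.sy.congr fun k hk => hA _ (by norm_num) (by norm_num) _ (by omega) (by omega)
  · rw [hA aHS (by norm_num) (by norm_num) _ (by omega) (by omega),
      hA aPY (by norm_num) (by norm_num) _ (by omega) (by omega)]
    exact h.hs j hj
  · rw [hA aHL (by norm_num) (by norm_num) _ (by omega) (by omega),
      hA aPY (by norm_num) (by norm_num) _ (by omega) (by omega)]
    exact h.hl j hj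
  · rw [hA aFS (by norm_num) (by norm_num) _ (by omega) (by omega),
      hA aSY (by norm_num) (by norm_num) _ (by omega) (by omega)]
    exact h.fs j hj

/-- The registers and arrays describe a sequence `Yl ++ M ++ Yr`: there are tables for `Yl` in the
rows at `lb` and for `Yr` in the rows at `rb`, and the middle part `M` is stored at `v`. -/
structure Triple (q Z v lb rb : ℕ) (Yl M Yr : List ℕ) (σ : AState) : Prop where
  r4 : σ.reg 4 = q - 1
  r11 : σ.reg 11 = v
  r13 : σ.reg 13 = lb
  r15 : σ.reg 15 = rb
  r16 : σ.reg 16 = M.length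
  hM : Row (σ.arr aNM) v M
  hl : Table q σ.arr lb Yl
  hr : Table q σ.arr rb Yr
  hv : v + M.length ≤ Z
  hlb : lb + q ≤ Z
  hrb : rb + q ≤ Z

theorem Triple.congr {q Z v lb rb : ℕ} {Yl M Yr : List ℕ} {σ τ : AState}
    (h : Triple q Z v lb rb Yl M Yr σ) (hq : 1 ≤ q) (hreg : ∀ r < 20, τ.reg r = σ.reg r)
    (hnm : τ.arr aNM = σ.arr aNM) (hlv : lb + q ≤ v) (hrv : rb + q ≤ v)
    (hA : ∀ a, 16 ≤ a → a ≤ 22 → ∀ x < v, τ.arr a x = σ.arr a x) :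
    Triple q Z v lb rb Yl M Yr τ where
  r4 := by rw [hreg _ (by norm_num), h.r4]
  r11 := by rw [hreg _ (by norm_num), h.r11]
  r13 := by rw [hreg _ (by norm_num), h.r13]
  r15 := by rw [hreg _ (by norm_num), h.r15]
  r16 := by rw [hreg _ (by norm_num), h.r16]
  hM := by rw [hnm]; exact h.hM
  hl := h.hl.congr hq fun a h1 h2 x _ hx => hA a h1 h2 x (by omega)
  hr := h.hr.congr hq fun a h1 h2 x _ hx => hA a h1 h2 x (by omega)
  hv := h.hv
  hlb := h.hlb
  hrb := h.hrb

/-- The greedy selection of the symbol in register `20`, started in the state in register `21`,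
along the sequence described by the registers: the final state is put into register `30`, the number
of hits selected in the middle part into register `31`, and the losses in the outer parts into
registers `32` and `33`. -/
def walk : Cmd :=
  .set 40 (.reg 20) ;; .set 41 (.reg 21) ;; .set 42 (.reg 13) ;; lookup ;;
  .set 30 (.reg 50) ;; .set 32 (.reg 51) ;; .set 31 (.const 0) ;;
  .forUp 34 16 (.ifLt (.const 0) (.reg 30) (.set 30 (.sub (.reg 30) (.const 1)))
    (.ld 35 aNM (.add (.reg 11) (.reg 34)) ;;
      .ifEq (.reg 35) (.reg 20) (.set 31 (.add (.reg 31) (.const 1)) ;; .set 30 (.reg 4))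
        .skip)) ;;
  .set 41 (.reg 30) ;; .set 42 (.reg 15) ;; lookup ;;
  .set 30 (.reg 50) ;; .set 33 (.reg 51)

/-- The tables hold losses instead of counts, so the number of hits in the composed sequence is
obtained relative to the numbers of hits in the outer parts. -/
theorem walk_spec {W Z q v lb rb z d : ℕ} {σ : AState} {Yl M Yr : List ℕ} (hZ : Z < W)
    (h20 : σ.reg 20 = z) (h21 : σ.reg 21 = d) (hT : Triple q Z v lb rb Yl M Yr σ)
    (hq : 1 ≤ q) (hd : d ≤ q - 1) :
    WP W Z 27 walk (fun σ' t => t ≤ 7 * M.length + 24 * q + 40 ∧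
      (∀ r < 30, σ'.reg r = σ.reg r) ∧ σ'.arr = σ.arr ∧
      σ'.reg 30 = state q (hits (Yl ++ M ++ Yr) z) d ∧
      σ'.reg 31 + count q (hits Yl z) 0 + count q (hits Yr z) 0 =
        count q (hits (Yl ++ M ++ Yr) z) d + σ'.reg 32 + σ'.reg 33 ∧
      σ'.reg 31 ≤ M.length ∧ σ'.reg 32 ≤ 1 ∧ σ'.reg 33 ≤ 1) σ := by
  obtain ⟨h4, h11, h13, h15, h16, hM, hl, hr, hv, hlb, hrb⟩ := hT
  simp only [walk, wp_seq, wp_set, HE.ok, HE.eval, AState.set_reg, AState.set_arr, h20, h21, h13,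
    Nat.reduceEqDiff, if_false, true_and]
  refine ⟨by norm_num, by norm_num, by norm_num, ?_⟩
  refine (lookup_spec (z := z) (d := d) (v := lb) (q := q) (Y := Yl) hZ ?_ ?_ ?_ ?_ hlb hq
    hd).mono ?_
  · simp
  · simp
  · simp
  · exact hl
  rintro σ₁ t₁ ⟨ht₁, hf₁, ha₁, h50₁, h51₁⟩
  have hf₁' : ∀ r < 40, σ₁.reg r = σ.reg r := by
    intro r hr
    rw [hf₁ r (by omega)]
    simp [show r ≠ 40 by omega, show r ≠ 41 by omega, show r ≠ 42 by omega]
  have h40₁ : σ₁.reg 40 = z := by rw [hf₁ 40 (by norm_num)]; simp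
  simp only [AState.set_arr] at ha₁
  refine ⟨by norm_num, by norm_num, by norm_num, by omega, ?_⟩
  have hs₁ : state q (hits Yl z) d ≤ q - 1 := state_le hd
  set s₁ := state q (hits Yl z) d with hs₁def
  refine (WP.forUp (fun k τ => (∀ r < 30, τ.reg r = σ.reg r) ∧ τ.arr = σ.arr ∧ τ.reg 40 = z ∧
      τ.reg 32 = σ₁.reg 51 ∧ τ.reg 30 = state q (hits (M.take k) z) s₁ ∧
      τ.reg 31 = count q (hits (M.take k) z) s₁ ∧ τ.reg 31 ≤ k)
    M.length 5 (by omega) (by norm_num) ?_ ?_ ?_).mono ?_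
  · refine ⟨fun r hr => ?_, by simp [ha₁], by simp [h40₁], by simp, ?_, ?_, by simp⟩
    · simp [show r ≠ 34 by omega, show r ≠ 31 by omega, show r ≠ 32 by omega,
        show r ≠ 30 by omega, hf₁' r (by omega)]
    · simp [h50₁, hits, state]
    · simp [hits, count]
  · rintro k τ - ⟨hf, -⟩
    rw [hf 16 (by norm_num), h16]
  · rintro k τ hk h34 ⟨hf, ha, h40, h32, h30, h31, h31k⟩
    have htake : M.take (k + 1) = M.take k ++ [σ.arr aNM (v + k)] := by
      rw [List.take_add_one, hM.getElem? hk]; rfl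
    have hst : state q (hits (M.take (k + 1)) z) s₁ =
        step q (decide (σ.arr aNM (v + k) = z)) (state q (hits (M.take k) z) s₁) := by
      rw [htake, hits_append, state_append]; rfl
    have hct : count q (hits (M.take (k + 1)) z) s₁ = count q (hits (M.take k) z) s₁ +
        (if state q (hits (M.take k) z) s₁ = 0 ∧ σ.arr aNM (v + k) = z then 1 else 0) := by
      rw [htake, hits_append, count_append]; simp [hits, count]
    have hsle : state q (hits (M.take k) z) s₁ ≤ q - 1 := state_le hs₁
    simp (disch := omega) only [wp_seq, wp_ld, wp_ifEq, wp_ifLt, wp_set, wp_skip, HE.ok, HE.eval,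
      AState.set_reg, AState.set_arr, hf, h4, h11, h20, h34, ha, Nat.reduceEqDiff, if_false,
      if_true, true_and]
    refine ⟨by omega, fun h0 => ?_, fun h0 => ⟨by omega, by omega, by omega, by omega,
      fun h => ?_, fun h => ?_⟩⟩
    · and_intros <;> try omega
      · intro r hr
        simp [show r ≠ 34 by omega, show r ≠ 30 by omega, hf r hr]
      · rw [hst, step, if_neg (by omega), h30]
      · rw [hct, if_neg (by omega), h31, add_zero]
    · and_intros <;> try omega
      · intro r hr
        simp [show r ≠ 34 by omega, show r ≠ 30 by omega, show r ≠ 35 by omega,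
          show r ≠ 31 by omega, hf r hr]
      · rw [hst, step, if_pos (by omega)]; simp [h]
      · rw [hct, if_pos ⟨by omega, h⟩, h31]
    · and_intros <;> try omega
      · intro r hr
        simp [show r ≠ 34 by omega, show r ≠ 35 by omega, hf r hr]
      · rw [hst, step, if_pos (by omega)]
        simp only [h, decide_false, Bool.false_eq_true, if_false]
        omega
      · rw [hct, if_neg (by tauto), h31, add_zero]
  · rintro σ₂ t₂ ⟨ht₂, -, hf₂, ha₂, h40₂, h32₂, h30₂, h31₂, h31k⟩
    rw [List.take_of_length_le le_rfl] at h30₂ h31₂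
    have hs₂ : state q (hits M z) s₁ ≤ q - 1 := state_le hs₁
    simp (disch := omega) only [HE.ok, HE.eval, AState.set_reg, AState.set_arr, hf₂, h15, h30₂,
      Nat.reduceEqDiff, if_false, true_and]
    refine ⟨by omega, by omega, ?_⟩
    refine (lookup_spec (z := z) (d := state q (hits M z) s₁) (v := rb) (q := q) (Y := Yr) hZ
      ?_ ?_ ?_ ?_ hrb hq hs₂).mono ?_
    · simp [h40₂]
    · simp
    · simp
    · simpa [ha₂] using hr
    rintro σ₃ t₃ ⟨ht₃, hf₃, ha₃, h50₃, h51₃⟩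
    have hf₃' : ∀ r < 40, σ₃.reg r = σ₂.reg r := by
      intro r hr
      rw [hf₃ r (by omega)]
      simp [show r ≠ 41 by omega, show r ≠ 42 by omega]
    simp only [Nat.reduceEqDiff, if_true, if_false]
    rw [hf₃' 31 (by norm_num), hf₃' 32 (by norm_num), h31₂, h32₂]
    have hc : count q (hits (Yl ++ M ++ Yr) z) d = count q (hits Yl z) d +
        count q (hits M z) s₁ + count q (hits Yr z) (state q (hits M z) s₁) := by
      rw [hits_append, hits_append, count_append, count_append, state_append]
    have hi₁ := (count_interleave (q := q) (hits Yl z) (Nat.zero_le d) hd).2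
    have hi₂ := (count_interleave (q := q) (hits Yr z) (Nat.zero_le _) hs₂).2
    and_intros <;> try omega
    · intro r hr
      simp [show r ≠ 33 by omega, show r ≠ 30 by omega, hf₃' r (by omega), hf₂ r hr]
    · rw [ha₃]; simp [ha₂]
    · rw [h50₃, hits_append, hits_append, state_append, state_append]

/-! ### Concatenation of rows -/

/-- A stored list: its entries are in array `src` from position `b` on, and entry `b` of array
`len` holds its length. -/
structure Stored (Z : ℕ) (A : ℕ → ℕ → ℕ) (src len b : ℕ) (M : List ℕ) : Prop where
  len : A len b = M.length
  row : Row (A src) b M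
  lt : b < Z
  le : b + M.length ≤ Z

/-- Append the list stored in `src` and `len` at the position in register `b`, see `appendRow`. -/
def push (dst src len b : ℕ) (rev : Bool) : Cmd :=
  .set 42 (.reg b) ;; .ld 43 len (.reg b) ;; appendRow dst src rev

/-- `M`, or the reversal of `M`. -/
def dirList (rev : Bool) (M : List ℕ) : List ℕ := if rev then M.reverse else M

theorem push_spec {W Z dst src len b : ℕ} {rev : Bool} {σ : AState} {L M : List ℕ}
    {cap db sb : ℕ} (hZ : Z < W) (hdst : dst < 27) (hsrc : src < 27) (hlen : len < 27)
    (hb : b < 40) (h40 : σ.reg 40 = db) (h41 : σ.reg 41 = cap) (hbv : σ.reg b = sb)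
    (h50 : σ.reg 50 = L.length) (hL : L.length ≤ cap) (hrow : Row (σ.arr dst) db L)
    (hM : Stored Z σ.arr src len sb M) (hdb : db + cap ≤ Z)
    (hne : src ≠ dst ∨ sb + M.length ≤ db) :
    WP W Z 27 (push dst src len b rev) (fun σ' t => t ≤ 6 * M.length + 4 ∧
      (∀ r < 42, σ'.reg r = σ.reg r) ∧
      σ'.reg 50 = ((L ++ dirList rev M).take cap).length ∧
      Row (σ'.arr dst) db ((L ++ dirList rev M).take cap) ∧
      (∀ a, a ≠ dst → σ'.arr a = σ.arr a) ∧
      ∀ x, x < db ∨ db + ((L ++ dirList rev M).take cap).length ≤ x →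
        σ'.arr dst x = σ.arr dst x) σ := by
  have h1 := hM.len
  have h2 := hM.row
  have h3 := hM.lt
  have h4 := hM.le
  simp (disch := omega) only [push, wp_seq, wp_set, wp_ld, HE.ok, HE.eval, AState.set_reg,
    AState.set_arr, hbv, h1, Nat.reduceEqDiff, if_false, true_and, if_neg]
  refine ⟨by norm_num, by norm_num, hlen, h3, ?_⟩
  refine (appendRow_spec (L := L) (M := M) (cap := cap) (db := db) (sb := sb) hZ hdst hsrc
    ?_ ?_ ?_ ?_ ?_ hL ?_ ?_ hdb h4 hne).mono ?_
  · simpa using h40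
  · simpa using h41
  · simp
  · simp
  · simpa using h50
  · simpa using hrow
  · simpa using h2
  rintro σ' t ⟨ht, hf, h50', hr, ha, hx⟩
  refine ⟨by omega, fun r hr => ?_, h50', hr, ha, hx⟩
  rw [hf r (by omega)]
  simp [show r ≠ 42 by omega, show r ≠ 43 by omega]

/-- Write the concatenation of three stored lists into array `dst`, at the position in register
`11`, cut off at the length in register `41`. Its length is put into register `50`. -/
def cat3 (dst s₁ l₁ b₁ : ℕ) (d₁ : Bool) (s₂ l₂ b₂ : ℕ) (d₂ : Bool) (s₃ l₃ b₃ : ℕ) (d₃ : Bool) :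
    Cmd :=
  .set 40 (.reg 11) ;; .set 50 (.const 0) ;; push dst s₁ l₁ b₁ d₁ ;; push dst s₂ l₂ b₂ d₂ ;;
  push dst s₃ l₃ b₃ d₃

theorem take_take_append (A B : List ℕ) (c : ℕ) : (A.take c ++ B).take c = (A ++ B).take c := by
  rw [List.take_append, List.take_append, List.take_take, min_self]
  rcases le_total c A.length with h | h
  · simp [h]
  · simp [List.length_take, h]

theorem take_append_take (A B : List ℕ) (c : ℕ) : (A ++ B.take c).take c = (A ++ B).take c := by
  rw [List.take_append, List.take_append, List.take_take]
  congr 2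
  omega

theorem cat3_spec {W Z dst s₁ l₁ b₁ s₂ l₂ b₂ s₃ l₃ b₃ : ℕ} {d₁ d₂ d₃ : Bool} {σ : AState}
    {M₁ M₂ M₃ : List ℕ} {cap v x₁ x₂ x₃ : ℕ} (hZ : Z < W) (h11 : σ.reg 11 = v)
    (h41 : σ.reg 41 = cap) (hv : v + cap ≤ Z)
    (hlit : dst < 27 ∧ s₁ < 27 ∧ s₂ < 27 ∧ s₃ < 27 ∧ l₁ < 27 ∧ l₂ < 27 ∧ l₃ < 27 ∧
      b₁ < 40 ∧ b₂ < 40 ∧ b₃ < 40)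
    (hl₂ : l₂ ≠ dst) (hl₃ : l₃ ≠ dst)
    (hb₁ : σ.reg b₁ = x₁) (hb₂ : σ.reg b₂ = x₂) (hb₃ : σ.reg b₃ = x₃)
    (hM₁ : Stored Z σ.arr s₁ l₁ x₁ M₁) (hM₂ : Stored Z σ.arr s₂ l₂ x₂ M₂)
    (hM₃ : Stored Z σ.arr s₃ l₃ x₃ M₃)
    (hne₁ : s₁ ≠ dst ∨ x₁ + M₁.length ≤ v) (hne₂ : s₂ ≠ dst ∨ x₂ + M₂.length ≤ v)
    (hne₃ : s₃ ≠ dst ∨ x₃ + M₃.length ≤ v) {T : List ℕ}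
    (hT : T = (dirList d₁ M₁ ++ dirList d₂ M₂ ++ dirList d₃ M₃).take cap) :
    WP W Z 27 (cat3 dst s₁ l₁ b₁ d₁ s₂ l₂ b₂ d₂ s₃ l₃ b₃ d₃) (fun σ' t =>
      t ≤ 6 * (M₁.length + M₂.length + M₃.length) + 14 ∧
      (∀ r < 40, σ'.reg r = σ.reg r) ∧ σ'.reg 41 = cap ∧
      σ'.reg 50 = T.length ∧ Row (σ'.arr dst) v T ∧ (∀ a, a ≠ dst → σ'.arr a = σ.arr a) ∧
      ∀ x, x < v ∨ v + T.length ≤ x → σ'.arr dst x = σ.arr dst x) σ := by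
  obtain ⟨hdst, hs₁, hs₂, hs₃, hl₁', hl₂', hl₃', hb₁', hb₂', hb₃'⟩ := hlit
  simp only [cat3, wp_seq, wp_set, HE.ok, HE.eval, AState.set_reg, AState.set_arr, h11,
    true_and]
  refine ⟨by norm_num, by norm_num, by omega, ?_⟩
  -- a stored source survives changes of `dst` inside the row that is being written
  have hst : ∀ {τ : AState} {s l x : ℕ} {M : List ℕ}, Stored Z σ.arr s l x M → l ≠ dst →
      (s ≠ dst ∨ x + M.length ≤ v) → (∀ a, a ≠ dst → τ.arr a = σ.arr a) →
      (∀ y < v, τ.arr dst y = σ.arr dst y) → Stored Z τ.arr s l x M := by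
    intro τ s l x M h hl hs ha hy
    refine ⟨by rw [ha l hl]; exact h.len, h.row.congr fun k hk => ?_, h.lt, h.le⟩
    by_cases hsd : s = dst
    · rw [hsd, hy _ (by simp [hsd] at hs; omega)]
    · rw [ha s hsd]
  refine (push_spec (L := []) (M := M₁) (cap := cap) (db := v) (sb := x₁) hZ hdst hs₁ hl₁' hb₁'
    ?_ ?_ ?_ ?_ (by simp) (row_nil _ _) ?_ hv hne₁).mono ?_
  · simp
  · simp [h41]
  · simp [show b₁ ≠ 40 by omega, show b₁ ≠ 50 by omega, hb₁]
  · simp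
  · exact hM₁
  rintro σ₁ t₁ ⟨ht₁, hf₁, h50₁, hr₁, ha₁, hx₁⟩
  have hf₁' : ∀ r < 40, σ₁.reg r = σ.reg r := fun r hr => by
    rw [hf₁ r (by omega)]; simp [show r ≠ 40 by omega, show r ≠ 50 by omega]
  have hreg₁ : σ₁.reg 40 = v ∧ σ₁.reg 41 = cap := by
    rw [hf₁ _ (by norm_num), hf₁ _ (by norm_num)]; simp [h41]
  refine (push_spec (M := M₂) (cap := cap) (db := v) (sb := x₂) hZ hdst hs₂ hl₂' hb₂'
    hreg₁.1 hreg₁.2 ((hf₁' _ hb₂').trans hb₂) h50₁ (by simp) hr₁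
    (hst hM₂ hl₂ hne₂ ha₁ fun y hy => hx₁ y (.inl hy)) hv hne₂).mono ?_
  rintro σ₂ t₂ ⟨ht₂, hf₂, h50₂, hr₂, ha₂, hx₂⟩
  refine (push_spec (M := M₃) (cap := cap) (db := v) (sb := x₃) hZ hdst hs₃ hl₃' hb₃'
    ((hf₂ _ (by norm_num)).trans hreg₁.1) ((hf₂ _ (by norm_num)).trans hreg₁.2)
    ((hf₂ _ (by omega)).trans ((hf₁' _ hb₃').trans hb₃)) h50₂ (by simp) hr₂
    (hst hM₃ hl₃ hne₃ (fun a h => (ha₂ a h).trans (ha₁ a h)) fun y hy =>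
      (hx₂ y (.inl hy)).trans (hx₁ y (.inl hy))) hv hne₃).mono ?_
  rintro σ₃ t₃ ⟨ht₃, hf₃, h50₃, hr₃, ha₃, hx₃⟩
  have hT₂ : ((dirList d₁ M₁).take cap ++ dirList d₂ M₂).take cap =
      (dirList d₁ M₁ ++ dirList d₂ M₂).take cap := take_take_append _ _ _
  have hT₃ : (((dirList d₁ M₁).take cap ++ dirList d₂ M₂).take cap ++ dirList d₃ M₃).take cap =
      T := by
    rw [hT₂, take_take_append, hT]
  simp only [List.nil_append, hT₃] at h50₃ hr₃ hx₃
  simp only [List.nil_append] at hx₁ hx₂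
  have hl₁₂ : ((dirList d₁ M₁).take cap).length ≤ T.length := by
    rw [hT]; simp
  have hl₂₃ : (((dirList d₁ M₁).take cap ++ dirList d₂ M₂).take cap).length ≤ T.length := by
    rw [hT]; simp; omega
  refine ⟨by omega, fun r hr => ?_, ?_, h50₃, hr₃, fun a h => ?_, fun x hx => ?_⟩
  · rw [hf₃ r (by omega), hf₂ r (by omega), hf₁' r hr]
  · rw [hf₃ _ (by norm_num), hf₂ _ (by norm_num), hreg₁.2]
  · rw [ha₃ a h, ha₂ a h, ha₁ a h]; rfl
  · rw [hx₃ x hx, hx₂ x (by omega), hx₁ x (by omega)]; rfl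

/-! ### The rows of a straight line program -/

/-- A straight line program in uniform shape: the string `X i` of row `i` is the concatenation of
the string of row `lc i`, of `mid i`, and of the string of row `rc i`. Row `0` has the empty
string, and takes the place of the missing factors of a letter. -/
structure RowSLP (n : ℕ) (lc rc : ℕ → ℕ) (mid X : ℕ → List ℕ) : Prop where
  zero : X 0 = []
  lc_lt : ∀ i, 1 ≤ i → i ≤ n → lc i < i
  rc_lt : ∀ i, 1 ≤ i → i ≤ n → rc i < i
  eq : ∀ i, 1 ≤ i → i ≤ n → X i = X (lc i) ++ mid i ++ X (rc i)
  mid_le : ∀ i, 1 ≤ i → i ≤ n → (mid i).length ≤ 1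
  leaf : ∀ i, 1 ≤ i → i ≤ n → mid i = [] ∨ (lc i = 0 ∧ rc i = 0)

/-- The sizes: rows have length `R`, and arrays have size `Z`, enough for two entries for each
of the `N` positions in the rows `0, …, n`, and for a string of length `q` at each of them. -/
structure Sizes (n q R N Z W : ℕ) : Prop where
  hn : 1 ≤ n
  hq : 1 ≤ q
  hR : R = 2 * q
  hN : N = (n + 1) * R
  hZ : Z = 2 * N + 4 * q
  hW : Z < W
  hW' : 1000 ≤ W

theorem row_lt {R i j : ℕ} (hij : i < j) : i * R + R ≤ j * R := by
  rw [← Nat.succ_mul]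
  exact Nat.mul_le_mul_right _ hij

section Sizes

variable {n q R N Z W : ℕ}

theorem Sizes.row_le (h : Sizes n q R N Z W) {i : ℕ} (hi : i ≤ n) : i * R + R ≤ N := by
  rw [h.hN, ← Nat.succ_mul]
  exact Nat.mul_le_mul_right _ (by omega)

theorem Sizes.n_le (h : Sizes n q R N Z W) : 2 * n ≤ N := by
  have := h.row_le (le_refl n)
  have h2 : n * 2 ≤ n * R := Nat.mul_le_mul_left n (by have := h.hR; have := h.hq; omega)
  omega

end Sizes

/-- The constants of the computation, in registers `0` to `6`. -/
structure Globals (n q R N Z : ℕ) (σ : AState) : Prop where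
  r0 : σ.reg 0 = n
  r1 : σ.reg 1 = q
  r2 : σ.reg 2 = Z
  r3 : σ.reg 3 = R
  r4 : σ.reg 4 = q - 1
  r5 : σ.reg 5 = N
  r6 : σ.reg 6 = n + q

theorem Globals.congr {n q R N Z : ℕ} {σ τ : AState} (h : Globals n q R N Z σ)
    (hr : ∀ r < 7, τ.reg r = σ.reg r) : Globals n q R N Z τ where
  r0 := by rw [hr _ (by norm_num), h.r0]
  r1 := by rw [hr _ (by norm_num), h.r1]
  r2 := by rw [hr _ (by norm_num), h.r2]
  r3 := by rw [hr _ (by norm_num), h.r3]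
  r4 := by rw [hr _ (by norm_num), h.r4]
  r5 := by rw [hr _ (by norm_num), h.r5]
  r6 := by rw [hr _ (by norm_num), h.r6]

/-- The assignment of row `i`, where a row is represented by the position at which it starts. -/
structure RowData (n R Z : ℕ) (lc rc : ℕ → ℕ) (mid : ℕ → List ℕ) (A : ℕ → ℕ → ℕ) (i : ℕ) :
    Prop where
  lc : A aLC (i * R) = lc i * R
  rc : A aRC (i * R) = rc i * R
  mid : Stored Z A aMV aML (i * R) (mid i)

theorem RowData.congr {n R Z : ℕ} {lc rc : ℕ → ℕ} {mid : ℕ → List ℕ} {A A' : ℕ → ℕ → ℕ} {i : ℕ}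
    (h : RowData n R Z lc rc mid A i) (hm : (mid i).length ≤ 1)
    (hA : ∀ a, 1 ≤ a → a ≤ 4 → A' a (i * R) = A a (i * R)) :
    RowData n R Z lc rc mid A' i where
  lc := by rw [hA _ (by norm_num) (by norm_num), h.lc]
  rc := by rw [hA _ (by norm_num) (by norm_num), h.rc]
  mid := ⟨by rw [hA _ (by norm_num) (by norm_num), h.mid.len], h.mid.row.congr fun k hk => by
    obtain rfl : k = 0 := by omega
    exact hA _ (by norm_num) (by norm_num), h.mid.lt, h.mid.le⟩

/-- Compute the constants, and distribute the assignments over the rows. -/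
def setup : Cmd :=
  .set 3 (.mul (.const 2) (.reg 1)) ;; .set 4 (.sub (.reg 1) (.const 1)) ;;
  .set 5 (.mul (.add (.reg 0) (.const 1)) (.reg 3)) ;; .set 6 (.add (.reg 0) (.reg 1)) ;;
  .forUp 9 0 (
    .set 10 (.add (.reg 9) (.const 1)) ;; .set 11 (.mul (.reg 10) (.reg 3)) ;;
    .set 12 (.mul (.const 3) (.reg 9)) ;; .ld 13 aIN (.reg 12) ;;
    .ld 14 aIN (.add (.reg 12) (.const 1)) ;; .ld 15 aIN (.add (.reg 12) (.const 2)) ;;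
    .ifEq (.reg 13) (.const 0)
      (.st aML (.reg 11) (.const 1) ;; .st aMV (.reg 11) (.reg 14))
      (.st aLC (.reg 11) (.mul (.add (.reg 14) (.const 1)) (.reg 3)) ;;
        .st aRC (.reg 11) (.mul (.add (.reg 15) (.const 1)) (.reg 3))))

theorem setup_spec {n q R N Z W : ℕ} {lc rc : ℕ → ℕ} {mid X : ℕ → List ℕ} {σ : AState}
    (hS : Sizes n q R N Z W) (hG : RowSLP n lc rc mid X)
    (h0 : σ.reg 0 = n) (h1 : σ.reg 1 = q) (h2 : σ.reg 2 = Z)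
    (hzero : ∀ a, 1 ≤ a → ∀ x, σ.arr a x = 0)
    (hin : ∀ i < n,
      (σ.arr aIN (3 * i) = 0 ∧ mid (i + 1) = [σ.arr aIN (3 * i + 1)] ∧ lc (i + 1) = 0 ∧
        rc (i + 1) = 0) ∨
      (σ.arr aIN (3 * i) ≠ 0 ∧ mid (i + 1) = [] ∧ lc (i + 1) = σ.arr aIN (3 * i + 1) + 1 ∧
        rc (i + 1) = σ.arr aIN (3 * i + 2) + 1)) :
    WP W Z 27 setup (fun σ' t => t ≤ 15 * n + 6 ∧ Globals n q R N Z σ' ∧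
      (∀ i, 1 ≤ i → i ≤ n → RowData n R Z lc rc mid σ'.arr i) ∧
      (∀ a, 5 ≤ a → ∀ x, σ'.arr a x = 0)) σ := by
  have hnN := hS.n_le
  have hNZ := hS.hZ
  have hR := hS.hR
  have hW := hS.hW
  have hW' := hS.hW'
  have hq := hS.hq
  have hN := hS.hN
  simp (disch := omega) only [setup, wp_seq, wp_set, HE.ok, HE.eval, AState.set_reg,
    AState.set_arr, h0, h1, Nat.reduceEqDiff, if_false, if_true, true_and, ← hR, ← hN]
  and_intros <;> try omega
  refine (WP.forUp (fun k τ => Globals n q R N Z τ ∧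
      (∀ i, 1 ≤ i → i ≤ k → RowData n R Z lc rc mid τ.arr i) ∧
      (∀ a, 1 ≤ a → ∀ x, k * R < x → τ.arr a x = 0) ∧ (∀ a, 5 ≤ a → ∀ x, τ.arr a x = 0) ∧
      τ.arr aIN = σ.arr aIN)
    n 13 (by omega) (by norm_num) ?_ ?_ ?_).mono ?_
  · refine ⟨⟨by simp [h0], by simp [h1], by simp [h2], by simp, by simp, by simp, by simp⟩,
      fun i h1 h2 => by omega, fun a ha x _ => hzero a ha x,
      fun a ha x => hzero a (by omega) x, rfl⟩
  · rintro k τ - ⟨hg, -⟩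
    exact hg.r0
  · rintro k τ hk h9 ⟨hg, hrow, hz, hz5, hIN⟩
    have hrk := hS.row_le (i := k + 1) (by omega)
    have hrk' := row_lt (R := R) (i := k) (j := k + 1) (by omega)
    have hlc := hG.lc_lt (k + 1) (by omega) (by omega)
    have hrc := hG.rc_lt (k + 1) (by omega) (by omega)
    have hlr := hS.row_le (i := lc (k + 1)) (by omega)
    have hrr := hS.row_le (i := rc (k + 1)) (by omega)
    have hi := hin k hk
    simp (disch := omega) only [wp_seq, wp_set, wp_ld, wp_ifEq, wp_st, HE.ok, HE.eval,
      AState.set_reg, AState.set_arr, AState.put_reg, h9, hg.r3, hIN, Nat.reduceEqDiff, if_false,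
      if_true, true_and]
    -- the two kinds of assignments write into the same row of different arrays
    have fin : ∀ τ' : AState, (∀ r < 7, τ'.reg r = τ.reg r) →
        (∀ a x, x ≠ (k + 1) * R → τ'.arr a x = τ.arr a x) →
        (∀ a, 5 ≤ a → τ'.arr a = τ.arr a) → τ'.arr aIN = τ.arr aIN →
        RowData n R Z lc rc mid τ'.arr (k + 1) →
        Globals n q R N Z τ' ∧
        (∀ i, 1 ≤ i → i ≤ k + 1 → RowData n R Z lc rc mid τ'.arr i) ∧
        (∀ a, 1 ≤ a → ∀ x, (k + 1) * R < x → τ'.arr a x = 0) ∧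
        (∀ a, 5 ≤ a → ∀ x, τ'.arr a x = 0) ∧ τ'.arr aIN = σ.arr aIN := by
      intro τ' hr hx ha hin' hrd
      refine ⟨hg.congr hr, fun i hi1 hi2 => ?_, fun a ha1 x hx1 => ?_, fun a ha5 x => ?_,
        hin'.trans hIN⟩
      · rcases (show i ≤ k ∨ i = k + 1 by omega) with hi | rfl
        · refine (hrow i hi1 hi).congr (hG.mid_le i hi1 (by omega)) fun a _ _ => hx a _ ?_
          have := row_lt (R := R) (i := i) (j := k + 1) (by omega)
          omega
        · exact hrd
      · rw [hx a x (by omega)]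
        exact hz a ha1 x (by omega)
      · rw [ha a ha5]
        exact hz5 a ha5 x
    have hzk : ∀ a, 1 ≤ a → τ.arr a ((k + 1) * R) = 0 := fun a ha => hz a ha _ (by omega)
    and_intros <;> try omega
    · intro h
      obtain ⟨-, hm, hl, hr⟩ : _ ∧ _ := by
        rcases hi with hi | hi
        · exact hi
        · exact absurd h hi.1
      repeat refine And.intro (by omega) ?_
      refine fin _ ?_ ?_ ?_ ?_ ?_
      · intro r hr
        simp [show r ≠ 9 by omega, show r ≠ 10 by omega, show r ≠ 11 by omega,
          show r ≠ 12 by omega, show r ≠ 13 by omega, show r ≠ 14 by omega, show r ≠ 15 by omega]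
      · intro a x hx
        simp [AState.put_arr, hx]
      · intro a ha
        simp [AState.put_arr_ne, show a ≠ 3 by omega, show a ≠ 4 by omega]
      · simp [AState.put_arr_ne]
      · refine ⟨by simp [AState.put_arr, hzk, hl], by simp [AState.put_arr, hzk, hr],
          by simp [AState.put_arr, hm], fun j hj => ?_, by omega, by rw [hm]; simp; omega⟩
        rw [hm] at hj ⊢
        obtain rfl : j = 0 := by simpa using hj
        simp [AState.put_arr]
    · intro h
      obtain ⟨-, hm, hl, hr⟩ : _ ∧ _ := by
        rcases hi with hi | hi
        · exact absurd hi.1 h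
        · exact hi
      rw [← hl, ← hr]
      repeat refine And.intro (by omega) ?_
      refine fin _ ?_ ?_ ?_ ?_ ?_
      · intro r hr
        simp [show r ≠ 9 by omega, show r ≠ 10 by omega, show r ≠ 11 by omega,
          show r ≠ 12 by omega, show r ≠ 13 by omega, show r ≠ 14 by omega, show r ≠ 15 by omega]
      · intro a x hx
        simp [AState.put_arr, hx]
      · intro a ha
        simp [AState.put_arr_ne, show a ≠ 1 by omega, show a ≠ 2 by omega]
      · simp [AState.put_arr_ne]
      · refine ⟨by simp [AState.put_arr], by simp [AState.put_arr],
          by simp [AState.put_arr, hm, hzk], by rw [hm]; exact row_nil _ _, by omega,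
          by rw [hm]; simp; omega⟩
  · rintro σ' t ⟨ht, -, hg, hrow, -, hz5, -⟩
    exact ⟨by omega, hg, hrow, hz5⟩

/-! ### The strings around the boundaries -/

/-- The string whose `q`-grams are those `q`-grams of `Xl ++ m ++ Xr` that are contained neither
in `Xl` nor in `Xr`. -/
def window (q : ℕ) (Xl m Xr : List ℕ) : List ℕ :=
  Xl.drop (Xl.length - (q - 1)) ++ m ++ Xr.take (q - 1)

theorem length_window_le {q : ℕ} {Xl m Xr : List ℕ} (hq : 1 ≤ q) (hm : m.length ≤ 1) :
    (window q Xl m Xr).length < 2 * q := by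
  simp only [window, List.length_append, List.length_drop, List.length_take]
  omega

/-- Row `v` holds the first and the last `q - 1` letters of `X`, the last ones in reverse order. -/
structure Ends (q Z : ℕ) (A : ℕ → ℕ → ℕ) (v : ℕ) (X : List ℕ) : Prop where
  pre : Stored Z A aPX aPXL v (X.take (q - 1))
  suf : Stored Z A aSX aSXL v (X.reverse.take (q - 1))

theorem Stored.congr {Z : ℕ} {A A' : ℕ → ℕ → ℕ} {s l v b : ℕ} {M : List ℕ}
    (h : Stored Z A s l v M) (hb : M.length ≤ b) (hb0 : 0 < b)
    (hs : ∀ x, v ≤ x → x < v + b → A' s x = A s x)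
    (hl : ∀ x, v ≤ x → x < v + b → A' l x = A l x) : Stored Z A' s l v M :=
  ⟨(hl v le_rfl (by omega)).trans h.len,
    h.row.congr fun k hk => hs _ (by omega) (by omega), h.lt, h.le⟩

theorem Ends.congr {q Z v : ℕ} {A A' : ℕ → ℕ → ℕ} {X : List ℕ} (h : Ends q Z A v X) (hq : 1 ≤ q)
    (hA : ∀ a, 5 ≤ a → a ≤ 8 → ∀ x, v ≤ x → x < v + q → A' a x = A a x) : Ends q Z A' v X :=
  ⟨h.pre.congr (by simp) hq (hA _ (by norm_num) (by norm_num))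
      (hA _ (by norm_num) (by norm_num)),
    h.suf.congr (by simp) hq (hA _ (by norm_num) (by norm_num))
      (hA _ (by norm_num) (by norm_num))⟩

/-- Row `v` holds the string `U`, and the number of its `q`-grams. -/
structure WindowAt (q : ℕ) (A : ℕ → ℕ → ℕ) (v : ℕ) (U : List ℕ) : Prop where
  row : Row (A aU) v U
  len : A aWL v = U.length + 1 - q

/-- The position of row `i`, for `i` in register `10`, is put into register `11`, and those of its
factors into registers `13` and `15`. -/
def rowAt : Cmd :=
  .set 11 (.mul (.reg 10) (.reg 3)) ;; .ld 13 aLC (.reg 11) ;; .ld 15 aRC (.reg 11)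

/-- Compute the ends of the strings, and the strings around the boundaries. -/
def strings : Cmd :=
  .forUp 9 0 (
    .set 10 (.add (.reg 9) (.const 1)) ;; rowAt ;; .set 41 (.reg 4) ;;
    cat3 aPX aPX aPXL 13 false aMV aML 11 false aPX aPXL 15 false ;;
    .st aPXL (.reg 11) (.reg 50) ;;
    cat3 aSX aSX aSXL 15 false aMV aML 11 true aSX aSXL 13 false ;;
    .st aSXL (.reg 11) (.reg 50) ;; .set 41 (.reg 3) ;;
    cat3 aU aSX aSXL 13 true aMV aML 11 false aPX aPXL 15 false ;;
    .ifLt (.reg 50) (.reg 1) (.st aWL (.reg 11) (.const 0))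
      (.st aWL (.reg 11) (.sub (.add (.reg 50) (.const 1)) (.reg 1))))

theorem take_cat (A B C : List ℕ) (c : ℕ) :
    (A.take c ++ B ++ C.take c).take c = (A ++ B ++ C).take c := by
  rw [take_append_take, List.append_assoc, take_take_append, ← List.append_assoc]

/-- The effect of the computations for one row: only this row is changed. -/
theorem strings_row_spec {n q R N Z W i : ℕ} {lc rc : ℕ → ℕ} {mid X : ℕ → List ℕ} {σ : AState}
    (hS : Sizes n q R N Z W) (hG : RowSLP n lc rc mid X) (hg : Globals n q R N Z σ)
    (hi1 : 1 ≤ i) (hin : i ≤ n) (hrow : RowData n R Z lc rc mid σ.arr i)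
    (hl : Ends q Z σ.arr (lc i * R) (X (lc i))) (hr : Ends q Z σ.arr (rc i * R) (X (rc i)))
    (h10 : σ.reg 10 = i) :
    WP W Z 27 (rowAt ;; .set 41 (.reg 4) ;;
      cat3 aPX aPX aPXL 13 false aMV aML 11 false aPX aPXL 15 false ;;
      .st aPXL (.reg 11) (.reg 50) ;;
      cat3 aSX aSX aSXL 15 false aMV aML 11 true aSX aSXL 13 false ;;
      .st aSXL (.reg 11) (.reg 50) ;; .set 41 (.reg 3) ;;
      cat3 aU aSX aSXL 13 true aMV aML 11 false aPX aPXL 15 false ;;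
      .ifLt (.reg 50) (.reg 1) (.st aWL (.reg 11) (.const 0))
        (.st aWL (.reg 11) (.sub (.add (.reg 50) (.const 1)) (.reg 1)))) (fun σ' t =>
      t ≤ 36 * q + 100 ∧ (∀ r < 10, σ'.reg r = σ.reg r) ∧
      Ends q Z σ'.arr (i * R) (X i) ∧
      WindowAt q σ'.arr (i * R) (window q (X (lc i)) (mid i) (X (rc i))) ∧
      (∀ a, a < 5 ∨ 10 < a → σ'.arr a = σ.arr a) ∧
      (∀ a x, x < i * R ∨ i * R + R ≤ x → σ'.arr a x = σ.arr a x) ∧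
      ∀ x, σ'.arr aU x = σ.arr aU x ∨ σ'.arr aU x ∈ window q (X (lc i)) (mid i) (X (rc i))) σ := by
  have hNZ := hS.hZ
  have hR := hS.hR
  have hW := hS.hW
  have hW' := hS.hW'
  have hq := hS.hq
  have hri := hS.row_le hin
  have hlc := row_lt (R := R) (hG.lc_lt i hi1 hin)
  have hrc := row_lt (R := R) (hG.rc_lt i hi1 hin)
  have hml := hG.mid_le i hi1 hin
  have hXi := hG.eq i hi1 hin
  have hlen : ∀ L : List ℕ, (L.take (q - 1)).length ≤ q - 1 := fun L => by simp
  have hll := hlen (X (lc i))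
  have hrl := hlen (X (rc i))
  have hll' := hlen (X (lc i)).reverse
  have hrl' := hlen (X (rc i)).reverse
  generalize hv : i * R = v at *
  have hlcv := hrow.lc
  have hrcv := hrow.rc
  have hmid := hrow.mid
  rw [hv] at hlcv hrcv hmid
  simp (disch := omega) only [rowAt, wp_seq, wp_set, wp_ld, wp_st, HE.ok, HE.eval, AState.set_reg,
    AState.set_arr, h10, hg.r3, hg.r4, hv, hlcv, hrcv, Nat.reduceEqDiff, if_false, if_true,
    true_and]
  repeat refine And.intro (by omega) ?_
  refine WP.mono (cat3_spec (cap := q - 1) (v := v) (x₁ := lc i * R) (x₂ := v) (x₃ := rc i * R)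
    (M₁ := (X (lc i)).take (q - 1)) (M₂ := mid i) (M₃ := (X (rc i)).take (q - 1))
    (T := (X i).take (q - 1)) hW ?_ ?_ (by omega) (by norm_num) (by norm_num) (by norm_num)
    ?_ ?_ ?_ ?_ ?_ ?_ (by omega) (by norm_num) (by omega) ?_) ?_
  · simp
  · simp
  · simp
  · simp
  · simp
  · exact hl.pre
  · exact hmid
  · exact hr.pre
  · rw [hXi]; exact (take_cat _ _ _ _).symm
  rintro σ₁ t₁ ⟨ht₁, hf₁, h41₁, h50₁, hr₁, ha₁, hx₁⟩
  simp only [AState.set_arr] at ha₁ hx₁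
  have hreg₁ : σ₁.reg 11 = v ∧ σ₁.reg 13 = lc i * R ∧ σ₁.reg 15 = rc i * R ∧
      ∀ r < 10, σ₁.reg r = σ.reg r := by
    refine ⟨by simp [hf₁], by simp [hf₁], by simp [hf₁], fun r hr => ?_⟩
    simp [hf₁ r (by omega), show r ≠ 11 by omega, show r ≠ 13 by omega, show r ≠ 15 by omega,
      show r ≠ 41 by omega]
  clear hf₁
  obtain ⟨h11₁, h13₁, h15₁, hf₁⟩ := hreg₁
  simp (disch := omega) only [HE.ok, HE.eval, h11₁, h50₁, true_and]
  repeat refine And.intro (by omega) ?_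
  refine WP.mono (cat3_spec (cap := q - 1) (v := v) (x₁ := rc i * R) (x₂ := v) (x₃ := lc i * R)
    (M₁ := (X (rc i)).reverse.take (q - 1)) (M₂ := mid i) (M₃ := (X (lc i)).reverse.take (q - 1))
    (T := (X i).reverse.take (q - 1)) hW ?_ ?_ (by omega) (by norm_num) (by norm_num)
    (by norm_num) ?_ ?_ ?_ ?_ ?_ ?_ (by omega) (by norm_num) (by omega) ?_) ?_
  · simp [h11₁]
  · simp [h41₁]
  · simp [h15₁]
  · simp [h11₁]
  · simp [h13₁]
  · refine hr.suf.congr (b := q) (by omega) (by omega) ?_ ?_ <;> intro x _ _ <;>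
      simp [AState.put_arr, ha₁]
  · refine hmid.congr (b := 2) (by omega) (by omega) ?_ ?_ <;> intro x _ _ <;>
      simp [AState.put_arr, ha₁]
  · refine hl.suf.congr (b := q) (by omega) (by omega) ?_ ?_ <;> intro x _ _ <;>
      simp [AState.put_arr, ha₁]
  · rw [hXi]
    simp only [dirList, Bool.false_eq_true, if_false, if_true, List.reverse_append]
    rw [take_cat, List.append_assoc]
  rintro σ₂ t₂ ⟨ht₂, hf₂, h41₂, h50₂, hr₂, ha₂, hx₂⟩
  simp only [AState.put_reg] at hf₂
  have h11₂ : σ₂.reg 11 = v := by rw [hf₂ _ (by norm_num), h11₁]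
  have h3₂ : σ₂.reg 3 = R := by rw [hf₂ _ (by norm_num), hf₁ _ (by norm_num), hg.r3]
  have hW₁ : (dirList true ((X (lc i)).reverse.take (q - 1)) ++ dirList false (mid i) ++
      dirList false ((X (rc i)).take (q - 1))) = window q (X (lc i)) (mid i) (X (rc i)) := by
    simp only [dirList, if_true, Bool.false_eq_true, if_false, window]
    rw [List.take_reverse, List.reverse_reverse]
  have hWl := length_window_le (Xl := X (lc i)) (Xr := X (rc i)) hq hml
  simp (disch := omega) only [HE.ok, HE.eval, h11₂, h50₂, h3₂, true_and]
  repeat refine And.intro (by omega) ?_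
  refine WP.mono (cat3_spec (cap := R) (v := v) (x₁ := lc i * R) (x₂ := v) (x₃ := rc i * R)
    (M₁ := (X (lc i)).reverse.take (q - 1)) (M₂ := mid i) (M₃ := (X (rc i)).take (q - 1))
    (T := window q (X (lc i)) (mid i) (X (rc i))) hW ?_ ?_ (by omega) (by norm_num) (by norm_num)
    (by norm_num) ?_ ?_ ?_ ?_ ?_ ?_ (by norm_num) (by norm_num) (by norm_num) ?_) ?_
  · simp [h11₂]
  · simp [h3₂]
  · simp [hf₂, h13₁]
  · simp [h11₂]
  · simp [hf₂, h15₁]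
  · refine hl.suf.congr (b := q) (by omega) (by omega) ?_ ?_ <;> intro x _ _
    · simp [AState.put_arr, hx₂ x (.inl (by omega)), ha₁]
    · simp [AState.put_arr, ha₂, ha₁, show x ≠ v by omega]
  · refine hmid.congr (b := 2) (by omega) (by omega) ?_ ?_ <;> intro x _ _ <;>
      simp [AState.put_arr, ha₁, ha₂]
  · refine hr.pre.congr (b := q) (by omega) (by omega) ?_ ?_ <;> intro x _ _
    · simp [AState.put_arr, hx₁ x (.inl (by omega)), ha₂]
    · simp [AState.put_arr, ha₂, ha₁, show x ≠ v by omega]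
  · rw [hW₁, List.take_of_length_le (by omega)]
  rintro σ₃ t₃ ⟨ht₃, hf₃, h41₃, h50₃, hr₃, ha₃, hx₃⟩
  have h11₃ : σ₃.reg 11 = v := by rw [hf₃ _ (by norm_num)]; simp [h11₂]
  have hf₃' : ∀ r < 10, σ₃.reg r = σ.reg r := fun r hr => by
    rw [hf₃ _ (by omega)]
    simp [hf₂ r (by omega), hf₁ r hr, show r ≠ 41 by omega]
  -- the remaining store only affects the array of the numbers of `q`-grams
  have fin : ∀ y, y = (window q (X (lc i)) (mid i) (X (rc i))).length + 1 - q →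
      (∀ r < 10, (σ₃.put aWL v y).reg r = σ.reg r) ∧
      Ends q Z (σ₃.put aWL v y).arr v (X i) ∧
      WindowAt q (σ₃.put aWL v y).arr v (window q (X (lc i)) (mid i) (X (rc i))) ∧
      (∀ a, a < 5 ∨ 10 < a → (σ₃.put aWL v y).arr a = σ.arr a) ∧
      (∀ a x, x < v ∨ v + R ≤ x → (σ₃.put aWL v y).arr a x = σ.arr a x) ∧
      ∀ x, (σ₃.put aWL v y).arr aU x = σ.arr aU x ∨
        (σ₃.put aWL v y).arr aU x ∈ window q (X (lc i)) (mid i) (X (rc i)) := by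
    rintro y rfl
    have hXl := hlen (X i)
    have hXl' := hlen (X i).reverse
    refine ⟨hf₃', ⟨⟨?_, hr₁.congr fun k hk => ?_, by omega, by omega⟩,
      ⟨?_, hr₂.congr fun k hk => ?_, by omega, by omega⟩⟩,
      ⟨hr₃.congr fun k hk => ?_, ?_⟩, fun a ha => ?_, fun a x hx => ?_, fun x => ?_⟩
    · simp [AState.put_arr, ha₃, ha₂]
    · simp [AState.put_arr, ha₃, ha₂]
    · simp [AState.put_arr, ha₃]
    · simp [AState.put_arr, ha₃]
    · simp [AState.put_arr]
    · simp [AState.put_arr]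
    · rw [AState.put_arr_ne _ (by omega), ha₃ a (by omega), AState.set_arr,
        AState.put_arr_ne _ (by omega), ha₂ a (by omega), AState.put_arr_ne _ (by omega),
        ha₁ a (by omega)]
    · rw [AState.put_arr, if_neg (by omega)]
      have e₁ : σ₁.arr a x = σ.arr a x := by
        by_cases h : a = 5
        · subst h; exact hx₁ x (by omega)
        · rw [ha₁ a h]
      have e₂ : σ₂.arr a x = σ.arr a x := by
        by_cases h : a = 7
        · subst h
          rw [hx₂ x (by omega), AState.put_arr, if_neg (by omega), e₁]
        · rw [ha₂ a h, AState.put_arr, if_neg (by omega), e₁]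
      by_cases h : a = 9
      · subst h
        rw [hx₃ x (by omega), AState.set_arr, AState.put_arr, if_neg (by omega), e₂]
      · rw [ha₃ a h, AState.set_arr, AState.put_arr, if_neg (by omega), e₂]
    · rw [AState.put_arr_ne _ (by norm_num)]
      by_cases h : x < v ∨ v + (window q (X (lc i)) (mid i) (X (rc i))).length ≤ x
      · left
        rw [hx₃ x h]
        simp [AState.put_arr, ha₂, ha₁]
      · right
        obtain ⟨k, rfl⟩ : ∃ k, x = v + k := ⟨x - v, by omega⟩
        exact hr₃.mem (by omega)
  simp (disch := omega) only [wp_ifLt, wp_st, HE.ok, HE.eval, h50₃, h11₃, hf₃', hg.r1, true_and]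
  refine ⟨fun h => ?_, fun h => ?_⟩
  · repeat refine And.intro (by omega) ?_
    exact fin 0 (by omega)
  · repeat refine And.intro (by omega) ?_
    exact fin _ rfl

/-- Besides the windows, the array `aU` contains zeros. The predicate `good` is instantiated with
the bounds on the letters. -/
theorem strings_spec {n q R N Z W : ℕ} {lc rc : ℕ → ℕ} {mid X : ℕ → List ℕ} {σ : AState}
    {good : ℕ → Prop} (hS : Sizes n q R N Z W) (hG : RowSLP n lc rc mid X)
    (hg : Globals n q R N Z σ) (hrow : ∀ i, 1 ≤ i → i ≤ n → RowData n R Z lc rc mid σ.arr i)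
    (hzero : ∀ a, 5 ≤ a → ∀ x, σ.arr a x = 0) (hgood0 : good 0)
    (hgood : ∀ i, 1 ≤ i → i ≤ n → ∀ a ∈ X i, good a) :
    WP W Z 27 strings (fun σ' t => t ≤ n * (36 * q + 103) + 2 ∧ Globals n q R N Z σ' ∧
      (∀ i, 1 ≤ i → i ≤ n → RowData n R Z lc rc mid σ'.arr i) ∧
      (∀ i, 1 ≤ i → i ≤ n →
        WindowAt q σ'.arr (i * R) (window q (X (lc i)) (mid i) (X (rc i)))) ∧
      (∀ x, good (σ'.arr aU x)) ∧ (∀ a, 11 ≤ a → ∀ x, σ'.arr a x = 0)) σ := by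
  have hnN := hS.n_le
  have hNZ := hS.hZ
  have hR := hS.hR
  have hW := hS.hW
  have hq := hS.hq
  refine (WP.forUp (fun k τ => Globals n q R N Z τ ∧ (∀ a, a < 5 ∨ 10 < a → τ.arr a = σ.arr a) ∧
      (∀ i ≤ k, Ends q Z τ.arr (i * R) (X i)) ∧
      (∀ i, 1 ≤ i → i ≤ k →
        WindowAt q τ.arr (i * R) (window q (X (lc i)) (mid i) (X (rc i)))) ∧
      (∀ x, good (τ.arr aU x)))
    n (36 * q + 101) (by omega) (by norm_num) ?_ ?_ ?_).mono ?_
  · refine ⟨hg.congr fun r hr => by simp [show r ≠ 9 by omega], fun _ _ => rfl, fun i hi => ?_,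
      fun i h1 h2 => by omega, fun x => ?_⟩
    · obtain rfl : i = 0 := by omega
      rw [hG.zero]
      exact ⟨⟨by simp [hzero], by simpa using row_nil _ _, by omega, by simp⟩,
        ⟨by simp [hzero], by simpa using row_nil _ _, by omega, by simp⟩⟩
    · simpa [hzero] using hgood0
  · rintro k τ - ⟨hg, -⟩
    exact hg.r0
  · rintro k τ hk h9 ⟨hgτ, ha, hE, hU, hgd⟩
    have hlc := hG.lc_lt (k + 1) (by omega) (by omega)
    have hrc := hG.rc_lt (k + 1) (by omega) (by omega)
    have hml := hG.mid_le (k + 1) (by omega) (by omega)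
    rw [wp_seq, wp_set]
    simp only [HE.ok, HE.eval, h9, true_and]
    refine ⟨by norm_num, by omega, ?_⟩
    refine WP.mono (strings_row_spec (i := k + 1) hS hG (hgτ.congr ?_) (by omega) (by omega)
      ?_ ?_ ?_
      ?_) ?_
    · intro r hr; simp [show r ≠ 10 by omega]
    · refine (hrow (k + 1) (by omega) (by omega)).congr hml fun a _ h4 => ?_
      simp [ha a (by omega)]
    · exact hE _ (by omega)
    · exact hE _ (by omega)
    · simp
    rintro σ₁ t₁ ⟨ht₁, hf₁, hE₁, hU₁, ha₁, hx₁, hgd₁⟩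
    simp only [AState.set_arr] at ha₁ hx₁ hgd₁
    refine ⟨by omega, ?_, ?_, ?_, ?_, ?_, ?_⟩
    · rw [hf₁ _ (by norm_num)]; simp [h9]
    · exact hgτ.congr fun r hr => by
        simp [show r ≠ 9 by omega, hf₁ r (by omega), show r ≠ 10 by omega]
    · intro a h
      rw [AState.set_arr, ha₁ a h, ha a h]
    · intro i hi
      rcases (show i ≤ k ∨ i = k + 1 by omega) with h | rfl
      · have hlt := row_lt (R := R) (show i < k + 1 by omega)
        exact (hE i h).congr hq fun a _ _ x _ hx => hx₁ a x (.inl (by omega))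
      · exact hE₁
    · intro i h1 hi
      rcases (show i ≤ k ∨ i = k + 1 by omega) with h | rfl
      · have hlt := row_lt (R := R) (show i < k + 1 by omega)
        have hwl := length_window_le (Xl := X (lc i)) (m := mid i) (Xr := X (rc i)) hq
          (hG.mid_le i h1 (by omega))
        refine ⟨(hU i h1 h).row.congr fun j hj => hx₁ _ _ (.inl ?_), ?_⟩
        · omega
        · rw [AState.set_arr, hx₁ _ _ (.inl (by omega)), (hU i h1 h).len]
      · exact hU₁
    · intro x
      rcases hgd₁ x with h | h
      · rw [AState.set_arr, h]; exact hgd x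
      · refine hgood (k + 1) (by omega) (by omega) _ ?_
        rw [hG.eq (k + 1) (by omega) (by omega)]
        simp only [AState.set_arr]
        simp only [window, List.mem_append] at h ⊢
        rcases h with (h | h) | h
        · exact .inl (.inl (List.mem_of_mem_drop h))
        · exact .inl (.inr h)
        · exact .inr (List.mem_of_mem_take h)
  · rintro σ' t ⟨ht, -, hg', ha, -, hU, hgd⟩
    refine ⟨ht, hg', fun i h1 h2 => ?_, hU, hgd, fun a h x => ?_⟩
    · exact (hrow i h1 h2).congr (hG.mid_le i h1 h2) fun a _ h4 => by rw [ha a (by omega)]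
    · rw [ha a (by omega)]; exact hzero a (by omega) x

/-! ### Naming the `q`-grams -/

/-- The linked list that starts at `h`, with links `nx`, runs through `l`. Links are shifted by
one, so that `0` ends the list. -/
def Chain (nx : ℕ → ℕ) : ℕ → List ℕ → Prop
  | h, [] => h = 0
  | h, e :: l => h = e + 1 ∧ Chain nx (nx e) l

theorem Chain.congr {nx nx' : ℕ → ℕ} {h : ℕ} {l : List ℕ} (hc : Chain nx h l)
    (hn : ∀ e ∈ l, nx' e = nx e) : Chain nx' h l := by
  induction l generalizing h with
  | nil => exact hc
  | cons e l ih =>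
    refine ⟨hc.1, ?_⟩
    rw [hn e (by simp)]
    exact ih hc.2 fun e he => hn e (by simp [he])

/-- The positions below `k` with digit `d`, in decreasing order. -/
def bucket (dig : ℕ → ℕ) (k d : ℕ) : List ℕ := ((List.range k).filter fun e => dig e = d).reverse

theorem bucket_succ (dig : ℕ → ℕ) (k d : ℕ) :
    bucket dig (k + 1) d = if dig k = d then k :: bucket dig k d else bucket dig k d := by
  unfold bucket
  rw [List.range_succ, List.filter_append]
  split_ifs with h <;> simp [h]

theorem mem_bucket {dig : ℕ → ℕ} {k d e : ℕ} : e ∈ bucket dig k d ↔ e < k ∧ dig e = d := by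
  simp [bucket]

theorem nodup_bucket (dig : ℕ → ℕ) (k d : ℕ) : (bucket dig k d).Nodup :=
  List.nodup_reverse.2 (List.nodup_range.filter _)

theorem sum_length_bucket {dig : ℕ → ℕ} {k b : ℕ} (h : ∀ e < k, dig e < b) :
    ∑ d ∈ Finset.range b, (bucket dig k d).length = k := by
  induction k with
  | zero => simp [bucket]
  | succ k ih =>
    have : ∀ d ∈ Finset.range b, (bucket dig (k + 1) d).length =
        (bucket dig k d).length + if dig k = d then 1 else 0 := by
      intro d _
      rw [bucket_succ]
      split_ifs <;> simp
    rw [Finset.sum_congr rfl this, Finset.sum_add_distrib, ih fun e he => h e (by omega),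
      Finset.sum_ite_eq, if_pos (by simpa using h k (by omega))]

/-- The state of a refinement pass: the elements of `D` have got their new names, according to the
old name `nm0` and the digit, and the current digit is `d`. `stp c = d + 1` tells that the new name
for the old name `c` and the digit `d` is `nw c`. -/
structure Refining (N : ℕ) (nm0 dig : ℕ → ℕ) (d : ℕ) (D : ℕ → Prop) (nm stp nw : ℕ → ℕ) : Prop where
  key : ∀ e < N, D e → nm e < N ∧ nm0 (nm e) = nm0 e ∧ dig (nm e) = dig e
  eq : ∀ e < N, ∀ f < N, D e → D f → nm0 e = nm0 f → dig e = dig f → nm e = nm f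
  old : ∀ e < N, ¬ D e → nm e = nm0 e
  stp_le : ∀ c < N, stp c ≤ d + 1
  nw_key : ∀ c < N, stp c = d + 1 → nw c < N ∧ dig (nw c) = d ∧ nm0 (nw c) = c
  nw_eq : ∀ e < N, D e → dig e = d → stp (nm0 e) = d + 1 ∧ nw (nm0 e) = nm e

/-- When all elements with digit `d` have been treated, the pass goes on with digit `d + 1`. No
stamp is valid for the next digit, so the stamps need not be cleared. -/
theorem Refining.next {N d : ℕ} {nm0 dig : ℕ → ℕ} {D D' : ℕ → Prop} {nm stp nw : ℕ → ℕ}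
    (h : Refining N nm0 dig d D nm stp nw) (hD : ∀ e < N, D e ↔ dig e < d + 1)
    (hD' : ∀ e < N, D' e ↔ dig e < d + 1) : Refining N nm0 dig (d + 1) D' nm stp nw where
  key e he hd := h.key e he ((hD e he).2 ((hD' e he).1 hd))
  eq e he f hf h1 h2 :=
    h.eq e he f hf ((hD e he).2 ((hD' e he).1 h1)) ((hD f hf).2 ((hD' f hf).1 h2))
  old e he hd := h.old e he fun h1 => hd ((hD' e he).2 ((hD e he).1 h1))
  stp_le c hc := (h.stp_le c hc).trans (by omega)
  nw_key c hc h1 := by have := h.stp_le c hc; omega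
  nw_eq e he h1 h2 := by have := (hD' e he).1 h1; omega

/-- The next element `e` gets the name `x`, where `stp'` and `nw'` are the updated stamps and new
names: `e` itself is the new name if it is the first element with its old name and digit. -/
theorem Refining.step {N d e x : ℕ} {nm0 dig : ℕ → ℕ} {D D' : ℕ → Prop}
    {nm stp nw stp' nw' nm' : ℕ → ℕ}
    (h : Refining N nm0 dig d D nm stp nw) (hnm0 : ∀ e < N, nm0 e < N) (he : e < N) (hDe : ¬ D e)
    (hde : dig e = d) (hD' : ∀ f < N, D' f ↔ D f ∨ f = e)
    (hstp : stp' = if stp (nm0 e) = d + 1 then stp else Function.update stp (nm0 e) (d + 1))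
    (hnw : nw' = if stp (nm0 e) = d + 1 then nw else Function.update nw (nm0 e) e)
    (hx : x = nw' (nm0 e)) (hnm : nm' = Function.update nm e x) :
    Refining N nm0 dig d D' nm' stp' nw' := by
  have hc := hnm0 e he
  have hs : stp' (nm0 e) = d + 1 := by subst hstp; split_ifs with h1 <;> simp [h1]
  have hxk : x < N ∧ dig x = d ∧ nm0 x = nm0 e := by
    subst hx hnw
    split_ifs with h1
    · exact h.nw_key _ hc h1
    · simpa using ⟨he, hde⟩
  have hkeep : ∀ c < N, stp c = d + 1 → stp' c = d + 1 ∧ nw' c = nw c := by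
    intro c _ h1
    subst hstp hnw
    split_ifs with h2
    · exact ⟨h1, rfl⟩
    · have hne : c ≠ nm0 e := fun h3 => h2 (h3 ▸ h1)
      simp [hne, h1]
  have hne : ∀ f < N, D f → f ≠ e := fun f _ h1 h2 => hDe (h2 ▸ h1)
  have hold : ∀ f < N, D f → nm' f = nm f := fun f hf h1 => by
    rw [hnm, Function.update_of_ne (hne f hf h1)]
  have hnew : nm' e = x := by rw [hnm]; simp
  have hpair : ∀ f < N, D f → nm0 f = nm0 e → dig f = d → nm f = x := by
    intro f hf h1 h2 h3
    have h4 := h.nw_eq f hf h1 h3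
    rw [hx, ← h2, (hkeep _ (hnm0 f hf) h4.1).2, h4.2]
  refine ⟨fun f hf hd => ?_, fun f hf g hg hdf hdg h1 h2 => ?_, fun f hf hd => ?_,
    fun c hc' => ?_, fun c hc' h1 => ?_, fun f hf hd h1 => ?_⟩
  · rcases (hD' f hf).1 hd with h1 | rfl
    · rw [hold f hf h1]; exact h.key f hf h1
    · rw [hnew]; exact ⟨hxk.1, hxk.2.2, hxk.2.1.trans hde.symm⟩
  · rcases (hD' f hf).1 hdf with h3 | rfl <;> rcases (hD' g hg).1 hdg with h4 | rfl
    · rw [hold f hf h3, hold g hg h4]; exact h.eq f hf g hg h3 h4 h1 h2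
    · rw [hold f hf h3, hnew]; exact hpair f hf h3 h1 (h2.trans hde)
    · rw [hold g hg h4, hnew]; exact (hpair g hg h4 h1.symm (h2.symm.trans hde)).symm
    · rfl
  · have h1 : ¬ D f ∧ f ≠ e := by
      constructor
      · exact fun h1 => hd ((hD' f hf).2 (.inl h1))
      · exact fun h1 => hd ((hD' f hf).2 (.inr h1))
    rw [hnm, Function.update_of_ne h1.2]
    exact h.old f hf h1.1
  · have := h.stp_le c hc'
    subst hstp
    split_ifs
    · exact this
    · rw [Function.update_apply]; split_ifs <;> omega
  · by_cases h2 : c = nm0 e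
    · rw [h2, ← hx]; exact hxk
    · have h3 : stp' c = stp c ∧ nw' c = nw c := by
        subst hstp hnw
        split_ifs <;> simp [h2]
      rw [h3.2]; exact h.nw_key c hc' (h3.1 ▸ h1)
  · rcases (hD' f hf).1 hd with h2 | rfl
    · obtain ⟨h3, h4⟩ := h.nw_eq f hf h2 h1
      obtain ⟨h5, h6⟩ := hkeep _ (hnm0 f hf) h3
      exact ⟨h5, by rw [h6, h4, hold f hf h2]⟩
    · exact ⟨hs, by rw [hnew, hx]⟩

/-- Put the positions below `N` into linked lists according to the current digit of the letter at
distance `j`, see `refine`. -/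
def distribute : Cmd :=
  .forUp 13 5 (.st aSTP (.reg 13) (.const 0)) ;;
  .forUp 13 6 (.st aHD (.reg 13) (.const 0)) ;;
  .forUp 13 5 (
    .ld 14 aU (.add (.reg 13) (.reg 10)) ;; .set 15 (.mod (.div (.reg 14) (.reg 12)) (.reg 6)) ;;
    .ld 16 aHD (.reg 15) ;; .st aNX (.reg 13) (.reg 16) ;;
    .st aHD (.reg 15) (.add (.reg 13) (.const 1)))

/-- The buckets are cleared and filled in `O(N + n + q)` steps. -/
theorem distribute_spec {n q R N Z W j pw : ℕ} {σ : AState} {dig : ℕ → ℕ}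
    (hS : Sizes n q R N Z W) (hg : Globals n q R N Z σ) (hj : j < q) (h10 : σ.reg 10 = j)
    (h12 : σ.reg 12 = pw) (hdig : ∀ e, dig e = σ.arr aU (e + j) / pw % (n + q)) :
    WP W Z 27 distribute (fun σ' t => t ≤ 3 * N + 3 * (n + q) + 7 * N + 6 ∧
      (∀ r < 13, σ'.reg r = σ.reg r) ∧
      (∀ a, a ≠ aHD → a ≠ aNX → a ≠ aSTP → σ'.arr a = σ.arr a) ∧
      (∀ e < N, σ'.arr aSTP e = 0) ∧
      ∀ d < n + q, Chain (σ'.arr aNX) (σ'.arr aHD d) (bucket dig N d)) σ := by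
  have hnN := hS.n_le
  have hNZ := hS.hZ
  have hR := hS.hR
  have hW := hS.hW
  have hW' := hS.hW'
  have hq := hS.hq
  have hn := hS.hn
  rw [distribute, wp_seq]
  refine (WP.forUp (fun k τ => (∀ r < 13, τ.reg r = σ.reg r) ∧
      (∀ a, a ≠ aHD → a ≠ aNX → a ≠ aSTP → τ.arr a = σ.arr a) ∧
      ∀ e < k, τ.arr aSTP e = 0)
    N 1 (by omega) (by norm_num) ?_ ?_ ?_).mono ?_
  · exact ⟨fun r hr => by simp [show r ≠ 13 by omega], fun _ _ _ _ => rfl, by omega⟩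
  · rintro k τ - ⟨hf, -⟩
    rw [hf _ (by norm_num), hg.r5]
  · rintro k τ hk h13 ⟨hf, ha, hst⟩
    rw [wp_st]
    simp only [HE.ok, HE.eval, h13, true_and, AState.put_reg, AState.set_arr, AState.set_reg]
    repeat refine And.intro (by omega) ?_
    refine ⟨fun r hr => by simp [show r ≠ 13 by omega, hf r hr], fun a h1 h2 h3 => ?_,
      fun e he => ?_⟩
    · rw [AState.put_arr_ne _ h3, ha a h1 h2 h3]
    · rw [AState.put_arr_same]
      split_ifs with h
      · rfl
      · exact hst e (by omega)
  rintro σ₁ t₁ ⟨ht₁, -, hf₁, ha₁, hst₁⟩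
  rw [wp_seq]
  refine (WP.forUp (fun k τ => (∀ r < 13, τ.reg r = σ.reg r) ∧
      (∀ a, a ≠ aHD → τ.arr a = σ₁.arr a) ∧ ∀ d < k, τ.arr aHD d = 0)
    (n + q) 1 (by omega) (by norm_num) ?_ ?_ ?_).mono ?_
  · exact ⟨fun r hr => by simp [show r ≠ 13 by omega, hf₁ r hr], fun _ _ => rfl, by omega⟩
  · rintro k τ - ⟨hf, -⟩
    rw [hf _ (by norm_num), hg.r6]
  · rintro k τ hk h13 ⟨hf, ha, hst⟩
    rw [wp_st]
    simp only [HE.ok, HE.eval, h13, true_and, AState.put_reg, AState.set_arr, AState.set_reg]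
    repeat refine And.intro (by omega) ?_
    refine ⟨fun r hr => by simp [show r ≠ 13 by omega, hf r hr], fun a h1 => ?_,
      fun e he => ?_⟩
    · rw [AState.put_arr_ne _ h1, ha a h1]
    · rw [AState.put_arr_same]
      split_ifs with h
      · rfl
      · exact hst e (by omega)
  rintro σ₂ t₂ ⟨ht₂, -, hf₂, ha₂, hhd₂⟩
  have hdlt : ∀ e, dig e < n + q := fun e => by rw [hdig]; exact Nat.mod_lt _ (by omega)
  refine (WP.forUp (fun k τ => (∀ r < 13, τ.reg r = σ.reg r) ∧
      (∀ a, a ≠ aHD → a ≠ aNX → τ.arr a = σ₁.arr a) ∧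
      ∀ d < n + q, Chain (τ.arr aNX) (τ.arr aHD d) (bucket dig k d))
    N 5 (by omega) (by norm_num) ?_ ?_ ?_).mono ?_
  · refine ⟨fun r hr => by simp [show r ≠ 13 by omega, hf₂ r hr], fun a h _ => ha₂ a h,
      fun d hd => ?_⟩
    simp [bucket, Chain, hhd₂ d hd]
  · rintro k τ - ⟨hf, -⟩
    rw [hf _ (by norm_num), hg.r5]
  · rintro k τ hk h13 ⟨hf, ha, hch⟩
    have hU : τ.arr aU = σ.arr aU := by
      rw [ha _ (by norm_num) (by norm_num), ha₁ _ (by norm_num) (by norm_num) (by norm_num)]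
    have hd := hdlt k
    simp (disch := omega) only [wp_seq, wp_ld, wp_set, wp_st, HE.ok, HE.eval, AState.set_reg,
      AState.set_arr, AState.put_reg, hf, h10, h12, h13, hU, hg.r6, ← hdig, Nat.reduceEqDiff,
      if_false, if_true, true_and]
    repeat refine And.intro (by omega) ?_
    refine ⟨fun r hr => ?_, fun a h1 h2 => ?_, fun d hd' => ?_⟩
    · simp [show r ≠ 13 by omega, show r ≠ 14 by omega, show r ≠ 15 by omega,
        show r ≠ 16 by omega, hf r hr]
    · rw [AState.put_arr_ne _ h1, AState.put_arr_ne _ h2]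
      simp [ha a h1 h2]
    · have hc := (hch d hd').congr (nx' := (((((τ.set 14 (σ.arr 9 (k + j))).set 15 (dig k)).set 16
          (τ.arr 12 (dig k))).put 13 k (τ.arr 12 (dig k))).put 12 (dig k) (k + 1)).arr aNX)
        fun e he => by
          have := (mem_bucket.1 he).1
          simp [AState.put_arr, show e ≠ k by omega]
      rw [bucket_succ]
      split_ifs with h
      · subst h
        refine ⟨by simp [AState.put_arr], ?_⟩
        have : (((((τ.set 14 (σ.arr 9 (k + j))).set 15 (dig k)).set 16
          (τ.arr 12 (dig k))).put 13 k (τ.arr 12 (dig k))).put 12 (dig k) (k + 1)).arr aNX k =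
            τ.arr aHD (dig k) := by simp [AState.put_arr]
        rw [this]
        exact hc
      · have : (((((τ.set 14 (σ.arr 9 (k + j))).set 15 (dig k)).set 16
          (τ.arr 12 (dig k))).put 13 k (τ.arr 12 (dig k))).put 12 (dig k) (k + 1)).arr aHD d =
            τ.arr aHD d := by simp [AState.put_arr, Ne.symm h]
        rw [this]
        exact hc
  · rintro σ₃ t₃ ⟨ht₃, -, hf₃, ha₃, hch⟩
    refine ⟨by omega, hf₃, fun a h1 h2 h3 => ?_, fun e he => ?_, hch⟩
    · rw [ha₃ a h1 h2, ha₁ a h1 h2 h3]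
    · rw [ha₃ _ (by norm_num) (by norm_num)]; exact hst₁ e he

/-- Give new names to the positions in the list that starts in register `14`, whose digit is in
register `13`. -/
def rename : Cmd :=
  .whileLt (.const 0) (.reg 14) (
    .set 15 (.sub (.reg 14) (.const 1)) ;; .ld 16 aNM (.reg 15) ;; .ld 17 aSTP (.reg 16) ;;
    .ifEq (.reg 17) (.add (.reg 13) (.const 1)) .skip
      (.st aSTP (.reg 16) (.add (.reg 13) (.const 1)) ;; .st aNW (.reg 16) (.reg 15)) ;;
    .ld 18 aNW (.reg 16) ;; .st aNM (.reg 15) (.reg 18) ;; .ld 14 aNX (.reg 15))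

/-- A refinement pass: positions keep the same name if they had the same name before, and if the
letters at distance `j` from them have the same digit in base `b`. Here `j` is in register `10`, `b`
in register `6`, and the power of `b` that belongs to the digit in register `12`. -/
def refine : Cmd :=
  distribute ;; .forUp 13 6 (.ld 14 aHD (.reg 13) ;; rename)

/-- The list `l` holds the elements with digit `d` that are still without new name. -/
theorem rename_spec {N Z W d : ℕ} {nm0 dig : ℕ → ℕ} (hNZ : N < Z) (hZW : Z < W) (hdW : d + 1 < W)
    (hnm0 : ∀ e < N, nm0 e < N) (l : List ℕ) : ∀ (σ : AState) (D : ℕ → Prop), l.Nodup →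
    (∀ e ∈ l, e < N ∧ dig e = d) → Chain (σ.arr aNX) (σ.reg 14) l → σ.reg 13 = d →
    (∀ e < N, D e ↔ dig e < d + 1 ∧ e ∉ l) →
    Refining N nm0 dig d D (σ.arr aNM) (σ.arr aSTP) (σ.arr aNW) →
    WP W Z 27 rename (fun σ' t => t ≤ 10 * l.length + 1 ∧ (∀ r < 14, σ'.reg r = σ.reg r) ∧
      (∀ a, a ≠ aNM → a ≠ aSTP → a ≠ aNW → σ'.arr a = σ.arr a) ∧
      Refining N nm0 dig (d + 1) (fun e => dig e < d + 1) (σ'.arr aNM) (σ'.arr aSTP)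
        (σ'.arr aNW)) σ := by
  induction l with
  | nil =>
    intro σ D _ _ hc h13 hD hR
    refine wp_whileLt (by simp only [HE.ok]; omega) trivial (fun h => ?_) fun _ => ?_
    · have : σ.reg 14 = 0 := hc
      simp [this] at h
    · exact ⟨by simp, fun _ _ => rfl, fun _ _ _ _ => rfl,
        hR.next (fun e he => by simpa using hD e he) fun _ _ => Iff.rfl⟩
  | cons e l ih =>
    intro σ D hnd hl hc h13 hD hR
    obtain ⟨he, hde⟩ := hl e (by simp)
    have hDe : ¬ D e := fun h => ((hD e he).1 h).2 (by simp)
    have hnd' := List.nodup_cons.1 hnd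
    have h14 : σ.reg 14 = e + 1 := hc.1
    have hold := hR.old e he hDe
    have hc0 := hnm0 e he
    refine wp_whileLt (by simp only [HE.ok]; omega) trivial (fun _ => ?_)
      fun h => absurd (by simp [h14]) h
    -- whatever happens to the stamps, the rest of the list is treated by the induction hypothesis
    have hrest : ∀ (x : ℕ) (τ : AState) (s : ℕ), (∀ r < 14, τ.reg r = σ.reg r) →
        (∀ a, a ≠ aNM → a ≠ aSTP → a ≠ aNW → τ.arr a = σ.arr a) →
        τ.reg 14 = σ.arr aNX e → s ≤ 9 →
        τ.arr aSTP = (if σ.arr aSTP (nm0 e) = d + 1 then σ.arr aSTP else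
          Function.update (σ.arr aSTP) (nm0 e) (d + 1)) →
        τ.arr aNW = (if σ.arr aSTP (nm0 e) = d + 1 then σ.arr aNW else
          Function.update (σ.arr aNW) (nm0 e) e) → x = τ.arr aNW (nm0 e) →
        τ.arr aNM = Function.update (σ.arr aNM) e x →
        WP W Z 27 rename (fun σ' t => 1 + s + t ≤ 10 * (e :: l).length + 1 ∧
          (∀ r < 14, σ'.reg r = σ.reg r) ∧
          (∀ a, a ≠ aNM → a ≠ aSTP → a ≠ aNW → σ'.arr a = σ.arr a) ∧
          Refining N nm0 dig (d + 1) (fun e => dig e < d + 1) (σ'.arr aNM) (σ'.arr aSTP)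
            (σ'.arr aNW)) τ := by
      intro x τ s hr ha h14' hs h1 h2 h3 h4
      have hD' : ∀ f < N, (dig f < d + 1 ∧ f ∉ l) ↔ D f ∨ f = e := by
        intro f hf
        rw [hD f hf, List.mem_cons]
        by_cases hfe : f = e
        · subst hfe; simp [hde, hnd'.1]
        · simp [hfe]
      refine (ih τ (fun f => dig f < d + 1 ∧ f ∉ l) hnd'.2 (fun f hf => hl f (by simp [hf])) ?_
        (by rw [hr _ (by norm_num), h13]) (fun _ _ => Iff.rfl)
        (hR.step hnm0 he hDe hde hD' h1 h2 h3 h4)).mono ?_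
      · rw [ha _ (by norm_num) (by norm_num) (by norm_num), h14']
        exact hc.2
      · rintro σ' t ⟨ht, hr', ha', hR'⟩
        refine ⟨by simp only [List.length_cons]; omega, fun r h => (hr' r h).trans (hr r h),
          fun a h1 h2 h3 => (ha' a h1 h2 h3).trans (ha a h1 h2 h3), hR'⟩
    simp (disch := omega) only [wp_seq, wp_set, wp_ld, wp_st, wp_ifEq, wp_skip, HE.ok, HE.eval,
      AState.set_reg, AState.set_arr, AState.put_reg, h13, h14, hold, Nat.add_sub_cancel,
      Nat.reduceEqDiff, if_false, if_true, true_and]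
    and_intros <;> try omega
    · intro hst
      have hw := (hR.nw_key _ hc0 hst).1
      repeat refine And.intro (by omega) ?_
      refine hrest (σ.arr aNW (nm0 e)) _ _ (fun r hr => ?_) (fun a h1 h2 h3 => ?_) ?_ (by norm_num)
        ?_ ?_ ?_ ?_
      · simp [show r ≠ 14 by omega, show r ≠ 15 by omega, show r ≠ 16 by omega,
          show r ≠ 17 by omega, show r ≠ 18 by omega]
      · simp [AState.put_arr_ne _ h1]
      · simp [AState.put_arr_ne]
      · simp [AState.put_arr_ne, hst]
      · simp [AState.put_arr_ne, hst]
      · simp [AState.put_arr_ne]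
      · simp [AState.put]
    · intro hst
      repeat refine And.intro (by omega) ?_
      simp only [AState.put_arr_same, if_true]
      refine hrest e _ _ (fun r hr => ?_) (fun a h1 h2 h3 => ?_) ?_ (by norm_num) ?_ ?_ ?_ ?_
      · simp [show r ≠ 14 by omega, show r ≠ 15 by omega, show r ≠ 16 by omega,
          show r ≠ 17 by omega, show r ≠ 18 by omega]
      · simp [AState.put_arr_ne _ h1, AState.put_arr_ne _ h2, AState.put_arr_ne _ h3]
      · simp [AState.put_arr_ne]
      · simp [hst, AState.put]
      · simp [hst, AState.put]
      · simp [AState.put]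
      · simp [AState.put]

/-- The total length of the buckets is `N`, so a pass takes linear time. -/
theorem refine_spec {n q R N Z W j pw : ℕ} {σ : AState} {dig nm0 : ℕ → ℕ}
    (hS : Sizes n q R N Z W) (hg : Globals n q R N Z σ) (hj : j < q) (h10 : σ.reg 10 = j)
    (h12 : σ.reg 12 = pw) (hdig : ∀ e, dig e = σ.arr aU (e + j) / pw % (n + q))
    (hnm0 : ∀ e < N, nm0 e < N) (hnm : σ.arr aNM = nm0) :
    WP W Z 27 refine (fun σ' t => t ≤ 20 * N + 7 * (n + q) + 8 ∧
      (∀ r < 13, σ'.reg r = σ.reg r) ∧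
      (∀ a, a < aNM ∨ aNW < a → σ'.arr a = σ.arr a) ∧
      (∀ e < N, σ'.arr aNM e < N ∧ nm0 (σ'.arr aNM e) = nm0 e ∧ dig (σ'.arr aNM e) = dig e) ∧
      ∀ e < N, ∀ f < N, nm0 e = nm0 f → dig e = dig f → σ'.arr aNM e = σ'.arr aNM f) σ := by
  have hnN := hS.n_le
  have hNZ := hS.hZ
  have hR := hS.hR
  have hW := hS.hW
  have hW' := hS.hW'
  have hq := hS.hq
  have hn := hS.hn
  have hdlt : ∀ e, dig e < n + q := fun e => by rw [hdig]; exact Nat.mod_lt _ (by omega)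
  rw [refine, wp_seq]
  refine (distribute_spec hS hg hj h10 h12 hdig).mono ?_
  rintro σ₁ t₁ ⟨ht₁, hf₁, ha₁, hst₁, hch⟩
  refine (WP.forUp_sum (fun d τ => (∀ r < 13, τ.reg r = σ.reg r) ∧
      (∀ a, a ≠ aNM → a ≠ aSTP → a ≠ aNW → τ.arr a = σ₁.arr a) ∧
      Refining N nm0 dig d (fun e => dig e < d) (τ.arr aNM) (τ.arr aSTP) (τ.arr aNW))
    (n + q) (fun d => 10 * (bucket dig N d).length + 2) (by omega) (by norm_num) ?_ ?_ ?_).mono ?_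
  · refine ⟨fun r hr => by simp [show r ≠ 13 by omega, hf₁ r hr], fun a _ _ _ => rfl, ?_⟩
    have hnm1 : σ₁.arr aNM = nm0 := by rw [ha₁ _ (by norm_num) (by norm_num) (by norm_num), hnm]
    refine ⟨by simp, by simp, fun e _ _ => ?_, fun c hc => ?_, fun c hc h => ?_, by simp⟩
    · simp [hnm1]
    · simp [hst₁ c hc]
    · simp [hst₁ c hc] at h
  · rintro d τ - ⟨hf, -⟩
    rw [hf _ (by norm_num), hg.r6]
  · rintro d τ hd h13 ⟨hf, ha, hR⟩
    have hHD : τ.arr aHD = σ₁.arr aHD := ha _ (by norm_num) (by norm_num) (by norm_num)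
    have hNX : τ.arr aNX = σ₁.arr aNX := ha _ (by norm_num) (by norm_num) (by norm_num)
    simp (disch := omega) only [wp_seq, wp_ld, HE.ok, HE.eval, h13, hHD, true_and]
    repeat refine And.intro (by omega) ?_
    refine WP.mono (rename_spec (N := N) (d := d) (nm0 := nm0) (dig := dig) (by omega) hW (by omega)
      hnm0 (bucket dig N d) _ (fun e => dig e < d) (nodup_bucket dig N d)
        (fun e he => mem_bucket.1 he)
      ?_ ?_ ?_ ?_) ?_
    · simp [hNX, hch d hd]
    · simp [h13]
    · intro e he
      simp only [mem_bucket]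
      omega
    · exact hR
    · rintro σ' t ⟨ht, hr', ha', hR'⟩
      refine ⟨by omega, by rw [hr' _ (by norm_num)]; simp [h13], fun r hr => ?_,
        fun a h1 h2 h3 => ?_, hR'⟩
      · simp [show r ≠ 13 by omega, hr' r (by omega), show r ≠ 14 by omega, hf r hr]
      · rw [AState.set_arr, ha' a h1 h2 h3]
        exact ha a h1 h2 h3
  · rintro σ₂ t₂ ⟨ht₂, -, hf₂, ha₂, hR₂⟩
    have hsum : (∑ k ∈ Finset.range (n + q), (10 * (bucket dig N k).length + 2 + 2)) =
        10 * N + 4 * (n + q) := by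
      simp only [Finset.sum_add_distrib, ← Finset.mul_sum,
        sum_length_bucket fun e _ => hdlt e]
      simp
      ring
    rw [hsum] at ht₂
    refine ⟨by omega, hf₂, fun a h => ?_, fun e he => hR₂.key e he (hdlt e),
      fun e he f hf => hR₂.eq e he f hf (hdlt e) (hdlt f)⟩
    rw [ha₂ _ (by omega) (by omega) (by omega), ha₁ _ (by omega) (by omega) (by omega)]

/-- `nm` chooses a representative of each class of the positions below `N` with the same `κ`. -/
structure Naming {γ : Type*} (N : ℕ) (κ : ℕ → γ) (nm : ℕ → ℕ) : Prop where
  lt : ∀ e < N, nm e < N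
  key : ∀ e < N, κ (nm e) = κ e
  eq : ∀ e < N, ∀ f < N, κ e = κ f → nm e = nm f

theorem Naming.congr {γ γ' : Type*} {N : ℕ} {κ : ℕ → γ} {κ' : ℕ → γ'} {nm : ℕ → ℕ}
    (h : Naming N κ nm) (hκ : ∀ e < N, ∀ f < N, κ e = κ f ↔ κ' e = κ' f) : Naming N κ' nm where
  lt := h.lt
  key e he := (hκ _ (h.lt e he) e he).1 (h.key e he)
  eq e he f hf h' := h.eq e he f hf ((hκ e he f hf).2 h')

theorem Naming.refine {γ : Type*} {N : ℕ} {κ : ℕ → γ} {nm0 nm dig : ℕ → ℕ} (h : Naming N κ nm0)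
    (h1 : ∀ e < N, nm e < N ∧ nm0 (nm e) = nm0 e ∧ dig (nm e) = dig e)
    (h2 : ∀ e < N, ∀ f < N, nm0 e = nm0 f → dig e = dig f → nm e = nm f) :
    Naming N (fun e => (κ e, dig e)) nm where
  lt e he := (h1 e he).1
  key e he := by
    obtain ⟨h3, h4, h5⟩ := h1 e he
    have h6 : κ (nm e) = κ e := by rw [← h.key _ h3, h4, h.key e he]
    exact Prod.ext h6 h5
  eq e he f hf h' := by
    rw [Prod.mk.injEq] at h'
    exact h2 e he f hf (h.eq e he f hf h'.1) h'.2

/-- The string of length `j` in the cells from `e` on. -/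
def cellGram (U : ℕ → ℕ) (j e : ℕ) : List ℕ := (List.range j).map fun i => U (e + i)

theorem cellGram_succ (U : ℕ → ℕ) (j e : ℕ) :
    cellGram U (j + 1) e = cellGram U j e ++ [U (e + j)] := by
  simp [cellGram, List.range_succ]

theorem cellGram_succ_inj {U : ℕ → ℕ} {j e f : ℕ} :
    cellGram U (j + 1) e = cellGram U (j + 1) f ↔
      cellGram U j e = cellGram U j f ∧ U (e + j) = U (f + j) := by
  rw [cellGram_succ, cellGram_succ, List.append_eq_append_iff_of_size_eq_right]
  · simp
  · simp

theorem mod_mul_eq_iff {x y a b : ℕ} :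
    x % (a * b) = y % (a * b) ↔ x % a = y % a ∧ x / a % b = y / a % b := by
  constructor
  · intro h
    refine ⟨?_, ?_⟩
    · rw [← Nat.mod_mul_right_mod x a b, h, Nat.mod_mul_right_mod]
    · rw [← Nat.mod_mul_right_div_self, h, Nat.mod_mul_right_div_self]
  · rintro ⟨h1, h2⟩
    rw [Nat.mod_mul, Nat.mod_mul, h1, h2]

/-- Put the largest letter into register `7`. -/
def maxLetter : Cmd :=
  .set 7 (.const 0) ;;
  .forUp 13 2 (.ld 14 aU (.reg 13) ;; .ifLt (.reg 7) (.reg 14) (.set 7 (.reg 14)) .skip)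

/-- Give each position a name: two positions have the same name if the strings of length `q` that
start there are the same. The letters are compared digit by digit. -/
def names : Cmd :=
  maxLetter ;; .forUp 10 1 (
    .set 11 (.reg 7) ;; .set 12 (.const 1) ;;
    .whileLt (.const 0) (.reg 11) (
      refine ;; .set 11 (.div (.reg 11) (.reg 6)) ;; .set 12 (.mulW (.reg 12) (.reg 6))))

theorem maxLetter_spec {Z W B : ℕ} {σ : AState} (hW : Z < W) (hB : 0 < B) (h2 : σ.reg 2 = Z)
    (hU : ∀ x < Z, σ.arr aU x < B) :
    WP W Z 27 maxLetter (fun σ' t => t ≤ 5 * Z + 3 ∧ (∀ r < 7, σ'.reg r = σ.reg r) ∧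
      σ'.arr = σ.arr ∧ σ'.reg 7 < B ∧ ∀ x < Z, σ.arr aU x ≤ σ'.reg 7) σ := by
  rw [maxLetter, wp_seq, wp_set]
  refine ⟨by norm_num, by simp only [HE.ok]; omega, ?_⟩
  refine (WP.forUp (fun k τ => (∀ r < 7, τ.reg r = σ.reg r) ∧ τ.arr = σ.arr ∧ τ.reg 7 < B ∧
      ∀ x < k, σ.arr aU x ≤ τ.reg 7) Z 3 hW (by norm_num) ?_ ?_ ?_).mono ?_
  · exact ⟨fun r hr => by simp [show r ≠ 7 by omega, show r ≠ 13 by omega], rfl, by simpa, by simp⟩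
  · rintro k τ - ⟨hf, -⟩
    rw [hf _ (by norm_num), h2]
  · rintro k τ hk h13 ⟨hf, ha, h7, hle⟩
    have hUk := hU k hk
    simp (disch := omega) only [wp_seq, wp_ld, wp_ifLt, wp_set, wp_skip, HE.ok, HE.eval,
      AState.set_reg, AState.set_arr, h13, ha, Nat.reduceEqDiff, if_false, if_true, true_and]
    and_intros <;> try omega
    · intro h
      repeat refine And.intro (by omega) ?_
      refine ⟨fun r hr => ?_, by omega, fun x hx => ?_⟩
      · simp [show r ≠ 7 by omega, show r ≠ 13 by omega, show r ≠ 14 by omega, hf r hr]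
      · rcases (show x < k ∨ x = k by omega) with h' | rfl
        · exact (hle x h').trans h.le
        · exact le_rfl
    · intro h
      repeat refine And.intro (by omega) ?_
      refine ⟨fun r hr => ?_, by omega, fun x hx => ?_⟩
      · simp [show r ≠ 7 by omega, show r ≠ 13 by omega, show r ≠ 14 by omega, hf r hr]
      · rcases (show x < k ∨ x = k by omega) with h' | rfl
        · exact hle x h'
        · omega
  · rintro σ' t ⟨ht, -, hf, ha, h7, hle⟩
    exact ⟨by omega, hf, ha, h7, hle⟩

/-- The outer loop refines by the letters at distance `0, …, q - 1`, the inner one by their digits;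
after `t` rounds of it the letters at distance `j` have been compared modulo `(n + q) ^ t`. -/
theorem names_spec {n q R N Z W c : ℕ} {σ : AState} (hS : Sizes n q R N Z W)
    (hg : Globals n q R N Z σ) (hU : ∀ x < Z, σ.arr aU x < (n + q) ^ c)
    (hUW : ∀ x < Z, σ.arr aU x < W) (hnm : ∀ x, σ.arr aNM x = 0) :
    WP W Z 27 names (fun σ' t =>
      t ≤ q * (c * (20 * N + 7 * (n + q) + 11) + 5) + 5 * Z + 5 ∧
      (∀ r < 7, σ'.reg r = σ.reg r) ∧ (∀ a, a < aNM ∨ aNW < a → σ'.arr a = σ.arr a) ∧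
      Naming N (cellGram (σ.arr aU) q) (σ'.arr aNM)) σ := by
  have hnN := hS.n_le
  have hNZ := hS.hZ
  have hR := hS.hR
  have hW := hS.hW
  have hW' := hS.hW'
  have hq := hS.hq
  have hn := hS.hn
  have hrow := hS.row_le (Nat.zero_le n)
  have hb : 1 < n + q := by omega
  rw [names, wp_seq]
  refine (maxLetter_spec (B := min ((n + q) ^ c) W) hW (by
    rw [lt_min_iff]; exact ⟨by positivity, by omega⟩) hg.r2
    (fun x hx => lt_min (hU x hx) (hUW x hx))).mono ?_
  rintro σ₁ t₁ ⟨ht₁, hf₁, ha₁, h7, hmax⟩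
  obtain ⟨h7c, h7W⟩ := lt_min_iff.1 h7
  generalize hM : σ₁.reg 7 = M at *
  refine (WP.forUp (fun j τ => (∀ r < 8, τ.reg r = σ₁.reg r) ∧
      (∀ a, a < aNM ∨ aNW < a → τ.arr a = σ.arr a) ∧
      Naming N (cellGram (σ.arr aU) j) (τ.arr aNM)) q
      (c * (20 * N + 7 * (n + q) + 11) + 3) (by omega) (by norm_num) ?_ ?_ ?_).mono ?_
  · -- all positions start with the name `0`, the name of the empty string
    refine ⟨fun r hr => by simp [show r ≠ 10 by omega], fun a _ => by simp [ha₁],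
      fun e he => ?_, fun e he => rfl, fun e _ f _ _ => ?_⟩
    · simp [ha₁, hnm]; omega
    · simp [ha₁, hnm]
  · rintro k τ - ⟨hf, -⟩
    rw [hf _ (by norm_num), hf₁ _ (by norm_num), hg.r1]
  · rintro j τ hj h10 ⟨hf, ha, hN⟩
    have h7' : τ.reg 7 = M := by rw [hf _ (by norm_num), hM]
    simp (disch := omega) only [wp_seq, wp_set, HE.ok, HE.eval, AState.set_reg, h7',
      Nat.reduceEqDiff, if_false, if_true, true_and]
    repeat refine And.intro (by omega) ?_
    refine (WP.while (fun t τ' => (∀ r < 11, τ'.reg r = τ.reg r) ∧ τ'.reg 11 = M / (n + q) ^ t ∧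
        τ'.reg 12 = (n + q) ^ t % W ∧ (∀ a, a < aNM ∨ aNW < a → τ'.arr a = σ.arr a) ∧
        Naming N (fun e => (cellGram (σ.arr aU) j e, σ.arr aU (e + j) % (n + q) ^ t))
          (τ'.arr aNM)) c (20 * N + 7 * (n + q) + 10) ?_ ?_ ?_ ?_).mono ?_
    · refine ⟨fun r hr => by simp [show r ≠ 11 by omega, show r ≠ 12 by omega], by simp, ?_, ha, ?_⟩
      · simp [Nat.mod_eq_of_lt (show 1 < W by omega)]
      · exact hN.congr fun e _ f _ => by simp [Nat.mod_one]
    · intro i τ' _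
      exact ⟨by simp only [HE.ok]; omega, trivial⟩
    · rintro t τ' ⟨-, h11, -⟩ hlt
      simp only [HE.eval, h11] at hlt
      by_contra hct
      have h1 := Nat.pow_le_pow_right (by omega : 0 < n + q) (not_lt.1 hct)
      rw [Nat.div_eq_of_lt (by omega)] at hlt
      omega
    · rintro t τ' ⟨hf', h11, h12, ha', hN'⟩ hlt
      simp only [HE.eval, h11] at hlt
      -- The quotient is not yet `0`, so the power of the base does not exceed the largest letter.
      -- Only the last power, which is not used any more, may wrap around.
      have hpw : (n + q) ^ t ≤ M := by
        by_contra h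
        rw [Nat.div_eq_of_lt (by omega)] at hlt
        omega
      rw [Nat.mod_eq_of_lt (by omega)] at h12
      have hg' : Globals n q R N Z τ' := hg.congr fun r hr => by
        rw [hf' r (by omega), hf r (by omega), hf₁ r hr]
      have haU : τ'.arr aU = σ.arr aU := ha' _ (by norm_num)
      rw [wp_seq]
      refine (refine_spec (dig := fun e => σ.arr aU (e + j) / (n + q) ^ t % (n + q))
        (nm0 := τ'.arr aNM) hS hg' hj (by rw [hf' _ (by norm_num), h10]) h12
        (by simp [haU]) hN'.lt rfl).mono ?_
      rintro τ'' s ⟨hs, hf'', ha'', hk, he⟩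
      have h11' : τ''.reg 11 = M / (n + q) ^ t := by rw [hf'' _ (by norm_num), h11]
      have h12' : τ''.reg 12 = (n + q) ^ t := by rw [hf'' _ (by norm_num), h12]
      have h6' : τ''.reg 6 = n + q := by rw [hf'' _ (by norm_num), hg'.r6]
      simp (disch := omega) only [wp_seq, wp_set, HE.ok, HE.eval, AState.set_reg, AState.set_arr,
        h11', h12', h6', Nat.reduceEqDiff, if_false, if_true, true_and]
      repeat refine And.intro (by omega) ?_
      refine ⟨fun r hr => ?_, by rw [Nat.div_div_eq_div_mul, pow_succ], by rw [pow_succ],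
        fun a h => ?_, ?_⟩
      · simp [show r ≠ 11 by omega, show r ≠ 12 by omega, hf'' r (by omega), hf' r hr]
      · rw [ha'' a h, ha' a h]
      · refine (hN'.refine hk he).congr fun e _ f _ => ?_
        simp only [Prod.mk.injEq, pow_succ, mod_mul_eq_iff, and_assoc]
    · rintro τ' t ⟨ht, i, -, ⟨hf', h11, h12, ha', hN'⟩, hnlt⟩
      simp only [HE.eval, h11, not_lt, Nat.le_zero, Nat.div_eq_zero_iff] at hnlt
      have hlt : M < (n + q) ^ i := by
        rcases hnlt with h | h
        · have : 0 < (n + q) ^ i := by positivity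
          omega
        · exact h
      have ht : t ≤ c * (20 * N + 7 * (n + q) + 11) + 1 := ht
      refine ⟨by omega, by rw [hf' _ (by norm_num), h10], fun r hr => ?_, ha', ?_⟩
      · simp [show r ≠ 10 by omega, hf' r (by omega), hf r hr]
      · refine hN'.congr fun e he f hf => ?_
        have h1 : ∀ x < N, σ.arr aU (x + j) % (n + q) ^ i = σ.arr aU (x + j) := fun x hx =>
          Nat.mod_eq_of_lt (lt_of_le_of_lt (hmax (x + j) (by omega)) hlt)
        simp only [Prod.mk.injEq, h1 e he, h1 f hf, cellGram_succ_inj]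
  · rintro σ₂ t₂ ⟨ht₂, -, hf₂, ha₂, hN₂⟩
    have ht₂ : t₂ ≤ q * (c * (20 * N + 7 * (n + q) + 11) + 5) + 2 := ht₂
    exact ⟨by omega, fun r hr => (hf₂ r (by omega)).trans (hf₁ r hr), ha₂, hN₂⟩

/-! ### Computing the tables -/

/-- The loss that is caused by blocked positions, computed by two walks, and the final state, for
each of the first `q - 1` entries. The loss is the difference of the two counts, in which the counts
in the outer parts cancel. -/
def headTables : Cmd :=
  .ld 23 aPYL (.reg 11) ;;
  .forUp 22 23 (
    .ld 20 aPY (.add (.reg 11) (.reg 22)) ;; .set 21 (.add (.reg 22) (.const 1)) ;; walk ;;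
    .set 24 (.reg 30) ;; .set 25 (.reg 31) ;; .set 26 (.add (.reg 32) (.reg 33)) ;;
    .set 21 (.const 0) ;; walk ;; .st aHS (.add (.reg 11) (.reg 22)) (.reg 24) ;;
    .st aHL (.add (.reg 11) (.reg 22))
      (.sub (.add (.reg 26) (.reg 31)) (.add (.reg 25) (.add (.reg 32) (.reg 33)))))

/-- The final states without blocked positions, for each of the last `q - 1` entries. -/
def tailTables : Cmd :=
  .ld 23 aSYL (.reg 11) ;;
  .forUp 22 23 (
    .ld 20 aSY (.add (.reg 11) (.reg 22)) ;; .set 21 (.const 0) ;; walk ;;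
    .st aFS (.add (.reg 11) (.reg 22)) (.reg 30))

/-- The tables of the row at register `11`. -/
def rowTables : Cmd :=
  .set 41 (.reg 4) ;;
  cat3 aPY aPY aPYL 13 false aNM aWL 11 false aPY aPYL 15 false ;; .st aPYL (.reg 11) (.reg 50) ;;
  cat3 aSY aSY aSYL 15 false aNM aWL 11 true aSY aSYL 13 false ;; .st aSYL (.reg 11) (.reg 50) ;;
  headTables ;; tailTables

theorem headTables_spec {W Z q v lb rb : ℕ} {σ : AState} {Yl M Yr P : List ℕ} (hZ : Z < W)
    (hqW : q + 10 < W) (hT : Triple q Z v lb rb Yl M Yr σ) (hq : 1 ≤ q) (hM : M.length ≤ q)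
    (hlv : lb + q ≤ v)
    (hrv : rb + q ≤ v) (hv : v + q ≤ Z) (hP : P.length ≤ q - 1)
    (hpyl : σ.arr aPYL v = P.length) :
    WP W Z 27 headTables (fun σ' t => t ≤ q * (62 * q + 100) + 3 ∧
      (∀ r < 20, σ'.reg r = σ.reg r) ∧
      (∀ a, a ≠ aHS → a ≠ aHL → σ'.arr a = σ.arr a) ∧
      (∀ a, ∀ x < v, σ'.arr a x = σ.arr a x) ∧
      (∀ j < P.length, σ'.arr aHS (v + j) =
        state q (hits (Yl ++ M ++ Yr) (σ.arr aPY (v + j))) (j + 1)) ∧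
      ∀ j < P.length,
        σ'.arr aHL (v + j) + count q (hits (Yl ++ M ++ Yr) (σ.arr aPY (v + j))) (j + 1) =
          count q (hits (Yl ++ M ++ Yr) (σ.arr aPY (v + j))) 0) σ := by
  simp (disch := omega) only [headTables, wp_seq, wp_ld, HE.ok, HE.eval, hT.r11, hpyl, true_and]
  repeat refine And.intro (by omega) ?_
  refine (WP.forUp (fun k τ => (∀ r < 20, τ.reg r = σ.reg r) ∧ τ.reg 23 = P.length ∧
      (∀ a, a ≠ aHS → a ≠ aHL → τ.arr a = σ.arr a) ∧
      (∀ a, ∀ x < v, τ.arr a x = σ.arr a x) ∧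
      (∀ j < k, τ.arr aHS (v + j) =
        state q (hits (Yl ++ M ++ Yr) (σ.arr aPY (v + j))) (j + 1)) ∧
      ∀ j < k, τ.arr aHL (v + j) + count q (hits (Yl ++ M ++ Yr) (σ.arr aPY (v + j))) (j + 1)
        = count q (hits (Yl ++ M ++ Yr) (σ.arr aPY (v + j))) 0)
    P.length (62 * q + 90) (by omega) (by norm_num) ?_ ?_ ?_).mono ?_
  · refine ⟨fun r hr => ?_, by simp, fun _ _ _ => rfl, fun _ _ _ => rfl, by omega, by omega⟩
    simp [show r ≠ 22 by omega, show r ≠ 23 by omega]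
  · rintro k τ - ⟨-, h, -⟩
    exact h
  · rintro k τ hk h22 ⟨hf, h23, ha, hx, hs, hl⟩
    have hT' : Triple q Z v lb rb Yl M Yr τ := hT.congr hq hf (ha _ (by norm_num) (by norm_num))
      hlv hrv fun a _ _ => hx a
    have hPY : τ.arr aPY = σ.arr aPY := ha _ (by norm_num) (by norm_num)
    obtain ⟨z, hz⟩ : ∃ z, σ.arr aPY (v + k) = z := ⟨_, rfl⟩
    simp (disch := omega) only [wp_seq, wp_ld, wp_set, HE.ok, HE.eval, AState.set_reg,
      AState.set_arr, hT'.r11, h22, hPY, hz, Nat.reduceEqDiff, if_false, if_true, true_and]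
    repeat refine And.intro (by omega) ?_
    refine WP.mono (walk_spec (z := z) (d := k + 1) hZ ?_ ?_
      (hT'.congr hq (fun r hr => ?_) rfl hlv hrv fun _ _ _ _ _ => rfl) hq (by omega)) ?_
    · simp
    · simp
    · simp [show r ≠ 20 by omega, show r ≠ 21 by omega]
    rintro σ₁ t₁ ⟨ht₁, hf₁, ha₁, h30, h31, h31M, h32, h33⟩
    have hf₁' : ∀ r < 20, σ₁.reg r = σ.reg r := fun r hr => by
      rw [hf₁ r (by omega)]
      simp [show r ≠ 20 by omega, show r ≠ 21 by omega, hf r hr]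
    have h20₁ : σ₁.reg 20 = z := by rw [hf₁ _ (by norm_num)]; simp
    have h22₁ : σ₁.reg 22 = k := by rw [hf₁ _ (by norm_num)]; simp [h22]
    have h23₁ : σ₁.reg 23 = P.length := by rw [hf₁ _ (by norm_num)]; simp [h23]
    rw [AState.set_arr, AState.set_arr] at ha₁
    repeat refine And.intro (by omega) ?_
    refine WP.mono (walk_spec (z := z) (d := 0) hZ ?_ ?_
      (hT'.congr hq (fun r hr => ?_) ?_ hlv hrv fun a _ _ x _ => ?_) hq (by omega)) ?_
    · simp [h20₁]
    · simp
    · simp [show r ≠ 24 by omega, show r ≠ 25 by omega, show r ≠ 26 by omega,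
        show r ≠ 21 by omega, hf₁' r hr, hf r hr]
    · simp [ha₁]
    · simp [ha₁]
    rintro σ₂ t₂ ⟨ht₂, hf₂, ha₂, h30', h31', h31M', h32', h33'⟩
    have hf₂' : ∀ r < 20, σ₂.reg r = σ.reg r := fun r hr => by
      rw [hf₂ r (by omega)]
      simp [show r ≠ 24 by omega, show r ≠ 25 by omega, show r ≠ 26 by omega,
        show r ≠ 21 by omega, hf₁' r hr]
    have h22₂ : σ₂.reg 22 = k := by rw [hf₂ _ (by norm_num)]; simp [h22₁]
    have h23₂ : σ₂.reg 23 = P.length := by rw [hf₂ _ (by norm_num)]; simp [h23₁]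
    have h24₂ : σ₂.reg 24 = σ₁.reg 30 := by rw [hf₂ _ (by norm_num)]; simp
    have h25₂ : σ₂.reg 25 = σ₁.reg 31 := by rw [hf₂ _ (by norm_num)]; simp
    have h26₂ : σ₂.reg 26 = σ₁.reg 32 + σ₁.reg 33 := by rw [hf₂ _ (by norm_num)]; simp
    have h11₂ : σ₂.reg 11 = v := by rw [hf₂' _ (by norm_num), hT.r11]
    have ha₂' : σ₂.arr = τ.arr := by rw [ha₂]; simp [ha₁]
    -- the loss is not negative, so the subtraction is exact
    have hmono := (count_interleave (q := q) (hits (Yl ++ M ++ Yr) z) (Nat.zero_le (k + 1))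
      (by omega)).1
    simp (disch := omega) only [wp_seq, wp_st, HE.ok, HE.eval, AState.put_reg,
      h11₂, h22₂, h24₂, h25₂, h26₂, true_and]
    repeat refine And.intro (by omega) ?_
    refine ⟨fun r hr => ?_, ?_, fun a h1 h2 => ?_, fun a x hxv => ?_, fun j hj => ?_,
      fun j hj => ?_⟩
    · simp [show r ≠ 22 by omega, hf₂' r hr]
    · simp [h23₂]
    · rw [AState.put_arr_ne _ h2, AState.put_arr_ne _ h1, ha₂']
      exact ha a h1 h2
    · rw [AState.put_arr, if_neg (by omega), AState.put_arr, if_neg (by omega), ha₂']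
      exact hx a x hxv
    · rw [AState.put_arr_ne _ (by norm_num), AState.put_arr_same]
      rcases (show j < k ∨ j = k by omega) with h | rfl
      · rw [if_neg (by omega), ha₂', hs j h]
      · rw [if_pos rfl, h30, hz]
    · rw [AState.put_arr_same]
      rcases (show j < k ∨ j = k by omega) with h | rfl
      · rw [if_neg (by omega), AState.put_arr_ne _ (by norm_num), ha₂', hl j h]
      · rw [if_pos rfl, hz]
        omega
  · rintro σ' t ⟨ht, -, hf, -, ha, hx, hs, hl⟩
    have h1 : P.length * (62 * q + 90 + 2) ≤ q * (62 * q + 100) :=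
      Nat.mul_le_mul (by omega) (by omega)
    exact ⟨by omega, hf, ha, hx, hs, hl⟩

theorem tailTables_spec {W Z q v lb rb : ℕ} {σ : AState} {Yl M Yr S : List ℕ} (hZ : Z < W)
    (hT : Triple q Z v lb rb Yl M Yr σ) (hq : 1 ≤ q) (hM : M.length ≤ q) (hlv : lb + q ≤ v)
    (hrv : rb + q ≤ v) (hv : v + q ≤ Z) (hS : S.length ≤ q - 1)
    (hsyl : σ.arr aSYL v = S.length) :
    WP W Z 27 tailTables (fun σ' t => t ≤ q * (31 * q + 100) + 3 ∧
      (∀ r < 20, σ'.reg r = σ.reg r) ∧ (∀ a, a ≠ aFS → σ'.arr a = σ.arr a) ∧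
      (∀ x < v, σ'.arr aFS x = σ.arr aFS x) ∧
      ∀ j < S.length, σ'.arr aFS (v + j) =
        state q (hits (Yl ++ M ++ Yr) (σ.arr aSY (v + j))) 0) σ := by
  simp (disch := omega) only [tailTables, wp_seq, wp_ld, HE.ok, HE.eval, hT.r11, hsyl, true_and]
  repeat refine And.intro (by omega) ?_
  refine (WP.forUp (fun k τ => (∀ r < 20, τ.reg r = σ.reg r) ∧ τ.reg 23 = S.length ∧
      (∀ a, a ≠ aFS → τ.arr a = σ.arr a) ∧ (∀ x < v, τ.arr aFS x = σ.arr aFS x) ∧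
      ∀ j < k, τ.arr aFS (v + j) = state q (hits (Yl ++ M ++ Yr) (σ.arr aSY (v + j))) 0)
    S.length (31 * q + 90) (by omega) (by norm_num) ?_ ?_ ?_).mono ?_
  · refine ⟨fun r hr => ?_, by simp, fun _ _ => rfl, fun _ _ => rfl, by omega⟩
    simp [show r ≠ 22 by omega, show r ≠ 23 by omega]
  · rintro k τ - ⟨-, h, -⟩
    exact h
  · rintro k τ hk h22 ⟨hf, h23, ha, hx, hs⟩
    have hT' : Triple q Z v lb rb Yl M Yr τ := hT.congr hq hf (ha _ (by norm_num))
      hlv hrv fun a _ _ x hxv => by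
        by_cases h : a = aFS
        · rw [h]; exact hx x hxv
        · rw [ha a h]
    have hSY : τ.arr aSY = σ.arr aSY := ha _ (by norm_num)
    obtain ⟨z, hz⟩ : ∃ z, σ.arr aSY (v + k) = z := ⟨_, rfl⟩
    simp (disch := omega) only [wp_seq, wp_ld, wp_set, HE.ok, HE.eval, AState.set_reg,
      AState.set_arr, hT'.r11, h22, hSY, hz, Nat.reduceEqDiff, if_false, if_true, true_and]
    repeat refine And.intro (by omega) ?_
    refine WP.mono (walk_spec (z := z) (d := 0) hZ ?_ ?_
      (hT'.congr hq (fun r hr => ?_) rfl hlv hrv fun _ _ _ _ _ => rfl) hq (by omega)) ?_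
    · simp
    · simp
    · simp [show r ≠ 20 by omega, show r ≠ 21 by omega]
    rintro σ₁ t₁ ⟨ht₁, hf₁, ha₁, h30, -⟩
    have hf₁' : ∀ r < 20, σ₁.reg r = σ.reg r := fun r hr => by
      rw [hf₁ r (by omega)]
      simp [show r ≠ 20 by omega, show r ≠ 21 by omega, hf r hr]
    have h22₁ : σ₁.reg 22 = k := by rw [hf₁ _ (by norm_num)]; simp [h22]
    have h23₁ : σ₁.reg 23 = S.length := by rw [hf₁ _ (by norm_num)]; simp [h23]
    have h11₁ : σ₁.reg 11 = v := by rw [hf₁' _ (by norm_num), hT.r11]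
    rw [AState.set_arr, AState.set_arr] at ha₁
    simp (disch := omega) only [wp_st, HE.ok, HE.eval, AState.put_reg, h11₁, h22₁, true_and]
    repeat refine And.intro (by omega) ?_
    refine ⟨fun r hr => ?_, ?_, fun a h1 => ?_, fun x hxv => ?_, fun j hj => ?_⟩
    · simp [show r ≠ 22 by omega, hf₁' r hr]
    · simp [h23₁]
    · rw [AState.put_arr_ne _ h1, ha₁]
      exact ha a h1
    · rw [AState.put_arr, if_neg (by omega), ha₁]
      exact hx x hxv
    · rw [AState.put_arr_same]
      rcases (show j < k ∨ j = k by omega) with h | rfl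
      · rw [if_neg (by omega), ha₁, hs j h]
      · rw [if_pos rfl, h30, hz]
  · rintro σ' t ⟨ht, -, hf, -, ha, hx, hs⟩
    have h1 : S.length * (31 * q + 90 + 2) ≤ q * (31 * q + 100) :=
      Nat.mul_le_mul (by omega) (by omega)
    exact ⟨by omega, hf, ha, hx, hs⟩

/-- The tables of a composed sequence are computed from those of its parts in `O(q ^ 2)` steps. -/
theorem rowTables_spec {W Z q v lb rb : ℕ} {σ : AState} {Yl M Yr Y : List ℕ} (hZ : Z < W)
    (hqW : q + 10 < W) (hT : Triple q Z v lb rb Yl M Yr σ) (hq : 1 ≤ q) (hM : M.length ≤ q)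
    (hlv : lb + q ≤ v) (hrv : rb + q ≤ v) (hv : v + q ≤ Z) (hY : Y = Yl ++ M ++ Yr)
    (hwl : σ.arr aWL v = M.length) :
    WP W Z 27 rowTables (fun σ' t => t ≤ q * (93 * q + 300) + 50 ∧
      (∀ r < 20, σ'.reg r = σ.reg r) ∧ (∀ a, a < 16 ∨ 22 < a → σ'.arr a = σ.arr a) ∧
      (∀ a, ∀ x < v, σ'.arr a x = σ.arr a x) ∧ Table q σ'.arr v Y) σ := by
  have hlen : ∀ L : List ℕ, (L.take (q - 1)).length ≤ q - 1 := fun L => by simp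
  have hl1 := hlen Yl
  have hl2 := hlen Yl.reverse
  have hr1 := hlen Yr
  have hr2 := hlen Yr.reverse
  have hy1 := hlen Y
  have hy2 := hlen Y.reverse
  obtain ⟨h4, h11, h13, h15, h16, hMr, hl, hr, hvM, hlb, hrb⟩ := hT
  rw [rowTables, wp_seq, wp_set, HE.eval, h4]
  refine ⟨by norm_num, trivial, ?_⟩
  rw [wp_seq]
  refine WP.mono (cat3_spec (cap := q - 1) (v := v) (x₁ := lb) (x₂ := v) (x₃ := rb)
    (M₁ := Yl.take (q - 1)) (M₂ := M) (M₃ := Yr.take (q - 1)) (T := Y.take (q - 1)) hZ ?_ ?_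
    (by omega) ?_ ?_ ?_ ?_ ?_ ?_ ⟨?_, ?_, by omega, by omega⟩ ⟨?_, ?_, by omega, by omega⟩
    ⟨?_, ?_, by omega, by omega⟩ ?_ ?_ ?_ ?_) ?_
  · simp [h11]
  · simp
  · norm_num
  · norm_num
  · norm_num
  · simp [h13]
  · simp [h11]
  · simp [h15]
  · exact hl.pyl
  · exact hl.py
  · exact hwl
  · exact hMr
  · exact hr.pyl
  · exact hr.py
  · omega
  · omega
  · omega
  · simp only [dirList, Bool.false_eq_true, if_false]
    rw [take_cat, hY]
  rintro σ₁ t₁ ⟨ht₁, hf₁, h41₁, h50₁, hrow₁, ha₁, hx₁⟩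
  have hf₁' : ∀ r < 40, σ₁.reg r = σ.reg r := fun r hr => by
    rw [hf₁ r hr]; simp [show r ≠ 41 by omega]
  rw [AState.set_arr] at ha₁ hx₁
  simp (disch := omega) only [wp_seq, wp_st, HE.ok, HE.eval, hf₁', h11, h50₁, true_and]
  repeat refine And.intro (by omega) ?_
  have hmid₁ : ∀ a, a ≠ aPY → a ≠ aPYL →
      (σ₁.put aPYL v (Y.take (q - 1)).length).arr a = σ.arr a := fun a h1 h2 => by
    rw [AState.put_arr_ne _ h2, ha₁ a h1]
  refine WP.mono (cat3_spec (cap := q - 1) (v := v) (x₁ := rb) (x₂ := v) (x₃ := lb)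
    (M₁ := Yr.reverse.take (q - 1)) (M₂ := M) (M₃ := Yl.reverse.take (q - 1))
    (T := Y.reverse.take (q - 1)) hZ ?_ ?_
    (by omega) ?_ ?_ ?_ ?_ ?_ ?_ ⟨?_, ?_, by omega, by omega⟩ ⟨?_, ?_, by omega, by omega⟩
    ⟨?_, ?_, by omega, by omega⟩ ?_ ?_ ?_ ?_) ?_
  · simp [hf₁', h11]
  · simp [h41₁]
  · norm_num
  · norm_num
  · norm_num
  · simp [hf₁', h15]
  · simp [hf₁', h11]
  · simp [hf₁', h13]
  · rw [hmid₁ _ (by norm_num) (by norm_num)]; exact hr.syl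
  · rw [hmid₁ _ (by norm_num) (by norm_num)]; exact hr.sy
  · rw [hmid₁ _ (by norm_num) (by norm_num)]; exact hwl
  · rw [hmid₁ _ (by norm_num) (by norm_num)]; exact hMr
  · rw [hmid₁ _ (by norm_num) (by norm_num)]; exact hl.syl
  · rw [hmid₁ _ (by norm_num) (by norm_num)]; exact hl.sy
  · omega
  · omega
  · omega
  · simp only [dirList, Bool.false_eq_true, if_false, if_true]
    rw [take_cat, hY, List.reverse_append, List.reverse_append, List.append_assoc]
  rintro σ₂ t₂ ⟨ht₂, hf₂, h41₂, h50₂, hrow₂, ha₂, hx₂⟩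
  have hf₂' : ∀ r < 40, σ₂.reg r = σ.reg r := fun r hr => by
    rw [hf₂ r hr, AState.put_reg, hf₁' r hr]
  simp (disch := omega) only [wp_seq, wp_st, HE.ok, HE.eval, hf₂', h11, h50₂, true_and]
  repeat refine And.intro (by omega) ?_
  generalize hτ : σ₂.put aSYL v (Y.reverse.take (q - 1)).length = τ
  have hτr : ∀ r < 40, τ.reg r = σ.reg r := fun r hr => by rw [← hτ, AState.put_reg, hf₂' r hr]
  have hτa : ∀ a, a < 16 ∨ 19 < a → τ.arr a = σ.arr a := fun a h => by
    rw [← hτ, AState.put_arr_ne _ (by omega), ha₂ a (by omega), hmid₁ a (by omega) (by omega)]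
  have hτx : ∀ a, ∀ x < v, τ.arr a x = σ.arr a x := by
    intro a x hxv
    have h1 : σ₁.arr a x = σ.arr a x := by
      by_cases h : a = aPY
      · rw [h]; exact hx₁ x (.inl hxv)
      · rw [ha₁ a h]
    have h2 : σ₂.arr a x = σ₁.arr a x := by
      by_cases h : a = aSY
      · rw [h, hx₂ x (.inl hxv), AState.put_arr, if_neg (by omega)]
      · rw [ha₂ a h, AState.put_arr, if_neg (by omega)]
    rw [← hτ, AState.put_arr, if_neg (by omega), h2, h1]
  have hpyl : τ.arr aPYL v = (Y.take (q - 1)).length := by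
    rw [← hτ, AState.put_arr_ne _ (by norm_num), ha₂ _ (by norm_num), AState.put_arr_same,
      if_pos rfl]
  have hpy : Row (τ.arr aPY) v (Y.take (q - 1)) := by
    rw [← hτ, AState.put_arr_ne _ (by norm_num), ha₂ _ (by norm_num),
      AState.put_arr_ne _ (by norm_num)]
    exact hrow₁
  have hsyl : τ.arr aSYL v = (Y.reverse.take (q - 1)).length := by
    rw [← hτ, AState.put_arr_same, if_pos rfl]
  have hsy : Row (τ.arr aSY) v (Y.reverse.take (q - 1)) := by
    rw [← hτ, AState.put_arr_ne _ (by norm_num)]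
    exact hrow₂
  have hT : Triple q Z v lb rb Yl M Yr σ := ⟨h4, h11, h13, h15, h16, hMr, hl, hr, hvM, hlb, hrb⟩
  have hTτ : Triple q Z v lb rb Yl M Yr τ := hT.congr hq (fun r h => hτr r (by omega))
    (hτa _ (by norm_num)) hlv hrv fun a _ _ => hτx a
  refine (headTables_spec hZ hqW hTτ hq hM hlv hrv hv hy1 hpyl).mono ?_
  rintro σ₃ t₃ ⟨ht₃, hf₃, ha₃, hx₃, hhs, hhl⟩
  refine (tailTables_spec (S := Y.reverse.take (q - 1)) hZ (hTτ.congr hq hf₃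
    (ha₃ _ (by norm_num) (by norm_num)) hlv hrv fun a _ _ => hx₃ a) hq hM hlv hrv hv hy2 (by
      rw [ha₃ _ (by norm_num) (by norm_num), hsyl])).mono ?_
  rintro σ₄ t₄ ⟨ht₄, hf₄, ha₄, hx₄, hfs⟩
  rw [← hY] at hhs hhl hfs
  have h34 : ∀ a, 16 ≤ a → a ≤ 19 → σ₄.arr a = τ.arr a := fun a h1 h2 => by
    rw [ha₄ a (by omega), ha₃ a (by omega) (by omega)]
  refine ⟨?_, fun r hr => ?_, fun a h => ?_, fun a x hxv => ?_, ⟨?_, ?_, ?_, ?_, ?_, ?_, ?_⟩⟩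
  · have h1 : q * (93 * q + 300) = q * (62 * q + 100) + q * (31 * q + 100) + 100 * q := by ring
    omega
  · rw [hf₄ r hr, hf₃ r hr, hτr r (by omega)]
  · rw [ha₄ a (by omega), ha₃ a (by omega) (by omega), hτa a (by omega)]
  · have h1 : σ₄.arr a x = σ₃.arr a x := by
      by_cases h : a = aFS
      · rw [h]; exact hx₄ x hxv
      · rw [ha₄ a h]
    rw [h1, hx₃ a x hxv, hτx a x hxv]
  · rw [h34 _ (by norm_num) (by norm_num), hpyl]
  · rw [h34 _ (by norm_num) (by norm_num)]; exact hpy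
  · rw [h34 _ (by norm_num) (by norm_num), hsyl]
  · rw [h34 _ (by norm_num) (by norm_num)]; exact hsy
  · rw [h34 aPY (by norm_num) (by norm_num), ha₄ aHS (by norm_num)]; exact hhs
  · rw [h34 aPY (by norm_num) (by norm_num), ha₄ aHL (by norm_num)]; exact hhl
  · rw [h34 aSY (by norm_num) (by norm_num)]
    intro j hj
    rw [hfs j hj, ha₃ _ (by norm_num) (by norm_num)]

/-- The sequences of symbols that belong to the rows: `Y i` is composed like `X i` in `RowSLP`, with
a middle part `M i` of at most `q` symbols, which is long enough to let the greedy selection of a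
symbol that it does not contain return to the initial state. -/
structure SymSLP (n q : ℕ) (lc rc : ℕ → ℕ) (M Y : ℕ → List ℕ) : Prop where
  zero : Y 0 = []
  lc_lt : ∀ i, 1 ≤ i → i ≤ n → lc i < i
  rc_lt : ∀ i, 1 ≤ i → i ≤ n → rc i < i
  eq : ∀ i, 1 ≤ i → i ≤ n → Y i = Y (lc i) ++ M i ++ Y (rc i)
  len_le : ∀ i, 1 ≤ i → i ≤ n → (M i).length ≤ q
  gap : ∀ i, 1 ≤ i → i ≤ n → Y (lc i) = [] ∨ Y (rc i) = [] ∨ q - 1 ≤ (M i).length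

/-- The data of row `i` that describe the composition of `Y i`. -/
structure SymRow (R : ℕ) (lc rc : ℕ → ℕ) (M : ℕ → List ℕ) (A : ℕ → ℕ → ℕ) (i : ℕ) : Prop where
  lc : A aLC (i * R) = lc i * R
  rc : A aRC (i * R) = rc i * R
  row : Row (A aNM) (i * R) (M i)
  len : A aWL (i * R) = (M i).length

theorem SymRow.congr {R i : ℕ} {lc rc : ℕ → ℕ} {M : ℕ → List ℕ} {A A' : ℕ → ℕ → ℕ}
    (h : SymRow R lc rc M A i) (hA : ∀ a, a < 12 → A' a = A a) : SymRow R lc rc M A' i := by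
  obtain ⟨h1, h2, h3, h4⟩ := h
  refine ⟨?_, ?_, ?_, ?_⟩ <;> rw [hA _ (by norm_num)] <;> assumption

/-- Load the description of row `i`, for `i` in register `10`. -/
def enter : Cmd := rowAt ;; .ld 16 aWL (.reg 11)

theorem enter_spec {n q R N Z W i : ℕ} {lc rc : ℕ → ℕ} {M Y : ℕ → List ℕ} {σ : AState}
    (hS : Sizes n q R N Z W) (hG : SymSLP n q lc rc M Y) (hg : Globals n q R N Z σ)
    (hi1 : 1 ≤ i) (hin : i ≤ n) (hrow : SymRow R lc rc M σ.arr i)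
    (hl : Table q σ.arr (lc i * R) (Y (lc i))) (hr : Table q σ.arr (rc i * R) (Y (rc i)))
    (h10 : σ.reg 10 = i) :
    WP W Z 27 enter (fun σ' t => t = 4 ∧
      (∀ r, r ≠ 11 → r ≠ 13 → r ≠ 15 → r ≠ 16 → σ'.reg r = σ.reg r) ∧ σ'.arr = σ.arr ∧
      Triple q Z (i * R) (lc i * R) (rc i * R) (Y (lc i)) (M i) (Y (rc i)) σ') σ := by
  have hNZ := hS.hZ
  have hR := hS.hR
  have hW := hS.hW
  have hq := hS.hq
  have hri := hS.row_le hin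
  have hlc := row_lt (R := R) (hG.lc_lt i hi1 hin)
  have hrc := row_lt (R := R) (hG.rc_lt i hi1 hin)
  have hM := hG.len_le i hi1 hin
  generalize hv : i * R = v at *
  have hlcv := hrow.lc
  have hrcv := hrow.rc
  have hrw := hrow.row
  have hlen := hrow.len
  rw [hv] at hlcv hrcv hrw hlen
  simp (disch := omega) only [enter, rowAt, wp_seq, wp_set, wp_ld, HE.ok, HE.eval, AState.set_reg,
    AState.set_arr, h10, hg.r3, hv, hlcv, hrcv, hlen, Nat.reduceEqDiff, if_false, if_true,
    true_and]
  repeat refine And.intro (by omega) ?_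
  refine ⟨fun r h1 h2 h3 h4 => by simp [h1, h2, h3, h4], ⟨by simp [hg.r4], by simp, by simp, by simp,
    by simp, hrw, hl, hr, by omega, by omega, by omega⟩⟩

/-- Compute the tables of all rows. -/
def tables : Cmd := .forUp 9 0 (.set 10 (.add (.reg 9) (.const 1)) ;; enter ;; rowTables)

/-- Row `0` needs no computation, since arrays filled with zeros are the tables of the empty
sequence. -/
theorem tables_spec {n q R N Z W : ℕ} {lc rc : ℕ → ℕ} {M Y : ℕ → List ℕ} {σ : AState}
    (hS : Sizes n q R N Z W) (hG : SymSLP n q lc rc M Y) (hg : Globals n q R N Z σ)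
    (hrow : ∀ i, 1 ≤ i → i ≤ n → SymRow R lc rc M σ.arr i)
    (hzero : ∀ a, 16 ≤ a → ∀ x, σ.arr a x = 0) :
    WP W Z 27 tables (fun σ' t => t ≤ n * (q * (93 * q + 300) + 60) + 2 ∧
      Globals n q R N Z σ' ∧ (∀ a, a < 16 ∨ 22 < a → σ'.arr a = σ.arr a) ∧
      ∀ i ≤ n, Table q σ'.arr (i * R) (Y i)) σ := by
  have hNZ := hS.hZ
  have hR := hS.hR
  have hW := hS.hW
  have hW' := hS.hW'
  have hq := hS.hq
  have hnN := hS.n_le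
  have hrow0 := hS.row_le (Nat.zero_le n)
  refine (WP.forUp (fun k τ => Globals n q R N Z τ ∧ (∀ a, a < 16 ∨ 22 < a → τ.arr a = σ.arr a) ∧
      ∀ i ≤ k, Table q τ.arr (i * R) (Y i))
    n (q * (93 * q + 300) + 58) (by omega) (by norm_num) ?_ ?_ ?_).mono ?_
  · refine ⟨hg.congr fun r hr => by simp [show r ≠ 9 by omega], fun _ _ => rfl, fun i hi => ?_⟩
    obtain rfl : i = 0 := by omega
    rw [hG.zero]
    refine ⟨?_, by simpa using row_nil _ _, ?_, by simpa using row_nil _ _, ?_, ?_, ?_⟩ <;>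
      simp [hzero]
  · rintro k τ - ⟨hg', -⟩
    exact hg'.r0
  · rintro k τ hk h9 ⟨hg', ha, hT⟩
    have hri := hS.row_le (i := k + 1) (by omega)
    have hlc := row_lt (R := R) (hG.lc_lt (k + 1) (by omega) (by omega))
    have hrc := row_lt (R := R) (hG.rc_lt (k + 1) (by omega) (by omega))
    simp (disch := omega) only [wp_seq, wp_set, HE.ok, HE.eval, h9, true_and]
    repeat refine And.intro (by omega) ?_
    have hsr : SymRow R lc rc M (τ.set 10 (k + 1)).arr (k + 1) :=
      (hrow (k + 1) (by omega) (by omega)).congr fun a h => ha a (by omega)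
    refine (enter_spec (σ := τ.set 10 (k + 1)) hS hG
      (hg'.congr fun r hr => by simp [show r ≠ 10 by omega]) (by omega)
      (by omega) hsr (hT _ (by have := hG.lc_lt (k + 1) (by omega) (by omega); omega))
      (hT _ (by have := hG.rc_lt (k + 1) (by omega) (by omega); omega)) (by simp)).mono ?_
    rintro σ₁ t₁ ⟨ht₁, hf₁, ha₁, hT₁⟩
    refine (rowTables_spec hW (by omega) hT₁ hq (hG.len_le _ (by omega) (by omega)) (by omega)
      (by omega) (by omega) (hG.eq _ (by omega) (by omega)) ?_).mono ?_
    · rw [ha₁]; exact hsr.len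
    rintro σ₂ t₂ ⟨ht₂, hf₂, ha₂, hx₂, hT₂⟩
    refine ⟨by omega, ?_, ?_, fun a h => ?_, fun i hi => ?_⟩
    · rw [hf₂ _ (by norm_num), hf₁ _ (by norm_num) (by norm_num) (by norm_num) (by norm_num)]
      simp [h9]
    · refine hg'.congr fun r hr => ?_
      rw [AState.set_reg, if_neg (by omega), hf₂ r (by omega),
        hf₁ r (by omega) (by omega) (by omega) (by omega), AState.set_reg, if_neg (by omega)]
    · rw [AState.set_arr, ha₂ a h, ha₁, AState.set_arr, ha a h]
    · rcases (show i ≤ k ∨ i = k + 1 by omega) with h | rfl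
      · have hlt := row_lt (R := R) (show i < k + 1 by omega)
        refine (hT i h).congr hq fun a _ _ x h1 h2 => ?_
        rw [AState.set_arr, hx₂ a x (by omega), ha₁, AState.set_arr]
      · exact hT₂
  · rintro σ' t ⟨ht, -, hg', ha, hT⟩
    have ht : t ≤ n * (q * (93 * q + 300) + 60) + 2 := ht
    exact ⟨ht, hg', ha, hT⟩

/-! ### The frequencies of the symbols -/

/-- A symbol that does not occur in the middle part contributes nothing there, and the greedy
selections in the outer parts do not interact. -/
theorem count_of_notMem {q z : ℕ} {Yl M Yr : List ℕ} (hz : z ∉ M)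
    (hgap : Yl = [] ∨ Yr = [] ∨ q - 1 ≤ M.length) :
    count q (hits (Yl ++ M ++ Yr) z) 0 = count q (hits Yl z) 0 + count q (hits Yr z) 0 := by
  have hM : ∀ b ∈ hits M z, b = false := by
    intro b hb
    obtain ⟨y, hy, rfl⟩ := List.mem_map.1 hb
    simp only [decide_eq_false_iff_not]
    rintro rfl
    exact hz hy
  rw [hits_append, hits_append, count_append, count_append, state_append, (of_all_false hM).1,
    (of_all_false hM).2, length_hits, add_zero]
  have hs : state q (hits Yl z) 0 ≤ q - 1 := state_le (Nat.zero_le _)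
  rcases hgap with rfl | rfl | h
  · simp [hits, state]
  · simp [hits, count]
  · rw [Nat.sub_eq_zero_of_le (by omega)]

/-- Update the frequencies of the symbols in the middle part of the row at register `11`, and pass
the number of occurrences of the row on to its factors. All frequencies are computed modulo the
number of words. -/
def freqRow : Cmd :=
  .forUp 22 16 (
    .ld 20 aNM (.add (.reg 11) (.reg 22)) ;; .set 21 (.const 0) ;; walk ;; .ld 24 aFQ (.reg 20) ;;
    .ld 25 aACC (.reg 11) ;;
    .st aNF (.reg 20)
      (.addW (.reg 24) (.mulW (.reg 25) (.subW (.reg 31) (.add (.reg 32) (.reg 33)))))) ;;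
  .forUp 22 16 (
    .ld 20 aNM (.add (.reg 11) (.reg 22)) ;; .ld 24 aNF (.reg 20) ;; .st aFQ (.reg 20) (.reg 24)) ;;
  .ld 24 aACC (.reg 11) ;;
  .ld 25 aACC (.reg 13) ;; .st aACC (.reg 13) (.addW (.reg 25) (.reg 24)) ;;
  .ld 25 aACC (.reg 15) ;; .st aACC (.reg 15) (.addW (.reg 25) (.reg 24))

/-- A name may occur several times in the middle part, but its frequency must be updated only once.
Hence the new frequencies are computed from the old ones into a separate array first, where writing
the same value repeatedly is harmless. -/
theorem freqRow_spec {W Z q v lb rb : ℕ} {σ : AState} {Yl M Yr : List ℕ} (hZ : Z < W)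
    (hqW : q + 10 < W) (hT : Triple q Z v lb rb Yl M Yr σ) (hq : 1 ≤ q) (hM : M.length ≤ q)
    (hlv : lb + q ≤ v) (hrv : rb + q ≤ v) (hv : v < Z) (hMZ : ∀ z ∈ M, z < Z)
    (hgap : Yl = [] ∨ Yr = [] ∨ q - 1 ≤ M.length) (hFW : ∀ z, σ.arr aFQ z < W) :
    WP W Z 27 freqRow (fun σ' t => t ≤ q * (31 * q + 70) + 9 ∧
      (∀ r < 20, σ'.reg r = σ.reg r) ∧ (∀ a < 23, σ'.arr a = σ.arr a) ∧
      (∀ z, σ'.arr aFQ z < W ∧ (σ'.arr aFQ z : ZMod W) = σ.arr aFQ z + σ.arr aACC v *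
        (count q (hits (Yl ++ M ++ Yr) z) 0 - count q (hits Yl z) 0 - count q (hits Yr z) 0)) ∧
      ∀ x, (σ'.arr aACC x : ZMod W) =
        σ.arr aACC x + (if x = lb then (σ.arr aACC v : ZMod W) else 0) +
        if x = rb then (σ.arr aACC v : ZMod W) else 0) σ := by
  -- `x` is the correct new frequency of `z`
  obtain ⟨good, hgood⟩ : ∃ good : ℕ → ℕ → Prop, good = fun z x => x < W ∧
    (x : ZMod W) = σ.arr aFQ z + σ.arr aACC v *
        (count q (hits (Yl ++ M ++ Yr) z) 0 - count q (hits Yl z) 0 -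
          count q (hits Yr z) 0) := ⟨_, rfl⟩
  have h11 := hT.r11
  have h13 := hT.r13
  have h15 := hT.r15
  have hvM := hT.hv
  have hlb := hT.hlb
  have hrb := hT.hrb
  have hNMZ : ∀ k < M.length, σ.arr aNM (v + k) < Z := fun k hk => hMZ _ (hT.hM.mem hk)
  rw [freqRow, wp_seq]
  refine (WP.forUp (fun k τ => (∀ r < 20, τ.reg r = σ.reg r) ∧ (∀ a, a ≠ aNF → τ.arr a = σ.arr a) ∧
      ∀ j < k, good (σ.arr aNM (v + j)) (τ.arr aNF (σ.arr aNM (v + j))))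
    M.length (31 * q + 60) (by omega) (by norm_num) ?_ ?_ ?_).mono ?_
  · exact ⟨fun r hr => by simp [show r ≠ 22 by omega], fun _ _ => rfl, by omega⟩
  · rintro k τ - ⟨hf, -⟩
    rw [hf _ (by norm_num), hT.r16]
  · rintro k τ hk h22 ⟨hf, ha, hgd⟩
    have hNM : τ.arr aNM = σ.arr aNM := ha _ (by norm_num)
    have hzZ := hNMZ k hk
    obtain ⟨z, hz⟩ : ∃ z, σ.arr aNM (v + k) = z := ⟨_, rfl⟩
    rw [hz] at hzZ
    simp (disch := omega) only [wp_seq, wp_ld, wp_set, HE.ok, HE.eval, AState.set_reg,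
      AState.set_arr, hf, h11, h22, hNM, hz, Nat.reduceEqDiff, if_false, if_true, true_and]
    repeat refine And.intro (by omega) ?_
    refine WP.mono (walk_spec (z := z) (d := 0) hZ ?_ ?_
      (hT.congr hq (fun r hr => ?_) ?_ hlv hrv fun a _ _ _ _ => ?_) hq (by omega)) ?_
    · simp
    · simp
    · simp [show r ≠ 20 by omega, show r ≠ 21 by omega, hf r hr]
    · simp [hNM]
    · simp [ha a (by omega)]
    rintro σ₁ t₁ ⟨ht₁, hf₁, ha₁, -, h31, h31M, h32, h33⟩
    have hf₁' : ∀ r < 20, σ₁.reg r = σ.reg r := fun r hr => by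
      rw [hf₁ r (by omega)]
      simp [show r ≠ 20 by omega, show r ≠ 21 by omega, hf r hr]
    have h20₁ : σ₁.reg 20 = z := by rw [hf₁ _ (by norm_num)]; simp
    have h22₁ : σ₁.reg 22 = k := by rw [hf₁ _ (by norm_num)]; simp [h22]
    rw [AState.set_arr, AState.set_arr] at ha₁
    simp (disch := omega) only [wp_seq, wp_ld, wp_set, wp_st, HE.ok, HE.eval, AState.set_reg,
      AState.set_arr, AState.put_reg, hf₁', h11, h20₁, h22₁, ha₁, ha, Nat.reduceEqDiff, if_false,
      if_true, true_and]
    repeat refine And.intro (by omega) ?_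
    refine ⟨fun r hr => ?_, fun a h1 => ?_, fun j hj => ?_⟩
    · simp [show r ≠ 22 by omega, show r ≠ 24 by omega, show r ≠ 25 by omega, hf₁' r hr]
    · rw [AState.put_arr_ne _ h1]
      simp [ha₁, ha a h1]
    · rw [AState.put_arr_same]
      split_ifs with h
      · rw [h, hgood]
        refine ⟨Nat.mod_lt _ (by omega), ?_⟩
        have h1 := congrArg (Nat.cast : ℕ → ZMod W) h31
        simp only [Nat.cast_add] at h1
        rw [ZMod.natCast_mod, Nat.cast_add, ZMod.natCast_mod, Nat.cast_mul, ZMod.natCast_mod,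
          Nat.cast_sub (by omega), Nat.cast_add, ZMod.natCast_self, Nat.cast_add]
        linear_combination (σ.arr 23 v : ZMod W) * h1
      · simp only [AState.set_arr, ha₁]
        refine hgd j ?_
        rcases (show j < k ∨ j = k by omega) with h' | rfl
        · exact h'
        · exact absurd hz h
  rintro σ₁ t₁ ⟨ht₁, -, hf₁, ha₁, hgd₁⟩
  rw [wp_seq]
  refine (WP.forUp (fun k τ => (∀ r < 20, τ.reg r = σ.reg r) ∧ (∀ a, a ≠ aFQ → τ.arr a = σ₁.arr a) ∧
      ∀ z, (∃ j < k, σ.arr aNM (v + j) = z) ∧ good z (τ.arr aFQ z) ∨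
        (∀ j < k, σ.arr aNM (v + j) ≠ z) ∧ τ.arr aFQ z = σ.arr aFQ z)
    M.length 3 (by omega) (by norm_num) ?_ ?_ ?_).mono ?_
  · refine ⟨fun r hr => by simp [show r ≠ 22 by omega, hf₁ r hr], fun _ _ => rfl,
      fun z => .inr ⟨by omega, ?_⟩⟩
    rw [AState.set_arr, ha₁ _ (by norm_num)]
  · rintro k τ - ⟨hf, -⟩
    rw [hf _ (by norm_num), hT.r16]
  · rintro k τ hk h22 ⟨hf, ha, hgd⟩
    have hNM : τ.arr aNM = σ.arr aNM := by rw [ha _ (by norm_num), ha₁ _ (by norm_num)]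
    have hzZ := hNMZ k hk
    have hgk := hgd₁ k hk
    obtain ⟨z, hz⟩ : ∃ z, σ.arr aNM (v + k) = z := ⟨_, rfl⟩
    rw [hz] at hzZ hgk
    simp (disch := omega) only [wp_seq, wp_ld, wp_set, wp_st, HE.ok, HE.eval, AState.set_reg,
      AState.set_arr, AState.put_reg, hf, h11, h22, hNM, hz, Nat.reduceEqDiff, if_false, if_true,
      true_and]
    repeat refine And.intro (by omega) ?_
    refine ⟨fun r hr => ?_, fun a h1 => ?_, fun y => ?_⟩
    · simp [show r ≠ 22 by omega, show r ≠ 24 by omega, show r ≠ 20 by omega, hf r hr]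
    · rw [AState.put_arr_ne _ h1]
      simp [ha a h1]
    · rw [AState.put_arr_same]
      split_ifs with h
      · subst h
        exact .inl ⟨⟨k, by omega, hz⟩, by rwa [ha _ (by norm_num)]⟩
      · simp only [AState.set_arr]
        rcases hgd y with ⟨⟨j, hj, hjy⟩, h2⟩ | ⟨h1, h2⟩
        · exact .inl ⟨⟨j, by omega, hjy⟩, h2⟩
        · refine .inr ⟨fun j hj => ?_, h2⟩
          rcases (show j < k ∨ j = k by omega) with h' | rfl
          · exact h1 j h'
          · rw [hz]; exact Ne.symm h
  rintro σ₂ t₂ ⟨ht₂, -, hf₂, ha₂, hgd₂⟩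
  have hAC : σ₂.arr aACC = σ.arr aACC := by rw [ha₂ _ (by norm_num), ha₁ _ (by norm_num)]
  simp (disch := omega) only [wp_seq, wp_ld, wp_set, wp_st, HE.ok, HE.eval, AState.set_reg,
    AState.set_arr, AState.put_reg, hf₂, h11, h13, h15, hAC, Nat.reduceEqDiff, if_false, if_true,
    true_and]
  repeat refine And.intro (by omega) ?_
  have hc : ∀ a b : ℕ, M.length * (a + 2) ≤ q * (a + 2) := fun a _ => Nat.mul_le_mul_right _ hM
  have h1 := hc (31 * q + 60) 0
  have h2 := hc 3 0
  refine ⟨?_, fun r hr => ?_, fun a h => ?_, fun z => ?_, fun x => ?_⟩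
  · have h3 : q * (31 * q + 70) = q * (31 * q + 60 + 2) + q * (3 + 2) + 3 * q := by ring
    omega
  · simp [show r ≠ 24 by omega, show r ≠ 25 by omega, hf₂ r hr]
  · rw [AState.put_arr_ne _ (by omega), AState.set_arr, AState.put_arr_ne _ (by omega)]
    simp [ha₂ a (by omega), ha₁ a (by omega)]
  · rw [AState.put_arr_ne _ (by norm_num), AState.set_arr, AState.put_arr_ne _ (by norm_num)]
    simp only [AState.set_arr]
    rcases hgd₂ z with ⟨-, h⟩ | ⟨h, h'⟩
    · rw [hgood] at h; exact h
    · have hzM : z ∉ M := by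
        intro hz
        obtain ⟨j, hj, hjz⟩ := List.mem_iff_getElem.1 hz
        have h3 := hT.hM.getElem? hj
        rw [List.getElem?_eq_getElem hj, hjz] at h3
        exact h j hj (Option.some.inj h3).symm
      rw [h', count_of_notMem hzM hgap]
      exact ⟨hFW z, by push_cast; ring⟩
  · rw [AState.put_arr_same, AState.set_arr, AState.put_arr_same, AState.put_arr_same]
    simp only [AState.set_arr, hAC]
    split_ifs <;> simp_all [ZMod.natCast_mod]

/-- The frequencies of all symbols. The rows are treated from the last one to the first one. -/
def freqs : Cmd :=
  .st aACC (.mul (.reg 0) (.reg 3)) (.const 1) ;;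
  .forUp 9 0 (.set 10 (.sub (.reg 0) (.reg 9)) ;; enter ;; freqRow)

/-- The invariant: the frequency computed so far, plus the sum over the rows that are still to be
treated of the number of occurrences times the frequency in the row, is the frequency in `Y n`. -/
theorem freqs_spec {n q R N Z W : ℕ} {lc rc : ℕ → ℕ} {M Y : ℕ → List ℕ} {σ : AState}
    (hS : Sizes n q R N Z W) (hG : SymSLP n q lc rc M Y) (hg : Globals n q R N Z σ)
    (hrow : ∀ i, 1 ≤ i → i ≤ n → SymRow R lc rc M σ.arr i)
    (hT : ∀ i ≤ n, Table q σ.arr (i * R) (Y i))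
    (hMZ : ∀ i, 1 ≤ i → i ≤ n → ∀ z ∈ M i, z < Z)
    (hzero : ∀ a, 23 ≤ a → ∀ x, σ.arr a x = 0) :
    WP W Z 27 freqs (fun σ' t => t ≤ n * (q * (31 * q + 70) + 20) + 3 ∧
      Globals n q R N Z σ' ∧ (∀ a < 23, σ'.arr a = σ.arr a) ∧
      ∀ z, σ'.arr aFQ z = count q (hits (Y n) z) 0 % W) σ := by
  have hNZ := hS.hZ
  have hR := hS.hR
  have hW := hS.hW
  have hW' := hS.hW'
  have hq := hS.hq
  have hnN := hS.n_le
  have hrn := hS.row_le le_rfl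
  have hinj : ∀ {i j : ℕ}, i * R = j * R ↔ i = j := fun {i j} =>
    ⟨fun h => Nat.eq_of_mul_eq_mul_right (by omega) h, fun h => h ▸ rfl⟩
  rw [freqs, wp_seq, wp_st]
  simp only [HE.ok, HE.eval, hg.r0, hg.r3, true_and]
  repeat refine And.intro (by omega) ?_
  refine (WP.forUp (fun k τ => Globals n q R N Z τ ∧ (∀ a < 23, τ.arr a = σ.arr a) ∧
      ∀ z, τ.arr aFQ z < W ∧ (τ.arr aFQ z : ZMod W) +
        ∑ j ∈ Finset.range (n - k + 1), (τ.arr aACC (j * R) : ZMod W) * count q (hits (Y j) z) 0 =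
          count q (hits (Y n) z) 0)
    n (q * (31 * q + 70) + 18) (by omega) (by norm_num) ?_ ?_ ?_).mono ?_
  · refine ⟨hg.congr fun r hr => by simp [show r ≠ 9 by omega], fun a h => ?_, fun z => ?_⟩
    · rw [AState.set_arr, AState.put_arr_ne _ (by omega)]
    · simp [AState.put_arr, hzero, hinj]
      omega
  · rintro k τ - ⟨hg', -⟩
    exact hg'.r0
  · rintro k τ hk h9 ⟨hg', ha, hF⟩
    obtain ⟨i, hi⟩ : ∃ i, n - k = i := ⟨_, rfl⟩
    obtain ⟨hl, hr⟩ : lc i < i ∧ rc i < i :=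
      ⟨hG.lc_lt i (by omega) (by omega), hG.rc_lt i (by omega) (by omega)⟩
    have hri := hS.row_le (i := i) (by omega)
    have hlc := row_lt (R := R) hl
    have hrc := row_lt (R := R) hr
    simp (disch := omega) only [wp_seq, wp_set, HE.ok, HE.eval, h9, hg'.r0, hi, true_and]
    repeat refine And.intro (by omega) ?_
    have hT' : ∀ j ≤ n, Table q τ.arr (j * R) (Y j) := fun j hj =>
      (hT j hj).congr hq fun a _ _ x _ _ => by rw [ha a (by omega)]
    refine (enter_spec (σ := τ.set 10 i) hS hG
      (hg'.congr fun r hr => by simp [show r ≠ 10 by omega]) (by omega) (by omega)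
      ((hrow i (by omega) (by omega)).congr fun a h => ha a (by omega)) (hT' _ (by omega))
      (hT' _ (by omega)) (by simp)).mono ?_
    rintro σ₁ t₁ ⟨ht₁, hf₁, ha₁, hT₁⟩
    rw [AState.set_arr] at ha₁
    refine (freqRow_spec hW (by omega) hT₁ hq (hG.len_le i (by omega) (by omega)) (by omega)
      (by omega) (by omega) (hMZ i (by omega) (by omega)) (hG.gap i (by omega) (by omega))
      (by rw [ha₁]; exact fun z => (hF z).1)).mono ?_
    rintro σ₂ t₂ ⟨ht₂, hf₂, ha₂, hF₂, hA₂⟩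
    rw [ha₁] at ha₂ hF₂ hA₂
    refine ⟨by omega, ?_, ?_, fun a h => ?_, fun z => ⟨(hF₂ z).1, ?_⟩⟩
    · rw [hf₂ _ (by norm_num), hf₁ _ (by norm_num) (by norm_num) (by norm_num) (by norm_num)]
      simp [h9]
    · refine hg'.congr fun r hr => ?_
      rw [AState.set_reg, if_neg (by omega), hf₂ r (by omega),
        hf₁ r (by omega) (by omega) (by omega) (by omega), AState.set_reg, if_neg (by omega)]
    · rw [AState.set_arr, ha₂ a h, ha a h]
    · -- the number of occurrences of row `i` moves to its factors
      have h1 := (hF z).2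
      rw [hi, Finset.sum_range_succ] at h1
      rw [AState.set_arr, (hF₂ z).2, ← h1, show n - (k + 1) + 1 = i by omega,
        ← hG.eq i (by omega) (by omega)]
      simp only [hA₂, add_mul, Finset.sum_add_distrib, ite_mul, zero_mul, hinj,
        Finset.sum_ite_eq', Finset.mem_range, hl, hr, if_true]
      ring
  · rintro σ' t ⟨ht, -, hg', ha, hF⟩
    have ht : t ≤ n * (q * (31 * q + 70) + 20) + 2 := ht
    refine ⟨by omega, hg', ha, fun z => ?_⟩
    obtain ⟨h1, h2⟩ := hF z
    rw [Nat.sub_self, zero_add, Finset.sum_range_one, hG.zero] at h2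
    -- only row `0` is left, which is empty
    have h3 : (σ'.arr aFQ z : ZMod W) = count q (hits (Y n) z) 0 := by
      simpa [hits, count] using h2
    rw [ZMod.natCast_eq_natCast_iff'] at h3
    rwa [Nat.mod_eq_of_lt h1] at h3

/-- Write the table of the results: for each symbol with a nonzero frequency, the address where the
symbol stands in the array `U` of strings, and the frequency. -/
def report : Cmd :=
  .set 8 (.const 0) ;;
  .forUp 9 5 (
    .ld 24 aFQ (.reg 9) ;;
    .ifEq (.reg 24) (.const 0) .skip
      (.st aOUT (.mul (.const 2) (.reg 8)) (.add (.mul (.const aU) (.reg 2)) (.reg 9)) ;;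
        .st aOUT (.add (.mul (.const 2) (.reg 8)) (.const 1)) (.reg 24) ;;
        .set 8 (.add (.reg 8) (.const 1)))) ;;
  .set 0 (.mul (.const aOUT) (.reg 2)) ;; .set 1 (.reg 8)

/-- `E` lists the symbols with a nonzero frequency; the `i`-th one fills the `i`-th pair of cells.
-/
theorem report_spec {n q R N Z W : ℕ} {σ : AState} (hS : Sizes n q R N Z W) (h27 : 27 * Z ≤ W)
    (hg : Globals n q R N Z σ) {E : List ℕ}
    (hE : E = (List.range N).filter fun e => σ.arr aFQ e ≠ 0) :
    WP W Z 27 report (fun σ' t => t ≤ 7 * N + 5 ∧ σ'.reg 0 = aOUT * Z ∧ σ'.reg 1 = E.length ∧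
      (∀ a, a ≠ aOUT → σ'.arr a = σ.arr a) ∧
      ∀ i < E.length, σ'.arr aOUT (2 * i) = aU * Z + E.getD i 0 ∧
        σ'.arr aOUT (2 * i + 1) = σ.arr aFQ (E.getD i 0)) σ := by
  have hNZ := hS.hZ
  have hW := hS.hW
  have hW' := hS.hW'
  rw [report, wp_seq, wp_set]
  refine ⟨by norm_num, by simp only [HE.ok]; omega, ?_⟩
  rw [wp_seq]
  refine (WP.forUp (fun k τ => (∀ r < 7, τ.reg r = σ.reg r) ∧ (∀ a, a ≠ aOUT → τ.arr a = σ.arr a) ∧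
      τ.reg 8 = ((List.range k).filter fun e => σ.arr aFQ e ≠ 0).length ∧ τ.reg 8 ≤ k ∧
      ∀ i < ((List.range k).filter fun e => σ.arr aFQ e ≠ 0).length,
        τ.arr aOUT (2 * i) =
          aU * Z + ((List.range k).filter fun e => σ.arr aFQ e ≠ 0).getD i 0 ∧
        τ.arr aOUT (2 * i + 1) =
          σ.arr aFQ (((List.range k).filter fun e => σ.arr aFQ e ≠ 0).getD i 0))
    N 5 (by omega) (by norm_num) ?_ ?_ ?_).mono ?_
  · exact ⟨fun r hr => by simp [show r ≠ 8 by omega, show r ≠ 9 by omega], fun _ _ => rfl,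
      by simp, by simp, by simp⟩
  · rintro k τ - ⟨hf, -⟩
    rw [hf _ (by norm_num), hg.r5]
  · rintro k τ hk h9 ⟨hf, ha, h8, h8k, hout⟩
    have h2 : τ.reg 2 = Z := by rw [hf _ (by norm_num), hg.r2]
    have hFQ : τ.arr aFQ = σ.arr aFQ := ha _ (by norm_num)
    rw [List.range_succ, List.filter_append]
    generalize (List.range k).filter (fun e => σ.arr aFQ e ≠ 0) = L at *
    simp (disch := omega) only [wp_seq, wp_ld, wp_set, wp_st, wp_ifEq, wp_skip, HE.ok, HE.eval,
      AState.set_reg, AState.set_arr, AState.put_reg, h9, h2, hFQ, h8, Nat.reduceEqDiff, if_false,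
      if_true, true_and]
    and_intros <;> try omega
    · intro h
      simp only [List.filter_cons, h, ne_eq, not_true_eq_false, decide_false, Bool.false_eq_true,
        if_false, List.filter_nil, List.append_nil, true_and]
      refine ⟨by omega, fun r hr => ?_, ha, by omega, hout⟩
      simp [show r ≠ 9 by omega, show r ≠ 24 by omega, hf r hr]
    · intro h
      simp only [List.filter_cons, h, ne_eq, not_false_eq_true, decide_true,
        if_true, List.filter_nil, List.length_append, List.length_singleton, true_and]
      and_intros <;> try omega
      · intro r hr
        simp [show r ≠ 9 by omega, show r ≠ 24 by omega, show r ≠ 8 by omega, hf r hr]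
      · intro a h1
        rw [AState.put_arr_ne _ h1, AState.put_arr_ne _ h1]
        exact ha a h1
      · intro i hi
        rw [AState.put_arr_same, AState.put_arr_same, AState.put_arr_same, AState.put_arr_same,
          AState.set_arr]
        rcases (show i < L.length ∨ i = L.length by omega) with h' | rfl
        · rw [if_neg (by omega), if_neg (by omega), if_neg (by omega), if_neg (by omega),
            List.getD_append _ _ _ _ h']
          exact hout i h'
        · rw [if_neg (by omega), if_pos rfl, if_pos rfl, List.getD_append_right _ _ _ _ le_rfl]
          simp
  · rintro σ₁ t₁ ⟨ht₁, -, hf₁, ha₁, h8₁, h8N, hout⟩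
    rw [← hE] at h8₁ hout
    have h2 : σ₁.reg 2 = Z := by rw [hf₁ _ (by norm_num), hg.r2]
    simp (disch := omega) only [wp_seq, wp_set, HE.ok, HE.eval, AState.set_reg, AState.set_arr, h2,
      h8₁, Nat.reduceEqDiff, if_false, if_true, true_and]
    exact ⟨by omega, by omega, by omega, by omega, ha₁, hout⟩

/-! ### The whole program -/

open Classical in
/-- The name of the string `P`: that of any position with key `P`, and `N` if there is none. -/
noncomputable def nameOf {γ : Type*} (N : ℕ) (κ : ℕ → γ) (nm : ℕ → ℕ) (P : γ) : ℕ :=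
  if h : ∃ e < N, κ e = P then nm h.choose else N

theorem Naming.nameOf_key {γ : Type*} {N e : ℕ} {κ : ℕ → γ} {nm : ℕ → ℕ} (h : Naming N κ nm)
    (he : e < N) : nameOf N κ nm (κ e) = nm e := by
  have hex : ∃ f < N, κ f = κ e := ⟨e, he, rfl⟩
  rw [nameOf, dif_pos hex]
  exact h.eq _ hex.choose_spec.1 e he hex.choose_spec.2

theorem Naming.nameOf_le {γ : Type*} {N : ℕ} {κ : ℕ → γ} {nm : ℕ → ℕ} (h : Naming N κ nm) (P : γ) :
    nameOf N κ nm P ≤ N := by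
  unfold nameOf
  split_ifs with hex
  · exact (h.lt _ hex.choose_spec.1).le
  · exact le_rfl

theorem Naming.nm_inj {γ : Type*} {N e f : ℕ} {κ : ℕ → γ} {nm : ℕ → ℕ} (h : Naming N κ nm)
    (he : e < N) (hf : f < N) : nm e = nm f ↔ κ e = κ f :=
  ⟨fun h1 => by rw [← h.key e he, h1, h.key f hf], h.eq e he f hf⟩

theorem length_cellGram (U : ℕ → ℕ) (q e : ℕ) : (cellGram U q e).length = q := by simp [cellGram]

/-- Counting names instead of strings gives the non-overlapping frequencies, and the positions with
a nonzero count are representatives of the strings that occur. -/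
theorem listsFrequencies_of_naming {T : List ℕ} {q N W : ℕ} {U nm F : ℕ → ℕ} (hq : 1 ≤ q)
    (hN : Naming N (cellGram U q) nm) (hcov : ∀ P ∈ grams q T, ∃ e < N, cellGram U q e = P)
    (hF : ∀ z, F z = count q (hits ((grams q T).map (nameOf N (cellGram U q) nm)) z) 0 % W)
    (hT : T.length < W) :
    WordRAM.ListsFrequencies T q
      (((List.range N).filter fun e => F e ≠ 0).map fun e => (cellGram U q e, F e)) := by
  -- names count like the strings they stand for
  have hval : ∀ e < N, F (nm e) = nOcc T (cellGram U q e) := by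
    intro e he
    have hhits : hits ((grams q T).map (nameOf N (cellGram U q) nm)) (nm e) =
        hits (grams q T) (cellGram U q e) := by
      simp only [hits, List.map_map]
      refine List.map_congr_left fun P hP => ?_
      obtain ⟨f, hf, rfl⟩ := hcov P hP
      simp only [Function.comp_apply, hN.nameOf_key hf, hN.nm_inj hf he]
    have h1 := nOcc_eq_count (T := T) (P := cellGram U q e) (by rw [length_cellGram]; exact hq)
    rw [length_cellGram] at h1
    rw [hF, hhits, ← h1, Nat.mod_eq_of_lt (lt_of_le_of_lt nOcc_le_length hT)]
  -- a symbol with a nonzero frequency is a name, and names are representatives of themselves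
  have hfix : ∀ e, F e ≠ 0 → e < N → nm e = e := by
    intro e he heN
    have hmem : e ∈ (grams q T).map (nameOf N (cellGram U q) nm) := by
      by_contra hno
      apply he
      rw [hF, (of_all_false ?_).2, Nat.zero_mod]
      intro b hb
      obtain ⟨y, hy, rfl⟩ := List.mem_map.1 hb
      simp only [decide_eq_false_iff_not]
      rintro rfl
      exact hno hy
    obtain ⟨P, hP, hPe⟩ := List.mem_map.1 hmem
    obtain ⟨f, hf, rfl⟩ := hcov P hP
    rw [hN.nameOf_key hf] at hPe
    rw [← hPe]
    exact (hN.nm_inj (hN.lt f hf) hf).2 (hN.key f hf)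
  refine ⟨?_, fun P f => ?_⟩
  · rw [List.map_map]
    refine List.Nodup.map_on (fun e he e' he' h => ?_) (List.nodup_range.filter _)
    simp only [List.mem_filter, List.mem_range, decide_eq_true_eq] at he he'
    rw [← hfix e he.2 he.1, ← hfix e' he'.2 he'.1]
    exact hN.eq e he.1 e' he'.1 h
  · simp only [List.mem_map, List.mem_filter, List.mem_range, decide_eq_true_eq, Prod.mk.injEq]
    constructor
    · rintro ⟨e, ⟨heN, he⟩, rfl, rfl⟩
      have h1 := hval e heN
      rw [hfix e he heN] at h1
      exact ⟨length_cellGram U q e, nOcc_ne_zero_iff.1 (h1 ▸ he), h1⟩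
    · rintro ⟨hPq, hocc, rfl⟩
      have hP : P ∈ grams q T := by
        rw [← hPq]; exact (Occ_nonempty_iff (by omega)).1 hocc
      obtain ⟨e, he, rfl⟩ := hcov P hP
      refine ⟨nm e, ⟨hN.lt e he, ?_⟩, hN.key e he, hval e he⟩
      rw [hval e he]
      exact nOcc_ne_zero_iff.2 hocc

/-- If there is a middle letter, both factors are empty, so `grams_append` covers the other case. -/
theorem grams_row {n q : ℕ} {lc rc : ℕ → ℕ} {mid X : ℕ → List ℕ} (hq : 1 ≤ q)
    (hG : RowSLP n lc rc mid X) {i : ℕ} (h1 : 1 ≤ i) (hn : i ≤ n) :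
    grams q (X i) = grams q (X (lc i)) ++ grams q (window q (X (lc i)) (mid i) (X (rc i))) ++
      grams q (X (rc i)) := by
  rw [hG.eq i h1 hn]
  rcases hG.leaf i h1 hn with h | ⟨hl, hr⟩
  · rw [h, List.append_nil, grams_append hq, window, List.append_nil]
  · rw [hl, hr, hG.zero]
    simp [window, grams]

theorem WindowAt.grams_getElem? {q v k : ℕ} {A : ℕ → ℕ → ℕ} {U : List ℕ} (h : WindowAt q A v U)
    (hq : 1 ≤ q) (hk : k + q ≤ U.length) : (grams q U)[k]? = some (cellGram (A aU) q (v + k)) := by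
  rw [_root_.grams_getElem? hq, if_pos hk, Option.some.injEq]
  refine List.ext_getElem? fun d => ?_
  by_cases hd : d < q
  · rw [List.getElem?_take, if_pos hd, List.getElem?_drop, h.row.getElem? (by omega)]
    simp [cellGram, hd, add_assoc]
  · rw [List.getElem?_eq_none (by simp; omega), List.getElem?_eq_none (by simp [cellGram]; omega)]

/-- Every `q`-gram of a row stands somewhere in the array of windows. -/
theorem exists_cellGram {n q R N Z W : ℕ} {lc rc : ℕ → ℕ} {mid X : ℕ → List ℕ} {A : ℕ → ℕ → ℕ}
    (hS : Sizes n q R N Z W) (hG : RowSLP n lc rc mid X)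
    (hwin : ∀ i, 1 ≤ i → i ≤ n →
      WindowAt q A (i * R) (window q (X (lc i)) (mid i) (X (rc i)))) (i : ℕ) (hi : i ≤ n) :
    ∀ P ∈ grams q (X i), ∃ e < N, cellGram (A aU) q e = P := by
  induction i using Nat.strong_induction_on with
  | h i ih =>
    intro P hP
    rcases Nat.eq_zero_or_pos i with rfl | h1
    · simp [hG.zero, grams] at hP
    · have hlc := hG.lc_lt i h1 hi
      have hrc := hG.rc_lt i h1 hi
      rw [grams_row hS.hq hG h1 hi, List.mem_append, List.mem_append] at hP
      rcases hP with (hP | hP) | hP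
      · exact ih _ hlc (by omega) P hP
      · obtain ⟨k, hk⟩ := List.mem_iff_getElem?.1 hP
        have hkq : k + q ≤ (window q (X (lc i)) (mid i) (X (rc i))).length := by
          rw [_root_.grams_getElem? hS.hq] at hk
          by_contra hno
          rw [if_neg hno] at hk
          simp at hk
        rw [(hwin i h1 hi).grams_getElem? hS.hq hkq, Option.some.injEq] at hk
        refine ⟨i * R + k, ?_, hk⟩
        have := hS.row_le hi
        have := length_window_le (Xl := X (lc i)) (Xr := X (rc i)) hS.hq (hG.mid_le i h1 hi)
        have := hS.hR
        omega
      · exact ih _ hrc (by omega) P hP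

/-- The names of the `q`-grams are composed like the strings. -/
theorem RowSLP.symSLP {n q : ℕ} {lc rc : ℕ → ℕ} {mid X : ℕ → List ℕ} (hq : 1 ≤ q)
    (hG : RowSLP n lc rc mid X) (name : List ℕ → ℕ) :
    SymSLP n q lc rc (fun i => (grams q (window q (X (lc i)) (mid i) (X (rc i)))).map name)
      fun i => (grams q (X i)).map name where
  zero := by simp [hG.zero, grams]
  lc_lt := hG.lc_lt
  rc_lt := hG.rc_lt
  eq i h1 hn := by simp only [grams_row hq hG h1 hn, List.map_append]
  len_le i h1 hn := by
    have := length_window_le (Xl := X (lc i)) (Xr := X (rc i)) hq (hG.mid_le i h1 hn)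
    rw [List.length_map, length_grams hq]
    omega
  gap i h1 hn := by
    by_cases hl : (X (lc i)).length < q
    · exact .inl (by rw [grams_eq_nil hq hl, List.map_nil])
    by_cases hr : (X (rc i)).length < q
    · exact .inr (.inl (by rw [grams_eq_nil hq hr, List.map_nil]))
    · refine .inr (.inr ?_)
      rw [List.length_map, length_grams hq]
      simp only [window, List.length_append, List.length_drop, List.length_take]
      omega

/-- The names at the positions of the window of row `i` are the names of its `q`-grams. The same
cell `aWL` serves as the number of the `q`-grams and as the length of the middle part `M i`. -/
theorem symRow_of_windowAt {n q R N Z W i : ℕ} {lc rc nm : ℕ → ℕ} {mid X : ℕ → List ℕ}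
    {A A' : ℕ → ℕ → ℕ} (hS : Sizes n q R N Z W) (hG : RowSLP n lc rc mid X) (h1 : 1 ≤ i)
    (hn : i ≤ n) (hrow : RowData n R Z lc rc mid A i)
    (hwin : WindowAt q A (i * R) (window q (X (lc i)) (mid i) (X (rc i))))
    (hN : Naming N (cellGram (A aU) q) nm) (hA' : ∀ a < aNM, A' a = A a) (hnm : A' aNM = nm) :
    SymRow R lc rc (fun i => (grams q (window q (X (lc i)) (mid i) (X (rc i)))).map
      (nameOf N (cellGram (A aU) q) nm)) A' i where
  lc := by rw [hA' _ (by norm_num), hrow.lc]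
  rc := by rw [hA' _ (by norm_num), hrow.rc]
  row := by
    intro k hk
    rw [List.length_map, length_grams hS.hq] at hk
    have hlen := length_window_le (Xl := X (lc i)) (Xr := X (rc i)) hS.hq (hG.mid_le i h1 hn)
    have := hS.row_le hn
    have := hS.hR
    rw [List.getD_eq_getElem?_getD, List.getElem?_map, hwin.grams_getElem? hS.hq (by omega),
      Option.map_some, hN.nameOf_key (by omega), hnm]
    rfl
  len := by rw [hA' _ (by norm_num), hwin.len, List.length_map, length_grams hS.hq]

/-- The whole computation, after the size of the arrays has been put into register `2`. -/
def program : Cmd := setup ;; strings ;; names ;; tables ;; freqs ;; report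

/-- The time is dominated by the naming, with `O(c * q)` passes over `O(q * n)` positions, and by
the `O(q * n)` walks for the tables and the frequencies. -/
theorem program_spec {n q R N Z W c : ℕ} {lc rc : ℕ → ℕ} {mid X : ℕ → List ℕ} {σ : AState}
    (hS : Sizes n q R N Z W) (h27 : 27 * Z ≤ W) (hG : RowSLP n lc rc mid X)
    (h0 : σ.reg 0 = n) (h1 : σ.reg 1 = q) (h2 : σ.reg 2 = Z)
    (hzero : ∀ a, 1 ≤ a → ∀ x, σ.arr a x = 0)
    (hin : ∀ i < n,
      (σ.arr aIN (3 * i) = 0 ∧ mid (i + 1) = [σ.arr aIN (3 * i + 1)] ∧ lc (i + 1) = 0 ∧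
        rc (i + 1) = 0) ∨
      (σ.arr aIN (3 * i) ≠ 0 ∧ mid (i + 1) = [] ∧ lc (i + 1) = σ.arr aIN (3 * i + 1) + 1 ∧
        rc (i + 1) = σ.arr aIN (3 * i + 2) + 1))
    (hletter : ∀ i, 1 ≤ i → i ≤ n → ∀ a ∈ X i, a < (n + q) ^ c ∧ a < W) (hX : (X n).length < W) :
    WP W Z 27 program (fun σ' t => t ≤ 105 * (c * (q ^ 2 * n)) + 844 * (q ^ 2 * n) ∧
      σ'.reg 0 = aOUT * Z ∧ ∃ E : List ℕ, σ'.reg 1 = E.length ∧ E.length ≤ N ∧ (∀ e ∈ E, e < N) ∧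
      (∀ i < E.length, σ'.arr aOUT (2 * i) = aU * Z + E.getD i 0 ∧
        σ'.arr aOUT (2 * i + 1) = σ'.arr aFQ (E.getD i 0)) ∧
      WordRAM.ListsFrequencies (X n) q
        (E.map fun e => (cellGram (σ'.arr aU) q e, σ'.arr aFQ e))) σ := by
  have hn := hS.hn
  have hq := hS.hq
  have hNZ := hS.hZ
  rw [program, wp_seq]
  refine (setup_spec hS hG h0 h1 h2 hzero hin).mono ?_
  rintro σ₁ t₁ ⟨ht₁, hg₁, hrow₁, hz₁⟩
  rw [wp_seq]
  refine (strings_spec (good := fun a => a < (n + q) ^ c ∧ a < W) hS hG hg₁ hrow₁ hz₁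
    ⟨by positivity, by have := hS.hW'; omega⟩ hletter).mono ?_
  rintro σ₂ t₂ ⟨ht₂, hg₂, hrow₂, hwin₂, hgood₂, hz₂⟩
  rw [wp_seq]
  refine (names_spec hS hg₂ (fun x _ => (hgood₂ x).1) (fun x _ => (hgood₂ x).2)
    (hz₂ _ (by norm_num))).mono ?_
  rintro σ₃ t₃ ⟨ht₃, hf₃, ha₃, hN⟩
  have hg₃ := hg₂.congr hf₃
  have hsym := hG.symSLP hq (nameOf N (cellGram (σ₂.arr aU) q) (σ₃.arr aNM))
  have hsr : ∀ i, 1 ≤ i → i ≤ n → SymRow R lc rc _ σ₃.arr i := fun i h1 h2 =>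
    symRow_of_windowAt hS hG h1 h2 (hrow₂ i h1 h2) (hwin₂ i h1 h2) hN
      (fun a h => ha₃ a (.inl h)) rfl
  rw [wp_seq]
  refine (tables_spec hS hsym hg₃ hsr fun a h x => by
    rw [ha₃ a (.inr (by omega)), hz₂ a (by omega)]).mono ?_
  rintro σ₄ t₄ ⟨ht₄, hg₄, ha₄, hT₄⟩
  rw [wp_seq]
  refine (freqs_spec hS hsym hg₄ (fun i h1 h2 => (hsr i h1 h2).congr fun a h => ha₄ a (by omega))
    hT₄ (fun i _ _ z hz => ?_) fun a h x => by
      rw [ha₄ a (by omega), ha₃ a (.inr (by omega)), hz₂ a (by omega)]).mono ?_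
  · obtain ⟨P, -, rfl⟩ := List.mem_map.1 hz
    have := hN.nameOf_le P
    omega
  rintro σ₅ t₅ ⟨ht₅, hg₅, ha₅, hF₅⟩
  refine (report_spec hS h27 hg₅ rfl).mono ?_
  rintro σ₆ t₆ ⟨ht₆, hr0, hr1, ha₆, hout⟩
  have hU : σ₆.arr aU = σ₂.arr aU := by
    rw [ha₆ _ (by norm_num), ha₅ _ (by norm_num), ha₄ _ (by norm_num), ha₃ _ (by norm_num)]
  have hFQ : σ₆.arr aFQ = σ₅.arr aFQ := ha₆ _ (by norm_num)
  refine ⟨?_, hr0, _, hr1, (List.length_filter_le _ _).trans (by simp), fun e he => ?_, ?_, ?_⟩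
  · obtain ⟨A, hA⟩ : ∃ A, q ^ 2 * n = A := ⟨_, rfl⟩
    have e1 : q ≤ q * n := Nat.le_mul_of_pos_right q hn
    have e2 : n ≤ q * n := Nat.le_mul_of_pos_left n hq
    have e3 : q * n ≤ A := by rw [← hA, sq, mul_assoc]; exact Nat.le_mul_of_pos_left _ hq
    have e4 : q * q ≤ A := by rw [← hA, sq]; exact Nat.le_mul_of_pos_right _ hn
    have e5 : N = 2 * (q * n) + 2 * q := by rw [hS.hN, hS.hR]; ring
    have e6 : q * (20 * N + 7 * (n + q) + 11) ≤ 105 * A := by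
      have : q * (20 * N + 7 * (n + q) + 11) =
          40 * (q ^ 2 * n) + 47 * (q * q) + 7 * (q * n) + 11 * q := by rw [e5]; ring
      omega
    have e7 : q * (c * (20 * N + 7 * (n + q) + 11) + 5) ≤ 105 * (c * A) + 5 * q := by
      have h3 := Nat.mul_le_mul_left c e6
      have h4 : q * (c * (20 * N + 7 * (n + q) + 11) + 5) =
          c * (q * (20 * N + 7 * (n + q) + 11)) + 5 * q := by ring
      have h5 : c * (105 * A) = 105 * (c * A) := by ring
      omega
    have e8 : n * (36 * q + 103) = 36 * (q * n) + 103 * n := by ring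
    have e9 : n * (q * (93 * q + 300) + 60) = 93 * A + 300 * (q * n) + 60 * n := by
      rw [← hA]; ring
    have e10 : n * (q * (31 * q + 70) + 20) = 31 * A + 70 * (q * n) + 20 * n := by
      rw [← hA]; ring
    rw [hA]
    omega
  · exact List.mem_range.1 (List.mem_of_mem_filter he)
  · rw [hFQ]; exact hout
  · rw [hU, hFQ]
    exact listsFrequencies_of_naming hq hN (exists_cellGram hS hG hwin₂ n le_rfl) hF₅ hX

end ArrayProg

/-! ### From straight line programs to rows -/

/-- The row of the first factor, or `0`. -/
def SLPExpr.leftRow {α : Type*} {i : ℕ} : SLPExpr α i → ℕ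
  | .letter _ => 0
  | .pair l _ => l + 1

/-- The row of the second factor, or `0`. -/
def SLPExpr.rightRow {α : Type*} {i : ℕ} : SLPExpr α i → ℕ
  | .letter _ => 0
  | .pair _ r => r + 1

/-- The string of a letter; it is empty for a pair. -/
def SLPExpr.middle {α : Type*} {i : ℕ} : SLPExpr α i → List α
  | .letter a => [a]
  | .pair _ _ => []

namespace SLP

variable {α : Type*}

/-- Extend a function on the variables to the rows `0, 1, …`, where row `i + 1` belongs to variable
`i`, and rows without variable get the value `d`. -/
def onRows {β : Type*} (G : SLP α) (d : β) (f : Fin G.size → β) : ℕ → β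
  | 0 => d
  | i + 1 => if h : i < G.size then f ⟨i, h⟩ else d

theorem onRows_succ {β : Type*} {G : SLP α} {d : β} {f : Fin G.size → β} {i : ℕ} (h : i < G.size) :
    G.onRows d f (i + 1) = f ⟨i, h⟩ := by simp [onRows, h]

theorem onRows_last (G : SLP α) : G.onRows [] G.val G.size = G.text := by
  obtain ⟨k, hk⟩ := Nat.exists_eq_succ_of_ne_zero G.size_pos.ne'
  have h : G.onRows [] G.val (k + 1) = G.val ⟨k, by omega⟩ := onRows_succ _
  rw [hk, Nat.succ_eq_add_one, h, text]
  congr 2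
  omega

/-- The uniform shape of a straight line program. -/
theorem rowSLP (G : SLP ℕ) : ArrayProg.RowSLP G.size (G.onRows 0 fun i => (G.rhs i).leftRow)
    (G.onRows 0 fun i => (G.rhs i).rightRow) (G.onRows [] fun i => (G.rhs i).middle)
    (G.onRows [] G.val) := by
  have key : ∀ k, ∀ h : k < G.size,
      (G.rhs ⟨k, h⟩).leftRow < k + 1 ∧ (G.rhs ⟨k, h⟩).rightRow < k + 1 ∧
      G.val ⟨k, h⟩ = G.onRows [] G.val (G.rhs ⟨k, h⟩).leftRow ++ (G.rhs ⟨k, h⟩).middle ++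
        G.onRows [] G.val (G.rhs ⟨k, h⟩).rightRow ∧ (G.rhs ⟨k, h⟩).middle.length ≤ 1 ∧
      ((G.rhs ⟨k, h⟩).middle = [] ∨
        ((G.rhs ⟨k, h⟩).leftRow = 0 ∧ (G.rhs ⟨k, h⟩).rightRow = 0)) := by
    intro k h
    rw [val]
    rcases G.rhs ⟨k, h⟩ with a | ⟨l, r⟩
    · simp [SLPExpr.leftRow, SLPExpr.rightRow, SLPExpr.middle, onRows]
    · have hl := l.isLt
      have hr := r.isLt
      simp only at hl hr
      simp [SLPExpr.leftRow, SLPExpr.rightRow, SLPExpr.middle, onRows, hl, hr, hl.trans h,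
        hr.trans h]
  refine ⟨rfl, ?_, ?_, ?_, ?_, ?_⟩ <;> intro i h1 h2 <;>
    obtain ⟨k, rfl⟩ := Nat.exists_eq_succ_of_ne_zero (by omega : i ≠ 0) <;>
    obtain ⟨k1, k2, k3, k4, k5⟩ := key k h2 <;> simp only [Nat.succ_eq_add_one, onRows_succ h2]
  · exact k1
  · exact k2
  · exact k3
  · exact k4
  · exact k5

/-- Every letter of a derived string stems from an assignment. -/
theorem exists_letter_of_mem_val {G : SLP α} {a : α} (k : ℕ) (hk : k < G.size)
    (ha : a ∈ G.val ⟨k, hk⟩) : ∃ i, G.rhs i = .letter a := by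
  induction k using Nat.strong_induction_on with
  | h k ih =>
    rw [val] at ha
    rcases hr : G.rhs ⟨k, hk⟩ with b | ⟨l, r⟩ <;> rw [hr] at ha
    · obtain rfl : a = b := by simpa using ha
      exact ⟨_, hr⟩
    · rcases List.mem_append.1 ha with h | h
      · exact ih _ l.isLt _ h
      · exact ih _ r.isLt _ h

end SLP

namespace ArrayProg

open WordRAM

/-- The size `4 * q * (n + 2)` of the arrays. -/
def arraySize : HE := .mul (.const 4) (.mul (.reg 1) (.add (.reg 0) (.const 2)))

/-- The word RAM program that computes the frequencies. -/
def ramProgram : Prog := .seq (.assign 2 arraySize.compile) program.compile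

/-- There are `27` arrays of size `4 * q * (n + 2) ≤ 12 * q * n`, so a memory of `2000 * q * n`
cells suffices. The time bound of `program_spec` gets multiplied by the slowdown `program.stepCost`,
which does not depend on the input. -/
theorem ramProgram_spec (c : ℕ) (G : SLP ℕ) (q w : ℕ) (hq : 1 ≤ q)
    (hletter : ∀ (i : Fin G.size) (a : ℕ), G.rhs i = .letter a →
      a < (G.size + q) ^ c ∧ a < 2 ^ w) (hT : G.text.length < 2 ^ w)
    (hC : (2000 + program.stepCost * (900 * (c + 1))) * (q * G.size) ≤ 2 ^ w) :
    ∃ (t : ℕ) (s : State),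
      Exec w ((2000 + program.stepCost * (900 * (c + 1))) * (q * G.size)) ramProgram
        (input G q) t s ∧
      t ≤ (2000 + program.stepCost * (900 * (c + 1))) * (q ^ 2 * G.size) ∧
      s.OutputInMemory q ((2000 + program.stepCost * (900 * (c + 1))) * (q * G.size)) ∧
      ListsFrequencies G.text q (s.output q) := by
  obtain ⟨M, hM⟩ : ∃ M, program.stepCost = M := ⟨_, rfl⟩
  have hn1 : 1 ≤ G.size := G.size_pos
  rw [hM] at hC ⊢
  obtain ⟨S, hS⟩ : ∃ S, (2000 + M * (900 * (c + 1))) * (q * G.size) = S := ⟨_, rfl⟩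
  rw [hS] at hC ⊢
  have hqn : q ≤ q * G.size := Nat.le_mul_of_pos_right q hn1
  have hnq : G.size ≤ q * G.size := Nat.le_mul_of_pos_left G.size hq
  have hS2 : 2000 * (q * G.size) ≤ S := by rw [← hS]; exact Nat.mul_le_mul_right _ (by omega)
  obtain ⟨Z, hZ⟩ : ∃ Z, 4 * (q * (G.size + 2)) = Z := ⟨_, rfl⟩
  have hZ' : Z = 4 * (q * G.size) + 8 * q := by rw [← hZ]; ring
  have hZn : 4 * G.size + 8 ≤ Z := by omega
  have hsz : Sizes G.size q (2 * q) ((G.size + 1) * (2 * q)) Z (2 ^ w) :=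
    ⟨hn1, hq, rfl, rfl, by rw [hZ']; ring, by omega, by omega⟩
  have hq2 : q * (G.size + 2) = q * G.size + 2 * q := by ring
  have hsize : arraySize.compile.eval w (input G q).reg = Z := by
    rw [HE.eval_compile]
    · simp [arraySize, input, hZ]
    · simp only [arraySize, HE.ok, HE.eval, input, if_true, true_and]
      norm_num
      omega
  -- the state after the first step, in which array `a` starts at address `a * Z`
  let s₁ : State := ⟨Function.update (input G q).reg 2 Z, (input G q).mem⟩
  let σ : AState := ⟨s₁.reg, fun a x => s₁.mem (a * Z + x)⟩
  have hrep : Rep Z 27 s₁ σ := ⟨rfl, by simp [s₁], fun _ _ _ _ => rfl⟩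
  have hzero : ∀ a, 1 ≤ a → ∀ x, σ.arr a x = 0 := by
    intro a ha x
    have h1 : Z ≤ a * Z := Nat.le_mul_of_pos_left Z ha
    simp only [σ, s₁, input]
    rw [dif_neg]
    omega
  have hin : ∀ i < G.size,
      (σ.arr 0 (3 * i) = 0 ∧
        G.onRows [] (fun i => (G.rhs i).middle) (i + 1) = [σ.arr 0 (3 * i + 1)] ∧
        G.onRows 0 (fun i => (G.rhs i).leftRow) (i + 1) = 0 ∧
        G.onRows 0 (fun i => (G.rhs i).rightRow) (i + 1) = 0) ∨
      (σ.arr 0 (3 * i) ≠ 0 ∧ G.onRows [] (fun i => (G.rhs i).middle) (i + 1) = [] ∧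
        G.onRows 0 (fun i => (G.rhs i).leftRow) (i + 1) = σ.arr 0 (3 * i + 1) + 1 ∧
        G.onRows 0 (fun i => (G.rhs i).rightRow) (i + 1) = σ.arr 0 (3 * i + 2) + 1) := by
    intro i hi
    have hcell : ∀ x < Z, σ.arr 0 x = (input G q).mem x := fun x _ => by simp [σ, s₁]
    have hm : ∀ d < 3, σ.arr 0 (3 * i + d) = encodeRhs (G.rhs ⟨i, hi⟩) d := by
      intro d hd
      have h3 : (3 * i + d) / 3 = i := by omega
      have h4 : (3 * i + d) % 3 = d := by omega
      rw [hcell _ (by omega)]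
      simp only [input, h4]
      rw [dif_pos (by omega)]
      congr 3
    have hm0 := hm 0 (by norm_num)
    rw [add_zero] at hm0
    rw [hm0, hm 1 (by norm_num), hm 2 (by norm_num)]
    simp only [SLP.onRows_succ hi]
    rcases G.rhs ⟨i, hi⟩ with a | ⟨l, r⟩
    · simp [encodeRhs, SLPExpr.middle, SLPExpr.leftRow, SLPExpr.rightRow]
    · simp [encodeRhs, SLPExpr.middle, SLPExpr.leftRow, SLPExpr.rightRow]
  have hlet : ∀ i, 1 ≤ i → i ≤ G.size → ∀ a ∈ G.onRows [] G.val i,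
      a < (G.size + q) ^ c ∧ a < 2 ^ w := by
    intro i h1 h2 a ha
    obtain ⟨k, rfl⟩ := Nat.exists_eq_succ_of_ne_zero (by omega : i ≠ 0)
    rw [Nat.succ_eq_add_one, SLP.onRows_succ h2] at ha
    obtain ⟨j, hj⟩ := SLP.exists_letter_of_mem_val k h2 ha
    exact hletter j a hj
  obtain ⟨t, σ', hrun, ht, hr0, E, hr1, hEN, hE, hout, hL⟩ :=
    program_spec (c := c) (σ := σ) hsz (by omega) G.rowSLP (by simp [σ, s₁, input])
      (by simp [σ, s₁, input]) (by simp [σ, s₁]) hzero hin hlet (by rwa [SLP.onRows_last])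
  obtain ⟨t', s', hexec, ht', hrep'⟩ := hrun.simulate (S := S) (M := M) (by omega) hC (by omega)
    hM.le hrep
  have hmem := hrep'.mem
  have hN2 := hsz.hZ
  have hE' : ∀ i < E.length, E.getD i 0 < (G.size + 1) * (2 * q) := fun i hi => hE _ (by
    rw [List.getD_eq_getElem _ _ hi]; exact List.getElem_mem hi)
  have ho1 : ∀ i < E.length, s'.mem (26 * Z + 2 * i) = 9 * Z + E.getD i 0 := fun i hi => by
    rw [hmem _ (by norm_num) _ (by omega), (hout i hi).1]
  have ho2 : ∀ i < E.length, s'.mem (26 * Z + 2 * i + 1) = σ'.arr 24 (E.getD i 0) := fun i hi => by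
    rw [add_assoc, hmem _ (by norm_num) _ (by omega), (hout i hi).2]
  refine ⟨_, s', .seq (.assign 2 _ _) (by rw [hsize]; exact hexec), ?_, ?_, ?_⟩
  · have h1 := Nat.mul_le_mul_left M ht
    have h2 : 8 ≤ 2000 * (q ^ 2 * G.size) := by
      have : 1 ≤ q ^ 2 * G.size := Nat.mul_pos (pow_pos hq 2) hn1
      omega
    have h3 : M * (105 * (c * (q ^ 2 * G.size)) + 844 * (q ^ 2 * G.size)) ≤
        M * (900 * (c + 1)) * (q ^ 2 * G.size) := by
      rw [mul_assoc]
      refine Nat.mul_le_mul_left M ?_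
      have : 900 * (c + 1) * (q ^ 2 * G.size) =
          900 * (c * (q ^ 2 * G.size)) + 900 * (q ^ 2 * G.size) := by ring
      omega
    have h4 : arraySize.compile.cost = 7 := rfl
    rw [add_mul]
    omega
  · intro k hk
    rw [hrep'.reg, hr1] at hk
    rw [hrep'.reg, hr0, ho1 k hk]
    have := hE' k hk
    omega
  · convert hL using 1
    · rw [SLP.onRows_last]
    · rw [State.output, hrep'.reg, hr0, hr1]
      refine List.ext_getElem (by simp) fun k h1 h2 => ?_
      have hk : k < E.length := by simpa using h2
      have hg := List.getD_eq_getElem E 0 hk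
      have hlt := hE' k hk
      simp only [List.getElem_map, List.getElem_range, ho1 k hk, ho2 k hk, hg]
      rw [hg] at hlt
      congr 1
      refine List.map_congr_left fun d hd => ?_
      rw [List.mem_range] at hd
      rw [add_assoc, hmem _ (by norm_num) _ (by omega)]

end ArrayProg

theorem mainTheorem1 :
    ∃ p : WordRAM.Prog, ∀ c : ℕ, ∃ C : ℕ, ∀ (G : SLP ℕ) (q w : ℕ), 1 ≤ q →
      (∀ (i : Fin G.size) (a : ℕ), G.rhs i = .letter a → a < (G.size + q) ^ c ∧ a < 2 ^ w) →
      G.text.length < 2 ^ w →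
      C * (q * G.size) ≤ 2 ^ w →
      ∃ (t : ℕ) (s : WordRAM.State),
        WordRAM.Exec w (C * (q * G.size)) p (WordRAM.input G q) t s ∧
        t ≤ C * (q ^ 2 * G.size) ∧
        s.OutputInMemory q (C * (q * G.size)) ∧
        WordRAM.ListsFrequencies G.text q (s.output q) :=
  ⟨ArrayProg.ramProgram, fun c => ⟨_, fun G q w => ArrayProg.ramProgram_spec c G q w⟩⟩
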